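/- Fix an integer $q\ge 2$ and let $D=\{-q+1,\dots,q-1\}$. A \emph{dag} $\Pi=(\Gamma,\delta)$ consists of a finite node set $\Gamma$ and a map $\delta:\Gamma\times\Gamma\to D$ such that the directed graph with edge set $\{(u,v):\delta(u,v)\ne 0\}$ is acyclic. A \emph{marking} of $\Pi$ is a map $M:\Gamma\to D$. The values of nodes and markings are the real numbers defined recursively by $\varepsilon(M)=\sum_{u\in\Gamma}M(u)\,\varepsilon(u)$ and $\varepsilon(u)=q^{\varepsilon(\Lambda_u)}$, where $\Lambda_u(v)=\delta(u,v)$. The dag $\Pi$ is a \emph{power circuit} if $\varepsilon(u)\in\{q^k:k\in\mathbb N\}$ for every $u\in\Gamma$. A \emph{reduced power circuit} is a power circuit in which different nodes have different values, together with the list $(u_1,\dots,u_N)$ of all its nodes sorted by value, $\varepsilon(u_1)<\dots<\varepsilon(u_N)$, and a bit vector $(b_1,\dots,b_{N-1})$ with $b_i=1$ if and only if $q\cdot\varepsilon(u_i)=\varepsilon(u_{i+1})$. Time is counted on a unit-cost random-access machine whose words hold $O(\log(|\Gamma|+m+2))$ bits, where $m$ is the number of input markings; inputs and outputs are stored as tables;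 $\tilde O(f)$ means $O\bigl((f+1)\log^k(f+2)\bigr)$ for some $k$; and all implied constants depend only on $q$. Theorem. There is a random-access machine program $\mathrm{Reduce}$ (for the given $q$) with the following properties. (1) Given a power circuit $\Pi=(\Gamma,\delta)$ and a list $M_1,\dots,M_m$ of markings of $\Pi$, it halts after $\tilde O(|\Gamma|^2+|\Gamma|\cdot m)$ steps and returns a reduced power circuit $\Pi'=(\Gamma',\delta')$ (with its sorted node list and its bit vector) and a list $M_1',\dots,M_m'$ of markings of $\Pi'$ such that $\varepsilon(M_i')=\varepsilon(M_i)$ for $1\le i\le m$ and $|\Gamma'|\le 2|\Gamma|$. (2) Given an arbitrary dag $\Pi=(\Gamma,\delta)$ and no markings, the same program halts after $\tilde O(|\Gamma|^2)$ steps and reports whether $\Pi$ is a power circuit. -/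

import Mathlib

/-! ### Circuits over a base `q` and their evaluation -/

/-- The digits `D = {-q+1, …, q-1}`. -/
abbrev Digit (q : ℕ) : Type := Set.Icc (-(q : ℤ) + 1) ((q : ℤ) - 1)

/-- A marking of a node set `Γ`: a map `Γ → D`. -/
abbrev Marking (q : ℕ) (Γ : Type*) : Type _ := Γ → Digit q

/-- A directed acyclic graph without multiple edges, with edges labelled by digits.
`δ u v = 0` means that there is no edge from `u` to `v`. -/
structure Dag (q : ℕ) (Γ : Type*) where
  δ : Γ → Γ → Digit q
  acyclic : ∀ u, ¬ Relation.TransGen (fun u v => (δ u v : ℤ) ≠ 0) u u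

namespace Dag

variable {q : ℕ} {Γ : Type*}

/-- There is an edge from `u` to `v`. -/
def Edge (G : Dag q Γ) (u v : Γ) : Prop := (G.δ u v : ℤ) ≠ 0

/-- The successor marking of a node. -/
def succ (G : Dag q Γ) (u : Γ) : Marking q Γ := fun v => G.δ u v

theorem wellFounded_edge [Finite Γ] (G : Dag q Γ) : WellFounded (fun v u => G.Edge u v) := by
  let r : Γ → Γ → Prop := fun v u => Relation.TransGen G.Edge u v
  have : IsTrans Γ r := ⟨fun _ _ _ h₁ h₂ => Relation.TransGen.trans h₂ h₁⟩
  have : Std.Irrefl r := ⟨fun u h => G.acyclic u h⟩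
  exact Subrelation.wf (r := r) (fun h => Relation.TransGen.single h)
    (Finite.wellFounded_of_trans_of_irrefl r)

open Classical in
/-- The value `ε(u) = q ^ ε(Λ_u)` of a node, by recursion along the edges. -/
noncomputable def nodeValue [Fintype Γ] (G : Dag q Γ) : Γ → ℝ :=
  G.wellFounded_edge.fix fun u ih =>
    (q : ℝ) ^ (∑ v, if h : G.Edge u v then ((G.δ u v : ℤ) : ℝ) * ih v h else (0 : ℝ))

/-- The value `ε(M) = ∑ M(u) ε(u)` of a marking. -/
noncomputable def markingValue [Fintype Γ] (G : Dag q Γ) (M : Marking q Γ) : ℝ :=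
  ∑ u, ((M u : ℤ) : ℝ) * G.nodeValue u

/-- The defining equation of the evaluation. -/
theorem nodeValue_eq [Fintype Γ] (G : Dag q Γ) (u : Γ) :
    G.nodeValue u = (q : ℝ) ^ G.markingValue (G.succ u) := by
  classical
  unfold nodeValue
  rw [WellFounded.fix_eq]
  congr 1
  unfold markingValue nodeValue succ
  refine Finset.sum_congr rfl fun v _ => ?_
  by_cases h : G.Edge u v
  · simp only [h, dif_pos]
  · have h0 : (G.δ u v : ℤ) = 0 := not_not.mp h
    simp only [h, h0, dif_neg, not_false_eq_true, Int.cast_zero, zero_mul]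

/-- A power circuit: every node evaluates to `q ^ k` for a natural number `k`. -/
def IsPowerCircuit [Fintype Γ] (G : Dag q Γ) : Prop :=
  ∀ u, ∃ k : ℕ, G.nodeValue u = (q : ℝ) ^ k

/-- `G` together with the list `u` of its nodes and the bit vector `b` is a reduced power
circuit. -/
structure IsReduced [Fintype Γ] (G : Dag q Γ) {N : ℕ} (u : Fin N → Γ)
    (b : Fin (N - 1) → Bool) : Prop where
  isPowerCircuit : G.IsPowerCircuit
  enumerates : Function.Bijective u
  distinct : ∀ v w, v ≠ w → G.nodeValue v ≠ G.nodeValue w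
  sorted : ∀ i j, i < j → G.nodeValue (u i) < G.nodeValue (u j)
  bit_iff : ∀ i : Fin (N - 1), b i = true ↔
    (q : ℝ) * G.nodeValue (u ⟨i, by omega⟩) = G.nodeValue (u ⟨i + 1, by omega⟩)

end Dag

/-! ### Random-access machines

Programs are finite and written in structured form. A machine has integer registers and an
indirectly addressed integer memory. Every evaluated operation, register access, constant and
memory access, every assignment and every test costs one step. All numbers that occur have to
fit into a machine word, i.e. to have absolute value at most `W`; a program that exceeds `W`
has no execution. -/

namespace RAM

structure State where
  reg : ℕ → ℤ
  mem : ℤ → ℤ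

/-- The binary operations; `div` is integer division, comparisons return `0` or `1`. -/
inductive Op where
  | add | sub | mul | div | lt | eq

def Op.apply : Op → ℤ → ℤ → ℤ
  | .add, x, y => x + y
  | .sub, x, y => x - y
  | .mul, x, y => x * y
  | .div, x, y => x / y
  | .lt, x, y => if x < y then 1 else 0
  | .eq, x, y => if x = y then 1 else 0

inductive Expr where
  | const (z : ℤ)
  | reg (x : ℕ)
  | load (a : Expr)
  | bin (o : Op) (a b : Expr)

def Expr.eval (s : State) : Expr → ℤ
  | .const z => z
  | .reg x => s.reg x
  | .load a => s.mem (a.eval s)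
  | .bin o a b => o.apply (a.eval s) (b.eval s)

/-- The number of steps for evaluating an expression. -/
def Expr.cost : Expr → ℕ
  | .const _ => 1
  | .reg _ => 1
  | .load a => a.cost + 1
  | .bin _ a b => a.cost + b.cost + 1

/-- All values that occur in the evaluation fit into a machine word. -/
def Expr.Fits (W : ℤ) (s : State) : Expr → Prop
  | .const z => |z| ≤ W
  | .reg x => |s.reg x| ≤ W
  | .load a => a.Fits W s ∧ |s.mem (a.eval s)| ≤ W
  | .bin o a b => a.Fits W s ∧ b.Fits W s ∧ |o.apply (a.eval s) (b.eval s)| ≤ W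

inductive Prog where
  | skip
  | assign (x : ℕ) (e : Expr)
  | store (a e : Expr)
  | seq (p₁ p₂ : Prog)
  | cond (e : Expr) (p₁ p₂ : Prog)
  | loop (e : Expr) (p : Prog)

/-- `Exec W p s s' t`: with word bound `W`, program `p` started in state `s` halts in state `s'`
after exactly `t` steps. Tests succeed when their value is nonzero. -/
inductive Exec (W : ℤ) : Prog → State → State → ℕ → Prop where
  | skip (s) : Exec W .skip s s 1
  | assign (x e s) (he : e.Fits W s) :
      Exec W (.assign x e) s ⟨Function.update s.reg x (e.eval s), s.mem⟩ (e.cost + 1)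
  | store (a e s) (ha : a.Fits W s) (he : e.Fits W s) :
      Exec W (.store a e) s ⟨s.reg, Function.update s.mem (a.eval s) (e.eval s)⟩
        (a.cost + e.cost + 1)
  | seq (p₁ p₂ s s₁ s₂ t₁ t₂) (h₁ : Exec W p₁ s s₁ t₁) (h₂ : Exec W p₂ s₁ s₂ t₂) :
      Exec W (.seq p₁ p₂) s s₂ (t₁ + t₂)
  | cond_true (e p₁ p₂ s s' t) (he : e.Fits W s) (h : e.eval s ≠ 0) (h₁ : Exec W p₁ s s' t) :
      Exec W (.cond e p₁ p₂) s s' (e.cost + 1 + t)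
  | cond_false (e p₁ p₂ s s' t) (he : e.Fits W s) (h : e.eval s = 0) (h₂ : Exec W p₂ s s' t) :
      Exec W (.cond e p₁ p₂) s s' (e.cost + 1 + t)
  | loop_false (e p s) (he : e.Fits W s) (h : e.eval s = 0) :
      Exec W (.loop e p) s s (e.cost + 1)
  | loop_true (e p s s₁ s₂ t₁ t₂) (he : e.Fits W s) (h : e.eval s ≠ 0)
      (h₁ : Exec W p s s₁ t₁) (h₂ : Exec W (.loop e p) s₁ s₂ t₂) :
      Exec W (.loop e p) s s₂ (e.cost + 1 + t₁ + t₂)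

/-- Words of `O(log (n + m))` bits. -/
def wordBound (c n m : ℕ) : ℤ := ((n : ℤ) + m + 2) ^ c

/-- `C · f · (log f)^k`, with `f` shifted so that small values of `f` cause no degeneration. -/
def softO (C k f : ℕ) : ℕ := C * (f + 1) * Nat.log 2 (f + 2) ^ k

/-- The entry in row `i` and column `j` of a table, and `0` outside of the table. -/
def entry {q r c : ℕ} (f : Fin r → Fin c → Digit q) (i j : ℕ) : ℤ :=
  if h : i < r ∧ j < c then (f ⟨i, h.1⟩ ⟨j, h.2⟩ : ℤ) else 0

/-- The memory cells from `base` on hold the table `f` row by row, where consecutive rows start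
at distance `stride`. -/
def HoldsTable {q r c : ℕ} (mem : ℤ → ℤ) (base stride : ℤ) (f : Fin r → Fin c → Digit q) :
    Prop :=
  (c : ℤ) ≤ stride ∧ ∀ (i : Fin r) (j : Fin c), mem (base + stride * (i : ℕ) + (j : ℕ)) = (f i j : ℤ)

/-- The input: register `0` holds the number `n` of nodes, register `1` the number `m` of
markings. The first `n * n` memory cells hold the edge labels row by row, the next `m * n` cells
the markings row by row. Everything else is `0`. -/
def inputState {q n m : ℕ} (G : Dag q (Fin n)) (M : Fin m → Marking q (Fin n)) : State where
  reg := fun x => if x = 0 then (n : ℤ) else if x = 1 then (m : ℤ) else 0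
  mem := fun a =>
    if a < 0 then 0
    else if a < (n : ℤ) * n then entry G.δ (a.toNat / n) (a.toNat % n)
    else entry M ((a.toNat - n * n) / n) ((a.toNat - n * n) % n)

/-- The final state `s` holds the circuit `G` with node list `u`, bit vector `b` and markings `M`.
Register `1` holds the number of nodes; the edge labels are a table at the address in register `2`
with stride in register `3`; the node list and the bit vector start at the addresses in registers
`4` and `5`; the markings are a table at the address in register `6` with stride in
register `7`. -/
structure IsOutput {q n m : ℕ} (s : State) (G : Dag q (Fin n)) (u : Fin n → Fin n)
    (b : Fin (n - 1) → Bool) (M : Fin m → Marking q (Fin n)) : Prop where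
  size : s.reg 1 = n
  edges : HoldsTable s.mem (s.reg 2) (s.reg 3) G.δ
  nodes : ∀ i : Fin n, s.mem (s.reg 4 + (i : ℕ)) = ((u i : ℕ) : ℤ)
  bits : ∀ i : Fin (n - 1), s.mem (s.reg 5 + (i : ℕ)) = if b i = true then 1 else 0
  markings : HoldsTable s.mem (s.reg 6) (s.reg 7) M

end RAM

/-! ### An array machine that compiles to the random-access machine

Programs of the array machine access a contiguous memory with nonnegative addresses and sixteen
arrays, which are interleaved on the negative addresses of the random-access machine. -/

namespace ArrayMachine

open RAM

/-! The exponents of nodes may be towers of powers, so they are never computed. The program only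
compares markings and measures small gaps between exponents.

Comparison. Suppose that the supports of two markings lie in a list of nodes sorted by value, for
which the gaps between successive exponents are known up to clipping. Their difference is evaluated
by Horner's rule from the largest exponent downwards, with every intermediate result clipped at size
O(qn). A result beyond the clipping bound cannot come back, because each later digit difference is
at most 2q in absolute value and the factors are at least 1. `ClipRel` is the invariant, and
`difference_spec` yields in O(n) steps the true difference up to clipping at `gapBound`, hence its
sign and all small gaps.

Sorting. Nodes are processed in a topological order. If all successors of a node have natural
exponents, its marking value is an integer, and the node is acceptable exactly when this integer is
nonnegative; one comparison with the zero marking decides this (`processNode_spec`). The place of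
the node is found by binary search, and the two adjacent gaps by two more comparisons. This gives
`sortNodes_spec` with O(n log n) comparisons of O(n) steps, and the power circuit test.

New nodes. Old nodes of equal value merge, so coefficients can leave the digit range, and carries
ask for nodes of exponent e+1, e+2, … above an old exponent e. `Plan` bounds by `Acc` the
coefficient that can arrive at each new node and continues a chain only while this bound is at least
q. A new node at distance o ≤ n above an old node u has as its successor marking that of u plus o
times the node of value 1. The latter node exists because a sink has exponent 0
(`SortedNodes.first_eq_zero`). The bound |Γ'| ≤ 2|Γ| comes from the potential c + 1 + Acc c / q ≤ n
+ p: continuing a chain lowers the quotient by at least one, and each further old node raises the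
left side by at most one.

Rows. Each marking is rewritten by collecting coefficients (`scatter_spec`), carrying
(`carry_spec`), and removing every digit 1 directly above a negative digit (`normalize_spec`). The
last step makes the new graph acyclic: a normalized row of value V ≥ 0 uses only exponents below V
(`IsRow.exponent_lt`), so edges lead to strictly smaller exponents. `Result.exists_output` turns the
memory contents into a reduced circuit.

Machine. Programs are written for a machine with sixteen arrays and verified with weakest
preconditions and time-bounded triples `ATri`. If all cells are at most K, an expression of cost at
most 64 has values at most K^64 (`AExpr.fits`). Since K is polynomial in n + m for fixed q, words of
logarithmic length suffice. -/

/-- A memory, split into the nonnegative addresses and sixteen interleaved arrays. -/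
structure Mem where
  pos : ℕ → ℤ
  arr : Fin 16 → ℕ → ℤ

namespace Mem

/-- The memory of the random-access machine. -/
def enc (M : Mem) : ℤ → ℤ
  | Int.ofNat a => M.pos a
  | Int.negSucc b => M.arr ⟨b % 16, Nat.mod_lt _ (by norm_num)⟩ (b / 16)

def setPos (M : Mem) (a : ℕ) (v : ℤ) : Mem := ⟨Function.update M.pos a v, M.arr⟩

def setArr (M : Mem) (k : Fin 16) (a : ℕ) (v : ℤ) : Mem :=
  ⟨M.pos, Function.update M.arr k (Function.update (M.arr k) a v)⟩

@[simp] theorem setPos_pos (M : Mem) (a v) : (M.setPos a v).pos = Function.update M.pos a v := rfl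
@[simp] theorem setPos_arr (M : Mem) (a v) : (M.setPos a v).arr = M.arr := rfl
@[simp] theorem setArr_pos (M : Mem) (k a v) : (M.setArr k a v).pos = M.pos := rfl
@[simp] theorem setArr_arr (M : Mem) (k a v) (j : Fin 16) : (M.setArr k a v).arr j =
    if j = k then Function.update (M.arr k) a v else M.arr j := by
  simp only [setArr, Function.update_apply]

/-- The memories agree up to the arrays in the list. -/
def AgreeOff (ks : List (Fin 16)) (M M' : Mem) : Prop :=
  M'.pos = M.pos ∧ ∀ k ∉ ks, M'.arr k = M.arr k

theorem AgreeOff.refl (ks : List (Fin 16)) (M : Mem) : M.AgreeOff ks M := ⟨rfl, fun _ _ => rfl⟩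

theorem AgreeOff.trans {ks : List (Fin 16)} {M₁ M₂ M₃ : Mem} (h : M₁.AgreeOff ks M₂)
    (h' : M₂.AgreeOff ks M₃) : M₁.AgreeOff ks M₃ :=
  ⟨h'.1.trans h.1, fun k hk => (h'.2 k hk).trans (h.2 k hk)⟩

theorem AgreeOff.mono {ks ks' : List (Fin 16)} {M M' : Mem} (h : M.AgreeOff ks M')
    (hk : ∀ k ∈ ks, k ∈ ks') : M.AgreeOff ks' M' :=
  ⟨h.1, fun k hk' => h.2 k fun h => hk' (hk k h)⟩

theorem AgreeOff.setArr {ks : List (Fin 16)} {M M' : Mem} (h : M.AgreeOff ks M') {k : Fin 16}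
    (hk : k ∈ ks) (a : ℕ) (v : ℤ) : M.AgreeOff ks (M'.setArr k a v) :=
  ⟨h.1, fun j hj => by
    rw [setArr_arr, if_neg (by rintro rfl; exact hj hk)]; exact h.2 j hj⟩

theorem enc_of_nonneg (M : Mem) {a : ℤ} (h : 0 ≤ a) : M.enc a = M.pos a.toNat := by
  obtain ⟨b, rfl⟩ := Int.eq_ofNat_of_zero_le h
  rfl

theorem location (k : Fin 16) (a : ℕ) :
    -((k : ℕ) : ℤ) - 1 - 16 * (a : ℤ) = Int.negSucc (16 * a + k) := by
  rw [Int.negSucc_eq]; push_cast; ring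

theorem enc_negSucc (M : Mem) (k : Fin 16) (a : ℕ) :
    M.enc (Int.negSucc (16 * a + k)) = M.arr k a := by
  have h₁ : (16 * a + (k : ℕ)) % 16 = k := by omega
  have h₂ : (16 * a + (k : ℕ)) / 16 = a := by omega
  simp only [enc, h₁, h₂]

theorem enc_setPos (M : Mem) {a : ℤ} (h : 0 ≤ a) (v : ℤ) :
    (M.setPos a.toNat v).enc = Function.update M.enc a v := by
  obtain ⟨b, rfl⟩ := Int.eq_ofNat_of_zero_le h
  funext x
  cases x with
  | ofNat x => simp [enc, setPos, Function.update_apply]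
  | negSucc x => simp [enc, setPos]

theorem enc_setArr (M : Mem) (k : Fin 16) (a : ℕ) (v : ℤ) :
    (M.setArr k a v).enc = Function.update M.enc (Int.negSucc (16 * a + k)) v := by
  funext x
  cases x with
  | ofNat x => simp [enc, setArr]
  | negSucc x =>
    by_cases hx : x = 16 * a + k
    · subst hx
      rw [enc_negSucc]; simp
    · rw [Function.update_of_ne (by simpa using hx)]
      simp only [enc, setArr_arr]
      split_ifs with hk
      · have h₁ : x % 16 = k := congrArg Fin.val hk
        rw [Function.update_of_ne (by omega), hk]
      · rfl

/-- The memory with prescribed contents. -/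
def dec (f : ℤ → ℤ) : Mem := ⟨fun a => f a, fun k a => f (Int.negSucc (16 * a + k))⟩

theorem enc_dec (f : ℤ → ℤ) : (dec f).enc = f := by
  funext x
  cases x with
  | ofNat x => rfl
  | negSucc x =>
    simp only [enc, dec]
    congr 2
    omega

end Mem

/-! ### Expressions of the array machine and the sizes of their values -/

inductive AExpr where
  | const (z : ℤ)
  | reg (x : ℕ)
  | pos (a : AExpr)
  | arr (k : Fin 16) (a : AExpr)
  | bin (o : Op) (a b : AExpr)

namespace AExpr

instance : Add AExpr := ⟨bin .add⟩
instance : Sub AExpr := ⟨bin .sub⟩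
instance : Mul AExpr := ⟨bin .mul⟩
instance : Div AExpr := ⟨bin .div⟩
instance (k : ℕ) [OfNat ℤ k] : OfNat AExpr k := ⟨const (OfNat.ofNat k)⟩

theorem sub_def (a b : AExpr) : a - b = bin .sub a b := rfl
theorem div_def (a b : AExpr) : a / b = bin .div a b := rfl

/-- The expression `1` if `a < b`, and `0` otherwise. -/
abbrev lt (a b : AExpr) : AExpr := bin .lt a b

/-- The expression `1` if `a = b`, and `0` otherwise. -/
abbrev eq (a b : AExpr) : AExpr := bin .eq a b

def compile : AExpr → Expr
  | const z => .const z
  | reg x => .reg x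
  | pos a => .load a.compile
  | arr k a => .load (.bin .sub (.const (-((k : ℕ) : ℤ) - 1)) (.bin .mul (.const 16) a.compile))
  | bin o a b => .bin o a.compile b.compile

/-- The five extra steps of an array access are the load, the two constants and the two operations
that compute its interleaved address. -/
def cost : AExpr → ℕ
  | const _ => 1
  | reg _ => 1
  | pos a => a.cost + 1
  | arr _ a => a.cost + 5
  | bin _ a b => a.cost + b.cost + 1

def eval (R : ℕ → ℤ) (M : Mem) : AExpr → ℤ
  | const z => z
  | reg x => R x
  | pos a => M.pos (a.eval R M).toNat
  | arr k a => M.arr k (a.eval R M).toNat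
  | bin o a b => o.apply (a.eval R M) (b.eval R M)

/-- All addresses are nonnegative. -/
def Safe (R : ℕ → ℤ) (M : Mem) : AExpr → Prop
  | const _ => True
  | reg _ => True
  | pos a => a.Safe R M ∧ 0 ≤ a.eval R M
  | arr _ a => a.Safe R M ∧ 0 ≤ a.eval R M
  | bin _ a b => a.Safe R M ∧ b.Safe R M

/-- The constants are at most `K`. -/
def ConstLE (K : ℤ) : AExpr → Prop
  | const z => |z| ≤ K
  | reg _ => True
  | pos a => a.ConstLE K
  | arr _ a => a.ConstLE K
  | bin _ a b => a.ConstLE K ∧ b.ConstLE K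

theorem cost_compile (e : AExpr) : e.compile.cost = e.cost := by
  induction e with
  | const z => rfl
  | reg x => rfl
  | pos a ih => simp [compile, Expr.cost, cost, ih]
  | arr k a ih => simp only [compile, Expr.cost, cost, ih]; omega
  | bin o a b iha ihb => simp [compile, Expr.cost, cost, iha, ihb]

theorem eval_compile (R : ℕ → ℤ) (M : Mem) (e : AExpr) (h : e.Safe R M) :
    e.compile.eval ⟨R, M.enc⟩ = e.eval R M := by
  induction e with
  | const z => rfl
  | reg x => rfl
  | pos a ih => simp only [compile, Expr.eval, eval, ih h.1, Mem.enc_of_nonneg M h.2]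
  | arr k a ih =>
    simp only [compile, Expr.eval, eval, ih h.1, Op.apply]
    obtain ⟨b, hb⟩ := Int.eq_ofNat_of_zero_le h.2
    rw [hb, Mem.location, Mem.enc_negSucc]; rfl
  | bin o a b iha ihb => simp only [compile, Expr.eval, eval, iha h.1, ihb h.2]

end AExpr

/-- The extra factor K pays for the doubling in sums and differences. Quotients do not exceed their
numerator, and comparisons are at most 1. -/
theorem abs_apply_le {K : ℤ} (hK : 2 ≤ K) (o : Op) {x y : ℤ} {a b : ℕ} (hx : |x| ≤ K ^ a)
    (hy : |y| ≤ K ^ b) : |o.apply x y| ≤ K ^ (a + b + 1) := by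
  have hK0 : (0 : ℤ) < K := by omega
  have ha : 1 ≤ K ^ a := one_le_pow₀ (by omega)
  have hb : 1 ≤ K ^ b := one_le_pow₀ (by omega)
  have hab : K ^ (a + b + 1) = K ^ a * K ^ b * K := by rw [pow_succ, pow_add]
  have hsum : K ^ a + K ^ b ≤ K ^ (a + b + 1) := by
    rw [hab]
    nlinarith [mul_le_mul ha hb (by norm_num) (by positivity), mul_nonneg (sub_nonneg.2 ha)
      (sub_nonneg.2 hb),
      mul_le_mul_of_nonneg_left hK (by positivity : 0 ≤ K ^ a * K ^ b)]
  have h1 : (1 : ℤ) ≤ K ^ (a + b + 1) := one_le_pow₀ (by omega)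
  cases o with
  | add => exact (abs_add_le x y).trans (by linarith)
  | sub => exact (abs_sub x y).trans (by linarith)
  | mul =>
    simp only [Op.apply]
    rw [abs_mul, hab]
    calc |x| * |y| ≤ K ^ a * K ^ b := mul_le_mul hx hy (abs_nonneg _) (by positivity)
      _ ≤ K ^ a * K ^ b * K := le_mul_of_one_le_right (by positivity) (by omega)
  | div =>
    simp only [Op.apply]
    have : |x / y| ≤ |x| := by
      rw [Int.abs_eq_natAbs, Int.abs_eq_natAbs]
      exact_mod_cast Int.natAbs_ediv_le_natAbs x y
    linarith
  | lt => simp only [Op.apply]; split_ifs <;> simp <;> linarith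
  | eq => simp only [Op.apply]; split_ifs <;> simp <;> linarith

/-- All registers and memory cells have absolute value at most `K`. -/
structure Bdd (K : ℤ) (R : ℕ → ℤ) (M : Mem) : Prop where
  reg : ∀ x, |R x| ≤ K
  pos : ∀ a, |M.pos a| ≤ K
  arr : ∀ k a, |M.arr k a| ≤ K

theorem Bdd.mem {K : ℤ} {R : ℕ → ℤ} {M : Mem} (h : Bdd K R M) (a : ℤ) : |M.enc a| ≤ K := by
  cases a with
  | ofNat a => exact h.pos a
  | negSucc a => exact h.arr _ _

/-- The largest cost of an expression whose values are guaranteed to fit into a word. -/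
def maxCost : ℕ := 64

/-- Every leaf and every loaded cell is at most K, and each operation adds at most one to the sum of
the exponents of K, so the cost itself serves as exponent. The word bound then depends only on the
largest cost of a single expression, not on the length of a computation. -/
theorem AExpr.fits {K W : ℤ} (hK : 17 ≤ K) (hW : K ^ maxCost ≤ W) {R : ℕ → ℤ} {M : Mem}
    (hB : Bdd K R M) (e : AExpr) (hc : e.cost ≤ maxCost) (he : e.ConstLE K) :
    |e.compile.eval ⟨R, M.enc⟩| ≤ K ^ e.cost ∧ e.compile.Fits W ⟨R, M.enc⟩ := by
  have hle : ∀ {x : ℤ} {c : ℕ}, c ≤ maxCost → |x| ≤ K ^ c → |x| ≤ W := fun hc hx =>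
    hx.trans ((pow_le_pow_right₀ (by omega) hc).trans hW)
  have hK1 : ∀ c : ℕ, K ≤ K ^ (c + 1) := fun c => le_self_pow₀ (by omega) (by omega)
  induction e with
  | const z =>
    have : |z| ≤ K ^ 1 := by simpa [AExpr.ConstLE] using he
    exact ⟨this, hle hc this⟩
  | reg x =>
    have : |R x| ≤ K ^ 1 := by simpa using hB.reg x
    exact ⟨this, hle hc this⟩
  | pos a ih =>
    simp only [AExpr.cost] at hc
    obtain ⟨_, h₂⟩ := ih (by omega) he
    have h := (hB.mem (a.compile.eval ⟨R, M.enc⟩)).trans (hK1 a.cost)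
    exact ⟨h, h₂, hle hc h⟩
  | arr k a ih =>
    simp only [AExpr.cost] at hc
    obtain ⟨h₁, h₂⟩ := ih (by omega) he
    have hk : |(-((k : ℕ) : ℤ) - 1)| ≤ K ^ 1 := by
      have := k.2
      rw [abs_le]; constructor <;> simp <;> omega
    have h16 : |(16 : ℤ)| ≤ K ^ 1 := by rw [abs_le]; constructor <;> simp <;> omega
    have hm := abs_apply_le (by omega) .mul h16 h₁
    have hs := abs_apply_le (by omega) .sub hk hm
    have h := (hB.mem (-((k : ℕ) : ℤ) - 1 - 16 * a.compile.eval ⟨R, M.enc⟩)).trans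
      (hK1 (a.cost + 4))
    exact ⟨h, ⟨hle (by unfold maxCost; omega) hk, ⟨hle (by unfold maxCost; omega) h16, h₂,
      hle (by omega) hm⟩, hle (by omega) hs⟩, hle hc h⟩
  | bin o a b iha ihb =>
    simp only [AExpr.cost] at hc
    obtain ⟨h₁, h₂⟩ := iha (by omega) he.1
    obtain ⟨h₃, h₄⟩ := ihb (by omega) he.2
    have h := abs_apply_le (by omega) o h₁ h₃
    exact ⟨h, h₂, h₄, hle hc h⟩

/-! ### Programs of the array machine and weakest preconditions -/

inductive AProg where
  | skip
  | assign (x : ℕ) (e : AExpr)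
  | storePos (a e : AExpr)
  | storeArr (k : Fin 16) (a e : AExpr)
  | seq (p₁ p₂ : AProg)
  | cond (e : AExpr) (p₁ p₂ : AProg)
  | loop (e : AExpr) (p : AProg)

infixr:60 " ;; " => AProg.seq
infix:62 " ::= " => AProg.assign

namespace AProg

def compile : AProg → Prog
  | skip => .skip
  | assign x e => .assign x e.compile
  | storePos a e => .store a.compile e.compile
  | storeArr k a e => .store (.bin .sub (.const (-((k : ℕ) : ℤ) - 1))
      (.bin .mul (.const 16) a.compile)) e.compile
  | seq p₁ p₂ => .seq p₁.compile p₂.compile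
  | cond e p₁ p₂ => .cond e.compile p₁.compile p₂.compile
  | loop e p => .loop e.compile p.compile

/-- The registers that are assigned to. -/
def writes : AProg → List ℕ
  | skip => []
  | assign x _ => [x]
  | storePos _ _ => []
  | storeArr _ _ _ => []
  | seq p₁ p₂ => p₁.writes ++ p₂.writes
  | cond _ p₁ p₂ => p₁.writes ++ p₂.writes
  | loop _ p => p.writes

/-- All expressions are cheap and have constants bounded by `K`. -/
def Small (K : ℤ) : AProg → Prop
  | skip => True
  | assign _ e => e.cost ≤ maxCost ∧ e.ConstLE K
  | storePos a e => (a.cost ≤ maxCost ∧ a.ConstLE K) ∧ e.cost ≤ maxCost ∧ e.ConstLE K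
  | storeArr _ a e => (a.cost + 5 ≤ maxCost ∧ a.ConstLE K) ∧ e.cost ≤ maxCost ∧ e.ConstLE K
  | seq p₁ p₂ => p₁.Small K ∧ p₂.Small K
  | cond e p₁ p₂ => (e.cost ≤ maxCost ∧ e.ConstLE K) ∧ p₁.Small K ∧ p₂.Small K
  | loop e p => (e.cost ≤ maxCost ∧ e.ConstLE K) ∧ p.Small K

/-- A bound for the running time of a program without loops. -/
def time : AProg → ℕ
  | skip => 1
  | assign _ e => e.cost + 1
  | storePos a e => a.cost + e.cost + 1
  | storeArr _ a e => a.cost + e.cost + 5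
  | seq p₁ p₂ => p₁.time + p₂.time
  | cond e p₁ p₂ => e.cost + 1 + max p₁.time p₂.time
  | loop _ _ => 0

/-- The weakest precondition of a program without loops. -/
def wp (K : ℤ) : AProg → ((ℕ → ℤ) → Mem → Prop) → (ℕ → ℤ) → Mem → Prop
  | skip, Q, R, M => Q R M
  | assign x e, Q, R, M => e.Safe R M ∧ (-K ≤ e.eval R M ∧ e.eval R M ≤ K) ∧
      Q (Function.update R x (e.eval R M)) M
  | storePos a e, Q, R, M => a.Safe R M ∧ e.Safe R M ∧ 0 ≤ a.eval R M ∧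
      (-K ≤ e.eval R M ∧ e.eval R M ≤ K) ∧
      Q R (M.setPos (a.eval R M).toNat (e.eval R M))
  | storeArr k a e, Q, R, M => a.Safe R M ∧ e.Safe R M ∧ 0 ≤ a.eval R M ∧
      (-K ≤ e.eval R M ∧ e.eval R M ≤ K) ∧
      Q R (M.setArr k (a.eval R M).toNat (e.eval R M))
  | seq p₁ p₂, Q, R, M => p₁.wp K (fun R' M' => p₂.wp K Q R' M') R M
  | cond e p₁ p₂, Q, R, M => e.Safe R M ∧ (e.eval R M ≠ 0 → p₁.wp K Q R M) ∧
      (e.eval R M = 0 → p₂.wp K Q R M)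
  | loop _ _, _, _, _ => False

end AProg

/-- Keeps specifications short: they mention only the registers that matter, and the contents of all
others are recovered from the syntactic list of assigned registers. -/
theorem exec_frame {W : ℤ} {p : AProg} {s s' : State} {t : ℕ} (h : Exec W p.compile s s' t) :
    ∀ x ∉ p.writes, s'.reg x = s.reg x := by
  generalize hP : p.compile = P at h
  induction h generalizing p with
  | skip s => intro x _; rfl
  | assign x e s he =>
    cases p <;> simp only [AProg.compile, Prog.assign.injEq, reduceCtorEq] at hP
    obtain ⟨rfl, _⟩ := hP
    intro y hy
    simp only [AProg.writes, List.mem_singleton] at hy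
    exact Function.update_of_ne hy _ _
  | store a e s ha he => intro x _; rfl
  | seq p₁ p₂ s s₁ s₂ t₁ t₂ h₁ h₂ ih₁ ih₂ =>
    cases p <;> simp only [AProg.compile, Prog.seq.injEq, reduceCtorEq] at hP
    intro y hy
    simp only [AProg.writes, List.mem_append, not_or] at hy
    rw [ih₂ hP.2 y hy.2, ih₁ hP.1 y hy.1]
  | cond_true e p₁ p₂ s s' t he h h₁ ih =>
    cases p <;> simp only [AProg.compile, Prog.cond.injEq, reduceCtorEq] at hP
    intro y hy
    simp only [AProg.writes, List.mem_append, not_or] at hy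
    exact ih hP.2.1 y hy.1
  | cond_false e p₁ p₂ s s' t he h h₂ ih =>
    cases p <;> simp only [AProg.compile, Prog.cond.injEq, reduceCtorEq] at hP
    intro y hy
    simp only [AProg.writes, List.mem_append, not_or] at hy
    exact ih hP.2.2 y hy.2
  | loop_false e p s he h => intro x _; rfl
  | loop_true e p' s s₁ s₂ t₁ t₂ he h h₁ h₂ ih₁ ih₂ =>
    intro y hy
    rw [ih₂ hP y hy]
    cases p <;> simp only [AProg.compile, Prog.loop.injEq, reduceCtorEq] at hP
    exact ih₁ hP.2 y hy

/-! ### Total correctness with time bounds -/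

/-- The bound `K` on the cell contents leaves enough room in words that are bounded by `W`. -/
structure WordSize (K W : ℤ) : Prop where
  le : 17 ≤ K
  pow_le : K ^ maxCost ≤ W

/-- Total correctness with a bound `T` on the number of steps. -/
def ATri (K W : ℤ) (p : AProg) (R : ℕ → ℤ) (M : Mem) (T : ℕ) (Q : (ℕ → ℤ) → Mem → Prop) : Prop :=
  WordSize K W → p.Small K → Bdd K R M → ∃ R' M' t, Exec W p.compile ⟨R, M.enc⟩ ⟨R', M'.enc⟩ t ∧
    t ≤ T ∧ Bdd K R' M' ∧ Q R' M'

section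
variable {K W : ℤ} {p p₁ p₂ : AProg} {R : ℕ → ℤ} {M : Mem} {T T₁ T₂ : ℕ}
  {Q Q' : (ℕ → ℤ) → Mem → Prop}

theorem ATri.mono (h : ATri K W p R M T₁ Q') (hT : T₁ ≤ T) (hQ : ∀ R' M', Q' R' M' → Q R' M') :
    ATri K W p R M T Q := fun hW hp hB => by
  obtain ⟨R', M', t, h₁, h₂, h₃, h₄⟩ := h hW hp hB
  exact ⟨R', M', t, h₁, h₂.trans hT, h₃, hQ _ _ h₄⟩

theorem ATri.frame (h : ATri K W p R M T Q) :
    ATri K W p R M T (fun R' M' => Q R' M' ∧ ∀ x ∉ p.writes, R' x = R x) := fun hW hp hB => by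
  obtain ⟨R', M', t, h₁, h₂, h₃, h₄⟩ := h hW hp hB
  exact ⟨R', M', t, h₁, h₂, h₃, h₄, exec_frame h₁⟩

/-- Gives access to the cell bound inside a proof, for values that are copied without knowing more
about them than that they fit. -/
theorem ATri.of_bdd (h : Bdd K R M → ATri K W p R M T Q) : ATri K W p R M T Q :=
  fun hW hp hB => h hB hW hp hB

theorem ATri.seq (h₁ : ATri K W p₁ R M T₁ Q')
    (h₂ : ∀ R' M', Q' R' M' → ATri K W p₂ R' M' T₂ Q) (hT : T₁ + T₂ ≤ T) :
    ATri K W (p₁ ;; p₂) R M T Q := fun hW hp hB => by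
  obtain ⟨R₁, M₁, t₁, e₁, ht₁, hB₁, hQ₁⟩ := h₁ hW hp.1 hB
  obtain ⟨R₂, M₂, t₂, e₂, ht₂, hB₂, hQ₂⟩ := h₂ _ _ hQ₁ hW hp.2 hB₁
  exact ⟨R₂, M₂, t₁ + t₂, .seq _ _ _ _ _ _ _ e₁ e₂, by omega, hB₂, hQ₂⟩

theorem ATri.cond {e : AExpr} (he : e.Safe R M)
    (h₁ : e.eval R M ≠ 0 → ATri K W p₁ R M T₁ Q) (h₂ : e.eval R M = 0 → ATri K W p₂ R M T₁ Q)
    (hT : e.cost + 1 + T₁ ≤ T) :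
    ATri K W (.cond e p₁ p₂) R M T Q := fun hW hp hB => by
  have hev := AExpr.eval_compile R M e he
  have hfit := (AExpr.fits hW.le hW.pow_le hB e hp.1.1 hp.1.2).2
  by_cases h : e.eval R M = 0
  · obtain ⟨R', M', t, e₁, ht, hB', hQ⟩ := h₂ h hW hp.2.2 hB
    exact ⟨R', M', _, .cond_false _ _ _ _ _ _ hfit (hev.trans h) e₁,
      by rw [AExpr.cost_compile]; omega, hB', hQ⟩
  · obtain ⟨R', M', t, e₁, ht, hB', hQ⟩ := h₁ h hW hp.2.1 hB
    exact ⟨R', M', _, .cond_true _ _ _ _ _ _ hfit (hev ▸ h) e₁,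
      by rw [AExpr.cost_compile]; omega, hB', hQ⟩

/-- Each assignment in `wp` carries the obligation that the new value is at most K in absolute
value; this keeps `Bdd` invariant and provides the hypothesis of `AExpr.fits` for the next
expression. -/
theorem ATri.of_wp (h : p.wp K Q R M) : ATri K W p R M p.time Q := fun hW hp hB => by
  induction p generalizing R M Q with
  | skip => exact ⟨R, M, 1, .skip _, le_rfl, hB, h⟩
  | assign x e =>
    obtain ⟨h₁, h₂, h₃⟩ := h
    refine ⟨_, M, _, .assign x _ _ (AExpr.fits hW.le hW.pow_le hB e hp.1 hp.2).2, ?_, ?_, ?_⟩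
    · rw [AExpr.cost_compile]; exact le_rfl
    · refine ⟨fun y => ?_, hB.pos, hB.arr⟩
      rw [AExpr.eval_compile R M e h₁]
      simp only [Function.update_apply]
      split_ifs
      · exact abs_le.2 h₂
      · exact hB.reg y
    · rw [AExpr.eval_compile R M e h₁]; exact h₃
  | storePos a e =>
    obtain ⟨h₁, h₂, h₃, h₄, h₅⟩ := h
    have := Exec.store (W := W) a.compile e.compile ⟨R, M.enc⟩
      (AExpr.fits hW.le hW.pow_le hB a hp.1.1 hp.1.2).2
      (AExpr.fits hW.le hW.pow_le hB e hp.2.1 hp.2.2).2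
    rw [AExpr.eval_compile R M e h₂, AExpr.eval_compile R M a h₁, ← Mem.enc_setPos M h₃] at this
    refine ⟨R, _, _, this, ?_, ⟨hB.reg, fun y => ?_, hB.arr⟩, h₅⟩
    · rw [AExpr.cost_compile, AExpr.cost_compile]; exact le_rfl
    · simp only [Mem.setPos_pos, Function.update_apply]
      split_ifs
      · exact abs_le.2 h₄
      · exact hB.pos y
  | storeArr k a e =>
    obtain ⟨h₁, h₂, h₃, h₄, h₅⟩ := h
    have hfit := (AExpr.fits hW.le hW.pow_le hB (.arr k a) hp.1.1 hp.1.2).2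
    have := Exec.store (W := W) (.bin .sub (.const (-((k : ℕ) : ℤ) - 1))
      (.bin .mul (.const 16) a.compile)) e.compile ⟨R, M.enc⟩ hfit.1
      (AExpr.fits hW.le hW.pow_le hB e hp.2.1 hp.2.2).2
    simp only [Expr.eval, Op.apply] at this
    obtain ⟨b, hb⟩ := Int.eq_ofNat_of_zero_le h₃
    rw [AExpr.eval_compile R M e h₂, AExpr.eval_compile R M a h₁, hb, Mem.location,
      ← Mem.enc_setArr M] at this
    rw [hb] at h₅
    refine ⟨R, _, _, this, ?_, ⟨hB.reg, hB.pos, fun j y => ?_⟩, h₅⟩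
    · simp only [Expr.cost, AExpr.cost_compile, AProg.time]; omega
    · rw [Mem.setArr_arr]
      split_ifs
      · rw [Function.update_apply]
        split_ifs
        · exact abs_le.2 h₄
        · exact hB.arr _ y
      · exact hB.arr _ y
  | seq p₁ p₂ ih₁ ih₂ =>
    exact ATri.seq (fun _ hp hB => ih₁ h hp hB) (fun R' M' hQ _ hp hB => ih₂ hQ hp hB) le_rfl
      hW hp hB
  | cond e p₁ p₂ ih₁ ih₂ =>
    exact ATri.cond (T₁ := max p₁.time p₂.time) h.1
      (fun he => ATri.mono (fun _ hp hB => ih₁ (h.2.1 he) hp hB) (le_max_left _ _) fun _ _ => id)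
      (fun he => ATri.mono (fun _ hp hB => ih₂ (h.2.2 he) hp hB) (le_max_right _ _) fun _ _ => id)
      le_rfl hW hp hB
  | loop e p => exact h.elim

theorem ATri.wp_seq (h : p₁.wp K (fun R' M' => ATri K W p₂ R' M' T₂ Q) R M)
    (hT : p₁.time + T₂ ≤ T) : ATri K W (p₁ ;; p₂) R M T Q :=
  ATri.seq (ATri.of_wp h) (fun _ _ => id) hT

theorem ATri.wp (h : p.wp K Q R M) (hT : p.time ≤ T) : ATri K W p R M T Q :=
  (ATri.of_wp h).mono hT fun _ _ => id

/-- The index of the invariant is a strictly decreasing variant, so its initial value bounds the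
number of rounds. -/
theorem ATri.loop {e : AExpr} (I : ℕ → (ℕ → ℤ) → Mem → Prop)
    (hstep : ∀ k R' M', I k R' M' → e.Safe R' M' ∧ (e.eval R' M' = 0 → Q R' M') ∧
      (e.eval R' M' ≠ 0 → ∃ j < k, ATri K W p R' M' T₁ (I j)))
    (k : ℕ) (h : I k R M) (hT : k * (T₁ + e.cost + 1) + e.cost + 1 ≤ T) :
    ATri K W (.loop e p) R M T Q := fun hW hp hB => by
  suffices H : ∀ k R M, I k R M → Bdd K R M → ∃ R' M' t,
      Exec W (AProg.loop e p).compile ⟨R, M.enc⟩ ⟨R', M'.enc⟩ t ∧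
      t ≤ k * (T₁ + e.cost + 1) + e.cost + 1 ∧ Bdd K R' M' ∧ Q R' M' by
    obtain ⟨R', M', t, h₁, h₂, h₃⟩ := H k R M h hB
    exact ⟨R', M', t, h₁, h₂.trans hT, h₃⟩
  intro k
  induction k using Nat.strong_induction_on with
  | _ k ih =>
    intro R M h hB
    obtain ⟨h₁, h₂, h₃⟩ := hstep k R M h
    have hev := AExpr.eval_compile R M e h₁
    have hfit := (AExpr.fits hW.le hW.pow_le hB e hp.1.1 hp.1.2).2
    by_cases h0 : e.eval R M = 0
    · exact ⟨R, M, _, .loop_false _ _ _ hfit (hev.trans h0),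
        by rw [AExpr.cost_compile]; omega, hB, h₂ h0⟩
    · obtain ⟨j, hj, hA⟩ := h₃ h0
      obtain ⟨R₁, M₁, t₁, e₁, ht₁, hB₁, hI₁⟩ := hA hW hp.2 hB
      obtain ⟨R₂, M₂, t₂, e₂, ht₂, hB₂, hQ₂⟩ := ih j hj R₁ M₁ hI₁ hB₁
      refine ⟨R₂, M₂, _, .loop_true _ _ _ _ _ _ _ hfit (hev ▸ h0) e₁ e₂, ?_, hB₂, hQ₂⟩
      rw [AExpr.cost_compile]
      have : (j + 1) * (T₁ + e.cost + 1) ≤ k * (T₁ + e.cost + 1) := Nat.mul_le_mul_right _ hj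
      rw [add_mul, one_mul] at this
      omega

/-- Increase register `i` by one until the value of register `B` is reached. -/
def forUp (i B : ℕ) (p : AProg) : AProg :=
  .loop (.lt (.reg i) (.reg B)) (p ;; i ::= .reg i + 1)

/-- The counter never exceeds the limit register, which is itself a bounded cell, so the increment
needs no separate bound. The step hypothesis is stated for the registers after the increment, since
the invariant may mention them. -/
theorem ATri.forUp {i B : ℕ} (hiB : i ≠ B) (hi : i ∉ p.writes) (hBp : B ∉ p.writes) {a b : ℕ}
    (hRi : R i = a) (hRB : R B = b) (hab : a ≤ b) (I : ℕ → (ℕ → ℤ) → Mem → Prop) (h0 : I a R M)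
    (hstep : ∀ (k : ℕ) (R' : ℕ → ℤ) M', a ≤ k → k < b → R' i = k → R' B = b →
      (∀ x ∉ p.writes, x ≠ i → R' x = R x) →
      I k R' M' → ATri K W p R' M' T₁
        (fun R'' M'' => I (k + 1) (Function.update R'' i (k + 1 : ℕ)) M''))
    (hT : (b - a) * (T₁ + 8) + 4 ≤ T)
    (hQ : ∀ R' M', I b R' M' → R' i = b → (∀ x ∉ p.writes, x ≠ i → R' x = R x) → Q R' M') :
    ATri K W (ArrayMachine.forUp i B p) R M T Q := by
  refine ATri.of_bdd fun hBd => ?_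
  have hbK : (b : ℤ) ≤ K := by
    have := hBd.reg B
    rw [hRB] at this
    exact (le_abs_self _).trans this
  refine ATri.loop (e := .lt (.reg i) (.reg B)) (T₁ := T₁ + 4) (fun d R' M' => ∃ k : ℕ,
    k + d = b ∧ a ≤ k ∧ R' i = k ∧
    (∀ x ∉ p.writes, x ≠ i → R' x = R x) ∧ I k R' M') ?_ (b - a)
    ⟨a, by omega, le_rfl, hRi, fun _ _ _ => rfl, h0⟩ (by simpa [AExpr.cost, add_assoc] using hT)
  rintro d R' M' ⟨k, hkd, hak, hk, hfr, hI⟩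
  have hB' : R' B = b := (hfr B hBp hiB.symm).trans hRB
  refine ⟨⟨trivial, trivial⟩, fun he => ?_, fun he => ⟨d - 1, ?_⟩⟩
  · have : k = b := by
      simp only [AExpr.eval, Op.apply, hk, hB'] at he
      split_ifs at he <;> omega
    subst this
    exact hQ R' M' hI hk hfr
  · have hkb : k < b := by
      simp only [AExpr.eval, Op.apply, hk, hB'] at he
      split_ifs at he <;> simp_all
    refine ⟨by omega, ATri.seq (hstep k R' M' hak hkb hk hB' hfr hI).frame
      (T₂ := 4) (fun R'' M'' hQ => ?_) (by omega)⟩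
    have hi'' : R'' i = k := (hQ.2 i hi).trans hk
    refine ATri.mono (ATri.of_wp (Q := fun R₃ M₃ => ∃ k' : ℕ, k' +
      (d - 1) = b ∧ a ≤ k' ∧ R₃ i = k' ∧
      (∀ x ∉ p.writes, x ≠ i → R₃ x = R x) ∧ I k' R₃ M₃) ?_) le_rfl fun _ _ h => h
    refine ⟨⟨trivial, trivial⟩, ?_, k + 1, by omega, by omega, ?_, ?_, ?_⟩
    · simp only [AExpr.eval, Op.apply, hi'']
      constructor <;> omega
    · simp [AExpr.eval, Op.apply, hi'']
    · intro x hx hxi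
      rw [Function.update_of_ne hxi, hQ.2 x hx, hfr x hx hxi]
    · simpa [AExpr.eval, Op.apply, hi''] using hQ.1

end

end ArrayMachine

/-! ### The program -/

namespace ArrayMachine

open RAM

abbrev r (x : ℕ) : AExpr := .reg x

/-- Registers `8`–`11` hold the stride of the output tables, the address behind the input, the
bound at which values are clipped and the bound at which gaps are clipped. -/
def setup (q : ℕ) : AProg :=
  8 ::= r 0 + r 0 + 2 ;;
  9 ::= r 0 * r 0 + r 0 * r 1 ;;
  11 ::= .const (2 * q) * (r 0 + 1) ;;
  10 ::= r 11 + r 11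

/-- Array `0` gets the out-degrees. -/
def countDegreesBody : AProg :=
  (17 ::= 0 ;; 16 ::= 0) ;;
  forUp 16 0 (.cond (.pos (r 0 * r 15 + r 16)) (17 ::= r 17 + 1) .skip) ;;
  .storeArr 0 (r 15) (r 17)

def countDegrees : AProg :=
  15 ::= 0 ;;
  forUp 15 0 countDegreesBody

/-- Array `2` gets the clipped powers of `q`. -/
def powers (q : ℕ) : AProg :=
  (17 ::= 1 ;; 16 ::= 0 ;; 18 ::= r 11 + 1) ;;
  forUp 16 18
    (.storeArr 2 (r 16) (r 17) ;;
     17 ::= r 17 * .const q ;;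
     .cond (.lt (r 10) (r 17)) (17 ::= r 10) .skip)

/-- The body of the loop of `difference`. -/
def differenceBody : AProg :=
  24 ::= r 13 - 1 - r 23 ;;
  22 ::= (r 22 + (.pos (r 20 + .arr 3 (r 24)) - .pos (r 21 + .arr 3 (r 24)))) *
    .arr 2 (.arr 4 (r 24)) ;;
  .cond (.lt (r 10) (r 22)) (22 ::= r 10)
    (.cond (.lt (r 22) (0 - r 10)) (22 ::= 0 - r 10) .skip)

/-- The clipped difference of the values of the markings at the addresses in registers `20` and
`21`, which is returned in register `22`. Array `3` holds the sorted list of the nodes and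
array `4` the clipped differences of successive exponents. -/
def difference : AProg :=
  (22 ::= 0 ;; 23 ::= 0) ;;
  forUp 23 13 differenceBody

/-- Register `14` gets an unprocessed node with processed successors. -/
def select : AProg :=
  (14 ::= 0 ;; 15 ::= 0) ;;
  forUp 15 0 (.cond (.eq (.arr 0 (r 15)) 0) (14 ::= r 15) .skip)

/-- Update the numbers of unprocessed successors. -/
def updateDegrees : AProg :=
  15 ::= 0 ;;
  forUp 15 0 (.cond (.pos (r 0 * r 15 + r 14)) (.storeArr 0 (r 15) (.arr 0 (r 15) - 1)) .skip) ;;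
  .storeArr 0 (r 14) (0 - 1)

/-- Binary search for the position of the node in register `14`. -/
def search : AProg :=
  (25 ::= 0 ;; 26 ::= r 13) ;;
  .loop (.lt (r 25) (r 26))
    ((27 ::= (r 25 + r 26) / 2 ;;
      20 ::= r 0 * r 14 ;;
      21 ::= r 0 * .arr 3 (r 27)) ;;
     difference ;;
     .cond (.lt (r 22) 0) (26 ::= r 27) (25 ::= r 27 + 1))

/-- The gaps below and above the node in register `14`. -/
def lowerGap : AProg :=
  (20 ::= r 0 * r 14 ;;
   .cond (.lt 0 (r 25)) (21 ::= r 0 * .arr 3 (r 25 - 1)) (21 ::= r 9)) ;;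
  difference ;;
  .cond (.lt (r 11) (r 22)) (28 ::= r 11) (28 ::= r 22)

def upperGap : AProg :=
  .cond (.lt (r 25) (r 13))
    ((20 ::= r 0 * .arr 3 (r 25) ;; 21 ::= r 0 * r 14) ;; difference) (22 ::= 0) ;;
  .cond (.lt (r 11) (r 22)) (29 ::= r 11) (29 ::= r 22)

/-- Move the entries of arrays `3` and `4` from the position in register `25` on. -/
def shift : AProg :=
  (31 ::= r 13 - r 25 ;; 30 ::= 0) ;;
  forUp 30 31
    (32 ::= r 13 - r 30 ;;
     .storeArr 3 (r 32) (.arr 3 (r 32 - 1)) ;;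
     .storeArr 4 (r 32) (.arr 4 (r 32 - 1)))

def insertNode : AProg :=
  lowerGap ;;
  upperGap ;;
  shift ;;
  .storeArr 3 (r 25) (r 14) ;;
  .storeArr 4 (r 25) (r 28) ;;
  .storeArr 4 (r 25 + 1) (r 29)

/-- Process one node; register `12` becomes `0` if its value is not a natural power of `q`. -/
def processNode : AProg :=
  select ;;
  updateDegrees ;;
  (20 ::= r 0 * r 14 ;; 21 ::= r 9) ;;
  difference ;;
  .cond (.lt (r 22) 0) (12 ::= 0) (search ;; insertNode)

def sortNodes : AProg :=
  (12 ::= 1 ;; 13 ::= 0) ;;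
  forUp 13 0 (.cond (r 12) processNode .skip)

/-- One step of the construction of the new nodes: absorb the next old node into the current new
node, or append the next power of `q` to the current chain, or start with the next old node. -/
def buildStep (q : ℕ) : AProg :=
  .cond (.lt (r 35) (r 0) * .eq (.arr 4 (r 35)) (r 36))
    (.storeArr 7 (.arr 3 (r 35)) (r 38 - 1) ;;
     37 ::= r 37 + .const ((q : ℤ) - 1) ;;
     35 ::= r 35 + 1 ;;
     36 ::= 0)
    (.cond (.lt (.const ((q : ℤ) - 1)) (r 37))
      (.storeArr 5 (r 38) (.arr 3 (r 35 - 1)) ;;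
       36 ::= r 36 + 1 ;;
       .storeArr 6 (r 38) (r 36) ;;
       .storePos (r 9 + r 8 + (r 38 - 1)) 1 ;;
       .storePos (r 9 + r 38) (r 38) ;;
       37 ::= r 37 / .const q ;;
       38 ::= r 38 + 1)
      (.cond (.lt (r 35) (r 0))
        (.storeArr 5 (r 38) (.arr 3 (r 35)) ;;
         .storeArr 6 (r 38) 0 ;;
         .storeArr 7 (.arr 3 (r 35)) (r 38) ;;
         .storePos (r 9 + r 8 + (r 38 - 1)) (.eq (.arr 4 (r 35)) (r 36 + 1)) ;;
         .storePos (r 9 + r 38) (r 38) ;;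
         37 ::= .const ((q : ℤ) - 1) ;;
         35 ::= r 35 + 1 ;;
         36 ::= 0 ;;
         38 ::= r 38 + 1)
        .skip))

/-- Arrays `5` and `6` describe the new nodes, array `7` maps the old nodes to new nodes. -/
def buildNodes (q : ℕ) : AProg :=
  (.storeArr 5 0 (.arr 3 0) ;;
   .storeArr 6 0 0 ;;
   .storeArr 7 (.arr 3 0) 0 ;;
   .storePos (r 9) 0 ;;
   38 ::= 1 ;;
   35 ::= 1 ;;
   36 ::= 0 ;;
   37 ::= r 0 + .const ((q : ℤ) - 1) ;;
   34 ::= 3 * r 0 ;;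
   33 ::= 0) ;;
  forUp 33 34 (buildStep q)

/-- Array `9` gets the coefficients of the marking at the address in register `41` plus the
number in register `42`. -/
def scatter : AProg :=
  (.storeArr 9 0 (r 42) ;;
   44 ::= 0) ;;
  forUp 44 0 (.storeArr 9 (.arr 7 (r 44)) (.arr 9 (.arr 7 (r 44)) + .pos (r 41 + r 44)))

/-- Array `10` gets digits, and array `9` is cleared. -/
def carry (q : ℕ) : AProg :=
  (46 ::= 0 ;;
   45 ::= 0) ;;
  forUp 45 38
    (47 ::= .arr 9 (r 45) + r 46 ;;
     .cond (.lt (r 47) 0) (46 ::= 0 - (0 - r 47) / .const q) (46 ::= r 47 / .const q) ;;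
     .storeArr 10 (r 45) (r 47 - .const q * r 46) ;;
     .storeArr 9 (r 45) 0)

/-- Remove all patterns of a digit `1` above a negative digit, and write the output. -/
def normalize (q : ℕ) : AProg :=
  (48 ::= .arr 10 (r 38 - 1) ;;
   45 ::= 1) ;;
  forUp 45 38
    (50 ::= r 38 - r 45 ;;
     49 ::= .arr 10 (r 50 - 1) ;;
     .cond (.eq (r 48) 1 * .pos (r 9 + r 8 + (r 50 - 1)) * .lt (r 49) 0)
       (48 ::= 0 ;; 49 ::= r 49 + .const q) .skip ;;
     .storePos (r 43 + r 50) (r 48) ;;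
     48 ::= r 49) ;;
  .storePos (r 43) (r 48)

def writeRow (q : ℕ) : AProg :=
  (.cond (.lt (r 39) (r 38)) (41 ::= r 0 * .arr 5 (r 39) ;; 42 ::= .arr 6 (r 39))
     (41 ::= r 0 * r 0 + r 0 * (r 39 - r 38) ;; 42 ::= 0) ;;
   43 ::= r 9 + 2 * r 8 + r 8 * r 39) ;;
  scatter ;;
  carry q ;;
  normalize q

def writeRows (q : ℕ) : AProg :=
  (40 ::= r 38 + r 1 ;;
   39 ::= 0) ;;
  forUp 39 40 (writeRow q)

def returnTables : AProg :=
  1 ::= r 38 ;;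
  2 ::= r 9 + 2 * r 8 ;;
  3 ::= r 8 ;;
  4 ::= r 9 ;;
  5 ::= r 9 + r 8 ;;
  6 ::= r 9 + 2 * r 8 + r 8 * r 38 ;;
  7 ::= r 8 ;;
  0 ::= 1

def reduce (q : ℕ) : AProg :=
  .cond (.lt 0 (r 0))
    (setup q ;;
     countDegrees ;;
     powers q ;;
     sortNodes ;;
     .cond (r 12) (buildNodes q ;; writeRows q ;; returnTables) (0 ::= 0))
    (0 ::= 1 ;;
     1 ::= 0)

theorem reduce_small {q : ℕ} {K : ℤ} (h : 10 * (q : ℤ) + 100 ≤ K) : (reduce q).Small K := by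
  have h0 : (0 : ℤ) ≤ K := by omega
  have h1 : (1 : ℤ) ≤ K := by omega
  have h2 : (2 : ℤ) ≤ K := by omega
  have h3 : (3 : ℤ) ≤ K := by omega
  have hq : (q : ℤ) ≤ K := by omega
  have hq2 : 2 * (q : ℤ) ≤ K := by omega
  have hq1 : |(q : ℤ) - 1| ≤ K := by rw [abs_le]; constructor <;> omega
  simp [reduce, setup, countDegrees, countDegreesBody, powers, sortNodes, processNode, select,
    updateDegrees, difference, differenceBody, search, insertNode, lowerGap, upperGap, shift,
    buildNodes, buildStep, writeRows, writeRow, scatter, carry, normalize, returnTables, forUp,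
    AProg.Small, AExpr.sub_def, AExpr.div_def, AExpr.cost, AExpr.ConstLE, maxCost, *]

end ArrayMachine

/-! ### Clipped differences -/

namespace ArrayMachine

open RAM

/-- `d` is `A`, up to clipping at a bound that is at least `B`. -/
def ClipRel (B d A : ℤ) : Prop := d = A ∨ (B ≤ d ∧ B ≤ A) ∨ (d ≤ -B ∧ A ≤ -B)

namespace ClipRel

variable {B d A : ℤ}

/-- In the clipped cases the perturbation moves both sides by the same amount, which is charged to
the bound. -/
theorem add (h : ClipRel B d A) {s c : ℤ} (hc : |c| ≤ s) : ClipRel (B - s) (d + c) (A + c) := by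
  rw [abs_le] at hc
  rcases h with h | h | h
  · exact .inl (by rw [h])
  · exact .inr (.inl (by omega))
  · exact .inr (.inr (by omega))

theorem mono (h : ClipRel B d A) {B' : ℤ} (hB : B' ≤ B) : ClipRel B' d A := by
  unfold ClipRel at *; omega

/-- Multiplication costs nothing, because factors at least 1 do not decrease absolute values. If d
is exact and nonzero but the factor is clipped to H, both products lie beyond H ≥ B on the same
side. -/
theorem mul (h : ClipRel B d A) (hB : 0 ≤ B) {H x y : ℤ} (hH : B ≤ H) (hx : 1 ≤ x)
    (hxy : x = y ∨ (x = H ∧ H ≤ y)) : ClipRel B (d * x) (A * y) := by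
  have hy : 1 ≤ y := by omega
  rcases h with h | h | h
  · subst h
    rcases hxy with rfl | ⟨rfl, hxy⟩
    · exact .inl rfl
    · rcases lt_trichotomy d 0 with hd | rfl | hd
      · exact .inr (.inr ⟨by nlinarith, by nlinarith⟩)
      · exact .inl (by simp)
      · exact .inr (.inl ⟨by nlinarith, by nlinarith⟩)
  · exact .inr (.inl ⟨by nlinarith, by nlinarith⟩)
  · exact .inr (.inr ⟨by nlinarith, by nlinarith⟩)

theorem clip (h : ClipRel B d A) {H d' : ℤ} (hH : B ≤ H)
    (hd : (H < d ∧ d' = H) ∨ (d < -H ∧ d' = -H) ∨ d' = d) : ClipRel B d' A := by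
  unfold ClipRel at *; omega

theorem lt_zero_iff (h : ClipRel B d A) (hB : 0 < B) : d < 0 ↔ A < 0 := by
  unfold ClipRel at h; omega

theorem min_eq (h : ClipRel B d A) (hA : 0 ≤ A) (hB : 0 < B) : min B d = min B A := by
  unfold ClipRel at h; omega

end ClipRel

/-- This exceeds 2qn, the total loss in Horner's rule over n digits, and also 2n, so that the chain
distances up to n and their successors are never clipped. -/
def gapBound (q n : ℕ) : ℕ := 2 * q * (n + 1)

/-- Starting Horner's rule with twice `gapBound` leaves at least `gapBound` after all losses. -/
def valueBound (q n : ℕ) : ℕ := 2 * gapBound q n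

/-- Clipping the gap at G is invisible behind clipping the power at 2G, because 2G ≤ 2 ^ G ≤ q ^ G.
-/
theorem pow_clip {q : ℕ} (hq : 2 ≤ q) {G : ℕ} (hG : 1 ≤ G) (g : ℕ) :
    1 ≤ min (2 * G) (q ^ min G g) ∧ (min (2 * G) (q ^ min G g) = q ^ g ∨
      min (2 * G) (q ^ min G g) = 2 * G ∧ 2 * G ≤ q ^ g) := by
  have h1 : ∀ k, 1 ≤ q ^ k := fun k => Nat.one_le_pow _ _ (by omega)
  refine ⟨le_min (by omega) (h1 _), ?_⟩
  rcases le_total g G with h | h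
  · rw [min_eq_right h]
    rcases le_total (2 * G) (q ^ g) with h' | h'
    · exact .inr ⟨min_eq_left h', h'⟩
    · exact .inl (min_eq_right h')
  · rw [min_eq_left h]
    have h2 : 2 * G ≤ q ^ G := by
      calc 2 * G ≤ 2 ^ G := by
            have : G - 1 < 2 ^ (G - 1) := Nat.lt_two_pow_self
            obtain ⟨k, rfl⟩ : ∃ k, G = k + 1 := ⟨G - 1, by omega⟩
            rw [pow_succ]; simp at this; omega
        _ ≤ q ^ G := Nat.pow_le_pow_left hq G
    exact .inr ⟨min_eq_left h2, h2.trans (Nat.pow_le_pow_right (by omega) h)⟩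

/-! ### Bounds for cell contents and the constant registers -/

/-- `K` is large enough for all numbers that occur. -/
structure Room (q n m : ℕ) (K : ℤ) : Prop where
  two_le : 2 ≤ q
  one_le : 1 ≤ n
  le : ((100 * q ^ 2 * (n + m + 2) ^ 2 : ℕ) : ℤ) ≤ K

/-- There are at most 2n new nodes, so this many cells hold a row, the node list or the bit vector
before the number of new nodes is known. -/
def stride (n : ℕ) : ℕ := 2 * n + 2

def offset (n m : ℕ) : ℕ := n * n + n * m

/-- The registers with constant contents. -/
structure Base (q n m : ℕ) (R : ℕ → ℤ) : Prop where
  r0 : R 0 = n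
  r1 : R 1 = m
  r8 : R 8 = stride n
  r9 : R 9 = offset n m
  r10 : R 10 = valueBound q n
  r11 : R 11 = gapBound q n

theorem Base.frame {q n m : ℕ} {R R' : ℕ → ℤ} (h : Base q n m R)
    (hR : ∀ x, x < 12 → R' x = R x) : Base q n m R' :=
  ⟨(hR _ (by norm_num)).trans h.r0, (hR _ (by norm_num)).trans h.r1,
    (hR _ (by norm_num)).trans h.r8, (hR _ (by norm_num)).trans h.r9,
    (hR _ (by norm_num)).trans h.r10, (hR _ (by norm_num)).trans h.r11⟩

/-- This is the largest number in `difference`: a clipped value plus a digit difference, times a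
clipped power. -/
theorem Room.value {q n m : ℕ} {K : ℤ} (h : Room q n m K) :
    ((valueBound q n : ℤ) + 2 * q) * valueBound q n ≤ K := by
  refine le_trans ?_ h.le
  have h2 := h.two_le
  have h1 := h.one_le
  norm_cast
  unfold valueBound gapBound
  have : (2 * (2 * q * (n + 1)) + 2 * q) * (2 * (2 * q * (n + 1))) =
    q ^ 2 * ((4 * (n + 1) + 2) * (4 * (n + 1))) := by ring
  rw [this, mul_comm 100, mul_assoc]
  refine Nat.mul_le_mul_left _ ?_
  nlinarith [Nat.zero_le m, Nat.zero_le (n * m)]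

/-- A sorted list `σ` of `i` nodes, whose successive exponents are `F 1, …, F i`. -/
structure SortedList (q n i : ℕ) (M : Mem) (σ F : ℕ → ℕ) : Prop where
  list : ∀ p < i, M.arr 3 p = σ p
  zero : F 0 = 0
  mono : ∀ p < i, F p ≤ F (p + 1)
  gap : ∀ p < i, M.arr 4 p = (min (gapBound q n) (F (p + 1) - F p) : ℕ)
  pow : ∀ j ≤ gapBound q n, M.arr 2 j = (min (valueBound q n) (q ^ j) : ℕ)

/-- Horner's rule from the top of the list. The clipping bound starts at H = 2G and loses 2q per
digit; at most n digits leave at least G, as G ≥ 2qn. -/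
theorem difference_spec {q n m i : ℕ} {K W : ℤ} (hroom : Room q n m K) {R : ℕ → ℤ} {M : Mem}
    {σ F : ℕ → ℕ} (hR : Base q n m R) (hi : R 13 = i) (hin : i ≤ n) (hS : SortedList q n i M σ F)
    {a b : ℕ} (ha : R 20 = a) (hb : R 21 = b)
    (hab : ∀ p < i, |M.pos (a + σ p) - M.pos (b + σ p)| ≤ 2 * q) :
    ATri K W difference R M (70 * n + 10) (fun R' M' => M' = M ∧
      ClipRel (gapBound q n) (R' 22)
        (∑ p ∈ Finset.range i, (M.pos (a + σ p) - M.pos (b + σ p)) * (q : ℤ) ^ F (p + 1)) ∧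
      ∀ x ∉ difference.writes, R' x = R x) := by
  have hq := hroom.two_le
  have hK := hroom.value
  have hG1 : 1 ≤ gapBound q n := by unfold gapBound; nlinarith
  obtain ⟨H, hHdef⟩ : ∃ H : ℤ, H = valueBound q n := ⟨_, rfl⟩
  obtain ⟨G, hGdef⟩ : ∃ G : ℤ, G = gapBound q n := ⟨_, rfl⟩
  rw [← hHdef] at hK
  rw [← hGdef]
  have hHG : H = 2 * G := by simp [hHdef, hGdef, valueBound]
  have hGn : 2 * (q : ℤ) * n ≤ G := by
    rw [hGdef]; unfold gapBound; push_cast; nlinarith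
  have hG1' : 1 ≤ G := by rw [hGdef]; exact_mod_cast hG1
  have hHK : H ≤ K := by nlinarith
  have hn0 : (n : ℤ) ≤ 2 * q * n := by nlinarith
  have hnK : (n : ℤ) ≤ K := by omega
  have hK0 : 0 ≤ K := by omega
  refine ATri.frame (Q := fun R' M' => M' = M ∧ _) ?_ |>.mono le_rfl
    fun R' M' h => ⟨h.1.1, h.1.2, h.2⟩
  refine ATri.seq (T₁ := 4) (T₂ := 70 * n + 4) (Q' := fun R' M' =>
      R' = Function.update (Function.update R 22 0) 23 0 ∧ M' = M)
    ((ATri.of_wp (by simpa [AProg.wp, AExpr.Safe, AExpr.eval] using hK0)).mono (by decide)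
      fun _ _ => id) ?_ (by omega)
  rintro R₁ M ⟨rfl, rfl⟩
  -- `A` is the unclipped Horner value after the top `k` digits. It is measured in units of q ^ F (i
  -- - k), so that at `k = i` the unit is q ^ F 0 = 1.
  refine ATri.forUp (a := 0) (b := i) (T₁ := 62) (by decide) (by decide) (by decide) (by simp)
    (by simp [hi]) (by omega)
    (fun k R' M' => M' = M ∧ |R' 22| ≤ H ∧ ∃ A : ℤ, ClipRel (H - 2 * q * k) (R' 22) A ∧
      A * (q : ℤ) ^ F (i - k) = ∑ p ∈ Finset.Ico (i - k) i,
        (M.pos (a + σ p) - M.pos (b + σ p)) * (q : ℤ) ^ F (p + 1)) ?_ ?_ ?_ ?_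
  · refine ⟨rfl, by simp; omega, 0, ?_, by simp⟩
    simp [ClipRel]
  · rintro k R' M' _ hk hR23 hR13 hfr ⟨rfl, hd, A, hA, hsum⟩
    have hR' : R' 10 = H ∧ R' 20 = a ∧ R' 21 = b := by
      refine ⟨?_, ?_, ?_⟩
      · rw [hfr 10 (by decide) (by decide)]; simp [hR.r10, hHdef]
      · rw [hfr 20 (by decide) (by decide)]; simp [ha]
      · rw [hfr 21 (by decide) (by decide)]; simp [hb]
    obtain ⟨h10, h20, h21⟩ := hR'
    obtain ⟨p, rfl⟩ : ∃ p, i = p + k + 1 := ⟨i - k - 1, by omega⟩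
    have hp : p < p + k + 1 := by omega
    have hidx : ((p + k + 1 : ℕ) : ℤ) - 1 - (k : ℤ) = (p : ℕ) := by push_cast; ring
    have hgap := hS.gap p hp
    have hpw := hS.pow (min (gapBound q n) (F (p + 1) - F p)) (min_le_left _ _)
    obtain ⟨hx1, hx2⟩ := pow_clip hq hG1 (F (p + 1) - F p)
    rw [← valueBound] at hx1 hx2
    set x : ℕ := min (valueBound q n) (q ^ min (gapBound q n) (F (p + 1) - F p)) with hxdef
    have hxH : (x : ℤ) ≤ H := by rw [hHdef]; exact_mod_cast min_le_left _ _
    have hkn : (k : ℤ) + 1 ≤ n := by omega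
    have hBk : 2 * (q : ℤ) * (k + 1) ≤ G := le_trans (by gcongr) hGn
    set c := M'.pos (a + σ p) - M'.pos (b + σ p) with hc
    have hcq : |c| ≤ 2 * q := hab p hp
    have hBk0 : 0 ≤ 2 * (q : ℤ) * ((k : ℤ) + 1) := by nlinarith
    -- The new digit costs 2q of the bound; the multiplication by the clipped power costs nothing.
    have hrel : ClipRel (H - 2 * q * (k + 1)) ((R' 22 + c) * x)
        ((A + c) * (q : ℤ) ^ (F (p + 1) - F p)) := by
      refine ClipRel.mul (H := H) ((hA.add hcq).mono (le_of_eq (by ring))) (by omega) (by omega)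
        (by exact_mod_cast hx1) ?_
      rcases hx2 with h | ⟨h, h'⟩
      · left; rw [h]; push_cast; rfl
      · right; exact ⟨by rw [h, hHdef], by rw [hHdef]; exact_mod_cast h'⟩
    have hval : |(R' 22 + c) * x| ≤ K := by
      rw [abs_mul, abs_of_nonneg (by positivity : (0 : ℤ) ≤ x)]
      refine le_trans (mul_le_mul ((abs_add_le _ _).trans (add_le_add hd hcq)) hxH (by positivity)
        (by omega)) hK
    have hnat : ((a : ℤ) + (σ p : ℕ)).toNat = a + σ p ∧ ((b : ℤ) + (σ p : ℕ)).toNat = b + σ p := by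
      omega
    have hnew : ∀ d', ((H < (R' 22 + c) * x ∧ d' = H) ∨ ((R' 22 + c) * x < -H ∧ d' = -H) ∨
        d' = (R' 22 + c) * x) → ∃ A' : ℤ, ClipRel (H - 2 * q * (k + 1)) d' A' ∧
        A' * (q : ℤ) ^ F (p + k + 1 - (k + 1)) = ∑ p' ∈ Finset.Ico (p + k + 1 - (k + 1))
          (p + k + 1),
          (M'.pos (a + σ p') - M'.pos (b + σ p')) * (q : ℤ) ^ F (p' + 1) := by
      intro d' hd'
      refine ⟨_, hrel.clip (by omega) hd', ?_⟩
      rw [show p + k + 1 - (k + 1) = p by omega, Finset.sum_eq_sum_Ico_succ_bot hp]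
      rw [show p + k + 1 - k = p + 1 by omega] at hsum
      rw [← hsum, mul_assoc, ← pow_add, Nat.sub_add_cancel (hS.mono p hp)]
      ring
    have h24 : (p : ℤ) ≤ K := by omega
    refine (ATri.of_wp (Q := fun R'' M'' => _) ?_).mono (by decide) fun _ _ h => h
    have hH0 : 0 ≤ H := by omega
    rw [abs_le] at hval
    simp only [differenceBody, AProg.wp, AExpr.sub_def, AExpr.Safe, AExpr.eval, Op.apply,
      Function.update_apply, hR13, hR23, hidx, h10, h20, h21, hS.list p hp, hnat, Nat.reduceEqDiff,
      Int.toNat_natCast, hgap, hpw, ← hc, if_true, if_false, true_and, and_true, zero_sub,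
      ne_eq, ite_eq_right_iff, one_ne_zero, imp_false, not_lt, not_le, Int.natCast_nonneg]
    refine ⟨by omega, by omega, hval,
      fun h => ⟨by omega, abs_le.2 (by omega), hnew _ (.inl ⟨h, rfl⟩)⟩, fun h =>
      ⟨fun h' => ⟨by omega, abs_le.2 (by omega), hnew _ (.inr (.inl ⟨h', rfl⟩))⟩,
      fun h' => ⟨abs_le.2 ⟨h', h⟩, hnew _ (.inr (.inr rfl))⟩⟩⟩
  · simp only [Nat.sub_zero]; omega
  · rintro R' M' ⟨rfl, hd, A, hA, hsum⟩ _ _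
    refine ⟨rfl, ?_⟩
    simp [hS.zero] at hsum
    rw [← hsum]
    refine hA.mono ?_
    have : 2 * (q : ℤ) * i ≤ 2 * q * n := by gcongr
    omega

end ArrayMachine

/-! ### Preparations -/

namespace ArrayMachine

open RAM

variable {q n m : ℕ} {K W : ℤ} {R : ℕ → ℤ} {M : Mem}

theorem Room.const_le (h : Room q n m K) : 10 * (q : ℤ) + 100 ≤ K := by
  refine le_trans ?_ h.le
  have h2 := h.two_le
  have h1 := h.one_le
  norm_cast
  have : 3 ^ 2 ≤ (n + m + 2) ^ 2 := Nat.pow_le_pow_left (by omega) 2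
  nlinarith [Nat.mul_le_mul_left (100 * q ^ 2) this]

theorem Room.address_le (h : Room q n m K) :
    (offset n m : ℤ) + stride n * (2 * n + m + 4) ≤ K := by
  refine le_trans ?_ h.le
  have h2 := h.two_le
  have h1 := h.one_le
  norm_cast
  have : 4 ≤ q ^ 2 := by nlinarith
  unfold offset stride
  nlinarith [Nat.mul_le_mul_right ((n + m + 2) ^ 2) this, Nat.zero_le (n * m), Nat.zero_le (m * m)]

theorem Room.linear_le (h : Room q n m K) : 10 * (q : ℤ) * (n + m + 2) ≤ K := by
  refine le_trans ?_ h.le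
  have h2 := h.two_le
  norm_cast
  nlinarith [Nat.mul_le_mul h2 (Nat.zero_le (n + m + 2)), Nat.zero_le (n + m), Nat.mul_le_mul_left
    (q * (n + m + 2)) (Nat.mul_pos (by omega : 0 < q) (by omega : 0 < n + m + 2))]

theorem Room.clip_le (h : Room q n m K) : (valueBound q n : ℤ) * q ≤ K := by
  refine le_trans ?_ h.le
  have h2 := h.two_le
  norm_cast
  unfold valueBound gapBound
  have : 2 * (2 * q * (n + 1)) * q = q ^ 2 * (4 * (n + 1)) := by ring
  rw [this, mul_comm 100, mul_assoc]
  refine Nat.mul_le_mul_left _ ?_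
  nlinarith [Nat.zero_le m, Nat.zero_le (n * m)]

theorem Room.basic (h : Room q n m K) : 100 ≤ K ∧ 4 * (n : ℤ) + 4 * m + 4 ≤ K ∧
    3 * (q : ℤ) * n + q ≤ K ∧ (valueBound q n : ℤ) + 1 ≤ K ∧ valueBound q n = 2 * gapBound q n ∧
    2 * n < gapBound q n := by
  have h1 := h.const_le
  have h2 := h.linear_le
  have h3 := h.clip_le
  have h4 := h.two_le
  have h5 := h.one_le
  refine ⟨by omega, by nlinarith, by nlinarith, ?_, rfl, ?_⟩
  · have : 1 ≤ valueBound q n := by unfold valueBound gapBound; nlinarith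
    have h4' : (2 : ℤ) ≤ q := by exact_mod_cast h4
    have : (1 : ℤ) ≤ valueBound q n := by exact_mod_cast this
    nlinarith
  · unfold gapBound; nlinarith

theorem setup_spec (hroom : Room q n m K) (h0 : R 0 = n) (h1 : R 1 = m) :
    ATri K W (setup q) R M 30 (fun R' M' => Base q n m R' ∧ M' = M) := by
  have hb := hroom.basic
  have ha := hroom.address_le
  have hx : (0 : ℤ) ≤ stride n * (2 * n + m + 4) := by positivity
  refine ATri.wp ?_ (by simp [setup, AProg.time, AExpr.cost])
  have e8 : (n : ℤ) + n + 2 = (stride n : ℕ) := by unfold stride; push_cast; ring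
  have e9 : (n : ℤ) * n + n * m = (offset n m : ℕ) := by unfold offset; push_cast; ring
  have e11 : 2 * (q : ℤ) * (n + 1) = (gapBound q n : ℕ) := by unfold gapBound; push_cast; ring
  have e10 : (gapBound q n : ℤ) + (gapBound q n : ℕ) = (valueBound q n : ℕ) := by
    unfold valueBound; push_cast; ring
  have hs : (stride n : ℤ) ≤ K := by rw [← e8]; omega
  simp only [setup, AProg.wp, AExpr.Safe, AExpr.eval, Op.apply,
    Function.update_apply, Nat.reduceEqDiff, if_true, if_false, true_and, and_true, h0, h1, e8, e9,
    e10, e11]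
  refine ⟨by omega, by omega, by omega, by omega, ?_⟩
  constructor <;> simp [h0, h1]

/-- The number of successors of `u` outside of `D` in the graph with adjacency matrix `P`. -/
def outDegree (P : ℕ → ℤ) (n : ℕ) (D : Finset ℕ) (u : ℕ) : ℕ :=
  ((Finset.range n).filter fun v => P (n * u + v) ≠ 0 ∧ v ∉ D).card

theorem address_toNat (a b c : ℕ) : ((a : ℤ) * b + c).toNat = a * b + c := by
  norm_cast

theorem countDegrees_spec (hroom : Room q n m K) (hR : Base q n m R) :
    ATri K W countDegrees R M (60 * n ^ 2 + 60 * n + 60) (fun _ M' => M.AgreeOff [0] M' ∧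
      ∀ u < n, M'.arr 0 u = outDegree M.pos n ∅ u) := by
  have hb := hroom.basic
  refine ATri.wp_seq (T₂ := 60 * n ^ 2 + 60 * n + 50) ?_ (by simp [AProg.time, AExpr.cost]; omega)
  simp only [AProg.wp, AExpr.Safe, AExpr.eval, true_and]
  refine ⟨by omega, ?_⟩
  refine ATri.forUp (a := 0) (b := n) (T₁ := 24 * n + 30) (by decide) (by decide) (by decide)
    (by simp)
    (by simp [hR.r0]) (by omega)
    (fun k _ M' => M.AgreeOff [0] M' ∧ ∀ u < k, M'.arr 0 u = outDegree M.pos n ∅ u)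
    ⟨.refl _ _, by simp⟩ ?_ (by rw [Nat.sub_zero]; nlinarith) (fun _ _ h _ _ => h)
  rintro u R₁ M₁ _ hu hR15 hR0 _ ⟨hM, hdeg⟩
  refine ATri.wp_seq (T₂ := 24 * n + 26) ?_ (by simp [AProg.time, AExpr.cost]; omega)
  simp only [AProg.wp, AExpr.Safe, AExpr.eval, true_and]
  refine ⟨by omega, by omega, ?_⟩
  refine ATri.seq (T₁ := 24 * n + 10) (T₂ := 10) (Q' := fun R' M' => M' = M₁ ∧
    R' 17 = outDegree M.pos n ∅ u ∧ R' 15 = u) ?_ ?_ (by omega)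
  · refine ATri.forUp (a := 0) (b := n) (T₁ := 12) (by decide) (by decide) (by decide) (by simp)
      (by simp [hR0]) (by omega) (fun k R' M' => M' = M₁ ∧ R' 17 =
        ((Finset.range k).filter fun v => M.pos (n * u + v) ≠ 0 ∧ v ∉ (∅ : Finset ℕ)).card) ?_ ?_
      (by rw [Nat.sub_zero]; nlinarith) ?_
    · simp
    · rintro k R₂ M₂ _ hk hR16 hR0' hfr ⟨rfl, h17⟩
      have h15 : R₂ 15 = u := by
        rw [hfr 15 (by decide) (by decide)]; simp [hR15]
      refine ATri.wp ?_ (by decide)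
      have hcard := Finset.card_filter_le (Finset.range k)
        (fun v => M.pos (n * u + v) ≠ 0 ∧ v ∉ (∅ : Finset ℕ))
      rw [Finset.card_range] at hcard
      rw [Finset.range_add_one, Finset.filter_insert]
      simp only [AProg.wp, AExpr.Safe, AExpr.eval, Op.apply,
        Function.update_apply, Nat.reduceEqDiff, if_true, if_false, true_and, hR0',
        h15, hR16, h17, address_toNat, hM.1]
      refine ⟨by positivity, fun h => ⟨by omega, ?_⟩, fun h => ?_⟩
      · rw [if_pos ⟨h, by simp⟩, Finset.card_insert_of_notMem (by simp)]
        push_cast; ring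
      · rw [if_neg (by simp [h])]
    · rintro R' M' ⟨h₁, h₂⟩ _ hfr
      exact ⟨h₁, h₂, by rw [hfr 15 (by decide) (by decide)]; simp [hR15]⟩
  · rintro R' M' ⟨rfl, h17, h15⟩
    refine ATri.wp ?_ (by decide)
    have hcard : outDegree M.pos n ∅ u ≤ n := (Finset.card_filter_le _ _).trans (by simp)
    simp only [AProg.wp, AExpr.Safe, AExpr.eval, true_and, h15, h17, Int.toNat_natCast]
    refine ⟨by omega, by omega, hM.setArr (by simp) _ _, fun v hv => ?_⟩
    simp only [Mem.setArr_arr, if_true, Function.update_apply]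
    split_ifs with h
    · rw [h]
    · exact hdeg v (by omega)

theorem powers_spec (hroom : Room q n m K) (hR : Base q n m R) :
    ATri K W (powers q) R M (100 * (gapBound q n + 1) + 60) (fun _ M' => M.AgreeOff [2] M' ∧
      ∀ j ≤ gapBound q n, M'.arr 2 j = (min (valueBound q n) (q ^ j) : ℕ)) := by
  have hb := hroom.basic
  have hq := hroom.two_le
  have hclip := hroom.clip_le
  refine ATri.wp_seq (T₂ := 100 * (gapBound q n + 1) + 40) ?_
    (by simp [AProg.time, AExpr.cost]; omega)
  simp only [AProg.wp, AExpr.Safe, AExpr.eval, Op.apply, true_and,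
    Function.update_apply, Nat.reduceEqDiff, if_false, hR.r11]
  refine ⟨by omega, by omega, by omega, ?_⟩
  refine ATri.forUp (a := 0) (b := gapBound q n + 1) (T₁ := 40) (by decide)
    (by simp [AProg.writes]) (by simp [AProg.writes])
    (by simp) (by simp) (by omega)
    (fun k R' M' => M.AgreeOff [2] M' ∧ R' 17 = (min (valueBound q n) (q ^ k) : ℕ) ∧
      ∀ j < k, M'.arr 2 j = (min (valueBound q n) (q ^ j) : ℕ)) ?_ ?_ (by omega) ?_
  · refine ⟨.refl _ _, ?_, by simp⟩
    have : 1 ≤ valueBound q n := by omega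
    simp [this]
  · rintro k R' M' _ hk h16 _ hfr ⟨hM, h17, harr⟩
    have h10 : R' 10 = valueBound q n := by
      rw [hfr 10 (by simp [AProg.writes]) (by decide)]; simp [hR.r10]
    refine ATri.wp ?_ (by simp [AProg.time, AExpr.cost])
    obtain ⟨x, hx⟩ : ∃ x, x = min (valueBound q n) (q ^ k) := ⟨_, rfl⟩
    rw [← hx] at h17
    have hxv : x ≤ valueBound q n := hx ▸ min_le_left _ _
    have hxq : (x : ℤ) * q ≤ valueBound q n * q := by
      have : (x : ℤ) ≤ valueBound q n := by exact_mod_cast hxv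
      gcongr
    have hx0 : (0 : ℤ) ≤ x * q := by positivity
    -- Clipping before the multiplication is harmless, since the factor q is at least 1.
    have hnext : min (valueBound q n) (q ^ (k + 1)) = min (valueBound q n) (x * q) := by
      rw [hx, pow_succ]
      rcases le_total (valueBound q n) (q ^ k) with h | h
      · rw [min_eq_left h, min_eq_left (by nlinarith), min_eq_left (by nlinarith)]
      · rw [min_eq_right h]
    have harr' : ∀ j < k + 1, (M'.setArr 2 k x).arr 2 j = (min (valueBound q n) (q ^ j) : ℕ) := by
      intro j hj
      simp only [Mem.setArr_arr, if_true, Function.update_apply]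
      split_ifs with h
      · rw [h, hx]
      · exact harr j (by omega)
    simp only [AProg.wp, AExpr.Safe, AExpr.eval, Op.apply,
      Function.update_apply, Nat.reduceEqDiff, if_true, if_false, true_and, h10, h16, h17,
      Int.toNat_natCast, ne_eq, ite_eq_right_iff, one_ne_zero, imp_false, not_lt, not_le, hnext]
    refine ⟨by omega, by omega, by omega, fun h => ⟨by omega, hM.setArr (by simp) _ _, ?_, harr'⟩,
      fun h => ⟨hM.setArr (by simp) _ _, ?_, harr'⟩⟩
    · rw [min_eq_left (by exact_mod_cast h.le)]
    · rw [min_eq_right (by exact_mod_cast h)]; push_cast; rfl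
  · rintro R' M' ⟨h₁, _, h₂⟩ _ _
    exact ⟨h₁, fun j hj => h₂ j (by omega)⟩

/-- Register `14` gets some `u` with `cnt u = 0`. -/
theorem select_spec (hroom : Room q n m K) (hR : R 0 = n) (hex : ∃ u < n, M.arr 0 u = 0) :
    ATri K W select R M (40 * n + 20) (fun R' M' => M' = M ∧
      ∃ w < n, R' 14 = (w : ℕ) ∧ M.arr 0 w = 0) := by
  have hb := hroom.basic
  refine ATri.wp_seq (T₂ := 40 * n + 10) ?_ (by simp [AProg.time, AExpr.cost]; omega)
  simp only [AProg.wp, AExpr.Safe, AExpr.eval, true_and]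
  refine ⟨by omega, by omega, ?_⟩
  refine ATri.forUp (a := 0) (b := n) (T₁ := 20) (by decide) (by decide) (by decide) (by simp)
    (by simp [hR]) (by omega) (fun k R' M' => M' = M ∧ ∀ u < k, M.arr 0 u = 0 →
      ∃ w < n, R' 14 = (w : ℕ) ∧ M.arr 0 w = 0) ?_ ?_ (by omega) ?_
  · simp
  · rintro k R' M' _ hk h15 _ _ ⟨rfl, h⟩
    refine ATri.wp ?_ (by decide)
    simp only [AProg.wp, AExpr.Safe, AExpr.eval, Op.apply,
      Function.update_apply, Nat.reduceEqDiff, if_true, if_false, true_and, and_true, h15,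
      Int.toNat_natCast, ne_eq, ite_eq_right_iff, one_ne_zero, imp_false, not_not]
    refine ⟨by omega, fun h0 => ⟨by omega, fun u _ _ => ⟨k, hk, rfl, h0⟩⟩, fun h0 u hu hu0 => ?_⟩
    obtain rfl | hlt := eq_or_lt_of_le (Nat.lt_succ_iff.1 hu)
    · exact absurd hu0 h0
    · exact h u hlt hu0
  · rintro R' M' ⟨rfl, h⟩ _ _
    obtain ⟨u, hu, h0⟩ := hex
    exact ⟨rfl, h u hu h0⟩

/-- The processed set is closed under successors, so the new node, which lies outside of it, is no
successor of a processed node, and no entry -1 is decremented. The entry of the new node itself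
becomes -1, which hides it from `select`. -/
theorem updateDegrees_spec (hroom : Room q n m K) (hR : R 0 = n) {w : ℕ} (hw : w < n)
    (hRw : R 14 = w) {D : Finset ℕ} (hwD : w ∉ D)
    (hcnt : ∀ u < n, M.arr 0 u = if u ∈ D then -1 else (outDegree M.pos n D u : ℤ))
    (hD : ∀ u ∈ D, ∀ v < n, M.pos (n * u + v) ≠ 0 → v ∈ D) :
    ATri K W updateDegrees R M (60 * n + 30) (fun _ M' => M.AgreeOff [0] M' ∧ ∀ u < n,
      M'.arr 0 u = if u ∈ insert w D then -1 else (outDegree M.pos n (insert w D) u : ℤ)) := by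
  have hb := hroom.basic
  refine ATri.wp_seq (T₂ := 60 * n + 20) ?_ (by simp [AProg.time, AExpr.cost]; omega)
  simp only [AProg.wp, AExpr.Safe, AExpr.eval, true_and]
  refine ⟨by omega, ?_⟩
  have hdeg : ∀ u, outDegree M.pos n D u ≤ n := fun u => (Finset.card_filter_le _ _).trans (by simp)
  have hstep : ∀ u, u ∉ D → (outDegree M.pos n D u : ℤ) -
      (if M.pos (n * u + w) ≠ 0 then 1 else 0) = outDegree M.pos n (insert w D) u := by
    intro u hu
    split_ifs with h
    -- Processing `w` removes exactly one element from the set of unprocessed successors.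
    · have : (Finset.range n).filter (fun v => M.pos (n * u + v) ≠ 0 ∧ v ∉ insert w D) =
          ((Finset.range n).filter fun v => M.pos (n * u + v) ≠ 0 ∧ v ∉ D).erase w := by
        ext v
        simp only [Finset.mem_filter, Finset.mem_erase, Finset.mem_insert]
        tauto
      unfold outDegree
      have hmem : w ∈ (Finset.range n).filter fun v => M.pos (n * u + v) ≠ 0 ∧ v ∉ D := by
        simp [hw, h, hwD]
      rw [this, Finset.card_erase_of_mem hmem, Nat.cast_sub (Finset.card_pos.2 ⟨w, hmem⟩)]
      simp
    · unfold outDegree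
      rw [sub_zero]
      congr 2
      ext v
      simp only [Finset.mem_filter, Finset.mem_insert]
      constructor
      · rintro ⟨h₁, h₂, h₃⟩
        exact ⟨h₁, h₂, by rintro (rfl | h₄) <;> tauto⟩
      · tauto
  refine ATri.seq (T₁ := 60 * n + 10) (T₂ := 10) (Q' := fun R' M' => M.AgreeOff [0] M' ∧ R' 14 = w ∧
    ∀ u < n, M'.arr 0 u = if u ∈ D then -1 else (outDegree M.pos n (insert w D) u : ℤ)) ?_ ?_
    (by omega)
  · refine ATri.forUp (a := 0) (b := n) (T₁ := 30) (by decide) (by decide) (by decide) (by simp)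
      (by simp [hR]) (by omega) (fun k R' M' => M.AgreeOff [0] M' ∧ ∀ u < n,
        M'.arr 0 u = if u ∈ D then -1 else if u < k then (outDegree M.pos n (insert w D) u : ℤ)
          else outDegree M.pos n D u) ?_ ?_ (by omega) ?_
    · exact ⟨.refl _ _, fun u hu => by simpa using hcnt u hu⟩
    · rintro k R' M' _ hk h15 h0 hfr ⟨hM, h⟩
      have h14 : R' 14 = w := by rw [hfr 14 (by decide) (by decide)]; simp [hRw]
      refine ATri.wp ?_ (by decide)
      have hk' := h k hk
      rw [if_neg (lt_irrefl k)] at hk'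
      have := hdeg k
      simp only [AProg.wp, AExpr.sub_def, AExpr.Safe, AExpr.eval, Op.apply,
        true_and, and_true, h15, h14, h0, address_toNat, Int.toNat_natCast, hM.1]
      have hlt : ∀ u, u ≠ k → (u < k + 1 ↔ u < k) := fun u hu => by omega
      refine ⟨by positivity, fun hne => ⟨by omega, by omega, ?_, hM.setArr (by simp) _ _,
        fun u hu => ?_⟩,
        fun h0 => ⟨hM, fun u hu => ?_⟩⟩
      · rw [hk']; split_ifs <;> omega
      · simp only [Mem.setArr_arr, if_true, Function.update_apply]
        by_cases huk : u = k
        · subst huk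
          have huD : u ∉ D := fun hu' => hwD (hD u hu' w hw hne)
          rw [if_pos rfl, hk', if_neg huD, if_neg huD, if_pos (Nat.lt_succ_self _), ← hstep u huD,
            if_pos hne]
        · simp only [if_neg huk, h u hu, hlt u huk]
      · by_cases huk : u = k
        · subst huk
          rw [hk']
          by_cases huD : u ∈ D
          · simp [huD]
          · rw [if_neg huD, if_neg huD, if_pos (Nat.lt_succ_self _), ← hstep u huD,
              if_neg (not_not.2 h0), sub_zero]
        · simp only [h u hu, hlt u huk]
    · rintro R' M' ⟨hM, h⟩ _ hfr
      refine ⟨hM, by rw [hfr 14 (by decide) (by decide)]; simp [hRw], fun u hu => ?_⟩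
      rw [h u hu, if_pos hu]
  · rintro R' M' ⟨hM, h14, h⟩
    refine ATri.wp ?_ (by decide)
    simp only [AProg.wp, AExpr.sub_def, AExpr.Safe, AExpr.eval, Op.apply,
        true_and, and_true, h14, Int.toNat_natCast]
    refine ⟨by omega, by omega, hM.setArr (by simp) _ _, fun u hu => ?_⟩
    simp only [Mem.setArr_arr, if_true, Function.update_apply]
    by_cases huw : u = w
    · simp [huw]
    · simp [huw, h u hu]

end ArrayMachine

/-! ### Sorting the nodes -/

namespace ArrayMachine

open RAM

variable {q n m i : ℕ} {K W : ℤ} {R : ℕ → ℤ} {M : Mem} {P : ℕ → ℤ} {ex σ : ℕ → ℕ}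
  {good : ℕ → Prop}

/-- The value of the marking at address `a`, if `ex v` is the exponent of node `v`. -/
def rowValue (q n : ℕ) (P : ℕ → ℤ) (ex : ℕ → ℕ) (a : ℕ) : ℤ :=
  ∑ v ∈ Finset.range n, P (a + v) * (q : ℤ) ^ ex v

/-- Row `u` of the matrix `P` is the successor marking of node `u`, which evaluates to a natural
power of `q` if and only if `good u` holds, and in this case `ex u` is its exponent. -/
structure NodeSystem (q n : ℕ) (P : ℕ → ℤ) (good : ℕ → Prop) (ex : ℕ → ℕ) : Prop where
  digit : ∀ u < n, ∀ v < n, |P (n * u + v)| ≤ q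
  good_iff : ∀ u < n, (∀ v < n, P (n * u + v) ≠ 0 → good v) →
    (good u ↔ 0 ≤ rowValue q n P ex (n * u))
  ex_eq : ∀ u < n, (∀ v < n, P (n * u + v) ≠ 0 → good v) → good u →
    rowValue q n P ex (n * u) = ex u
  acyclic : ∀ D : Finset ℕ, (∃ u < n, u ∉ D) →
    ∃ u < n, u ∉ D ∧ ∀ v < n, P (n * u + v) ≠ 0 → v ∈ D

/-- The exponents of a list of nodes, preceded by `0`. -/
def exponents (ex σ : ℕ → ℕ) : ℕ → ℕ
  | 0 => 0
  | p + 1 => ex (σ p)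

/-- The list `σ` of `i` nodes is sorted and closed under successors. -/
structure SortedNodes (q n i : ℕ) (P : ℕ → ℤ) (good : ℕ → Prop) (ex : ℕ → ℕ) (M : Mem)
    (σ : ℕ → ℕ) : Prop where
  list : SortedList q n i M σ (exponents ex σ)
  lt : ∀ p < i, σ p < n
  inj : ∀ p < i, ∀ p' < i, σ p = σ p' → p = p'
  good : ∀ p < i, good (σ p)
  closed : ∀ p < i, ∀ v < n, P (n * σ p + v) ≠ 0 → ∃ p' < i, σ p' = v

/-- The marking at address `a` has small digits and is supported on the first `i` nodes of `σ`. -/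
def Supported (q n i : ℕ) (P : ℕ → ℤ) (σ : ℕ → ℕ) (a : ℕ) : Prop :=
  ∀ v < n, |P (a + v)| ≤ q ∧ (P (a + v) ≠ 0 → ∃ p < i, σ p = v)

theorem SortedNodes.supported (hN : NodeSystem q n P good ex)
    (hS : SortedNodes q n i P good ex M σ) {p : ℕ} (hp : p < i) :
    Supported q n i P σ (n * σ p) :=
  fun v hv => ⟨hN.digit _ (hS.lt p hp) v hv, hS.closed p hp v hv⟩

theorem SortedNodes.rowValue_eq (hN : NodeSystem q n P good ex)
    (hS : SortedNodes q n i P good ex M σ) {p : ℕ} (hp : p < i) :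
    rowValue q n P ex (n * σ p) = ex (σ p) := by
  refine hN.ex_eq _ (hS.lt p hp) (fun v hv h => ?_) (hS.good p hp)
  obtain ⟨p', hp', rfl⟩ := hS.closed p hp v hv h
  exact hS.good p' hp'

theorem SortedNodes.le (hS : SortedNodes q n i P good ex M σ) {p p' : ℕ} (h : p ≤ p')
    (hp' : p' < i) : ex (σ p) ≤ ex (σ p') := by
  induction p', h using Nat.le_induction with
  | base => exact le_rfl
  | succ p' _ ih => exact (ih (by omega)).trans (hS.list.mono (p' + 1) hp')

/-- Nodes outside of the list contribute nothing to a supported marking, and the list has no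
repetitions, so Horner's sum over positions is the whole value. -/
theorem SortedNodes.sum_eq (hS : SortedNodes q n i P good ex M σ) {a : ℕ}
    (ha : Supported q n i P σ a) :
    ∑ p ∈ Finset.range i, P (a + σ p) * (q : ℤ) ^ ex (σ p) = rowValue q n P ex a := by
  have hinj : Set.InjOn σ (Finset.range i) := fun p hp p' hp' h =>
    hS.inj p (Finset.mem_range.1 hp) p' (Finset.mem_range.1 hp') h
  rw [rowValue, ← Finset.sum_image (f := fun v => P (a + v) * (q : ℤ) ^ ex v) hinj]
  refine Finset.sum_subset (fun v hv => ?_) (fun v hv hv' => ?_)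
  · obtain ⟨p, hp, rfl⟩ := Finset.mem_image.1 hv
    exact Finset.mem_range.2 (hS.lt p (Finset.mem_range.1 hp))
  · by_contra h
    obtain ⟨p, hp, rfl⟩ := (ha v (Finset.mem_range.1 hv)).2 (left_ne_zero_of_mul h)
    exact hv' (Finset.mem_image_of_mem _ (Finset.mem_range.2 hp))

theorem difference_rows_spec (hroom : Room q n m K) (hR : Base q n m R) (hi : R 13 = i)
    (hin : i ≤ n) (hS : SortedNodes q n i M.pos good ex M σ) {a b : ℕ} (ha : R 20 = a)
    (hb : R 21 = b) (ha' : Supported q n i M.pos σ a) (hb' : Supported q n i M.pos σ b) :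
    ATri K W difference R M (70 * n + 10) (fun R' M' => M' = M ∧
      ClipRel (gapBound q n) (R' 22) (rowValue q n M.pos ex a - rowValue q n M.pos ex b) ∧
      ∀ x ∉ difference.writes, R' x = R x) := by
  refine (difference_spec hroom hR hi hin hS.list ha hb fun p hp => ?_).mono le_rfl
    fun R' M' h => ⟨h.1, ?_, h.2.2⟩
  · have h1 := (ha' _ (hS.lt p hp)).1
    have h2 := (hb' _ (hS.lt p hp)).1
    rw [abs_le] at *
    omega
  · rw [← hS.sum_eq ha', ← hS.sum_eq hb', ← Finset.sum_sub_distrib]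
    simpa only [sub_mul, exponents] using h.2.1

theorem mul_toNat (a b : ℕ) : (a : ℤ) * b = (a * b : ℕ) := by push_cast; rfl

/-- Only the sign of a difference is needed, and clipping preserves it. Each comparison halves the
interval, whence the factor log n + 1. -/
theorem search_spec (hroom : Room q n m K) (hR : Base q n m R) (hi : R 13 = i)
    (hin : i ≤ n) (hN : NodeSystem q n M.pos good ex) (hS : SortedNodes q n i M.pos good ex M σ)
    {w : ℕ} (hw : R 14 = w) (hwn : w < n) (hsupp : Supported q n i M.pos σ (n * w))
    (hval : rowValue q n M.pos ex (n * w) = ex w) :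
    ATri K W search R M ((Nat.log 2 n + 1) * (70 * n + 80) + 20) (fun R' M' => M' = M ∧
      ∃ lo ≤ i, R' 25 = (lo : ℕ) ∧ (∀ p < lo, ex (σ p) ≤ ex w) ∧
      ∀ p < i, lo ≤ p → ex w ≤ ex (σ p)) := by
  have hbasic := hroom.basic
  have haddr := hroom.address_le
  have hrow : ∀ u < n, (n * u : ℕ) ≤ K := by
    intro u hu
    have : n * u ≤ offset n m := by unfold offset; nlinarith
    have h0 : (0 : ℤ) ≤ stride n * (2 * n + m + 4) := by positivity
    have : ((n * u : ℕ) : ℤ) ≤ offset n m := by exact_mod_cast this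
    omega
  refine ATri.wp_seq (T₂ := (Nat.log 2 n + 1) * (70 * n + 80) + 10) ?_
    (by simp [AProg.time, AExpr.cost]; omega)
  simp only [AProg.wp, AExpr.Safe, AExpr.eval, true_and, Function.update_apply, Nat.reduceEqDiff,
    if_false, hi]
  refine ⟨by omega, by omega, ?_⟩
  -- The interval from `lo` to `hi` brackets the insertion position and has length below 2 ^ k. The
  -- initial variant log n + 1 is large enough because i ≤ n < 2 ^ (log n + 1).
  refine ATri.loop (T₁ := 70 * n + 70) (fun k R' M' => M' = M ∧ (∀ x < 25, x ∉ difference.writes →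
      x ≠ 20 → x ≠ 21 → R' x = R x) ∧ ∃ lo hi : ℕ, lo ≤ hi ∧ hi ≤ i ∧ R' 25 = lo ∧ R' 26 = hi ∧
      hi < lo + 2 ^ k ∧ (∀ p < lo, ex (σ p) ≤ ex w) ∧ ∀ p < i, hi ≤ p → ex w ≤ ex (σ p))
    ?_ (Nat.log 2 n + 1) ⟨rfl, ?_, 0, i, by omega, le_rfl, by simp, by simp, ?_, by simp, ?_⟩ ?_
  · rintro k R₁ M₁ ⟨rfl, hfr, lo, hi', hlh, hhi, h25, h26, hk, hlo, hhi'⟩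
    refine ⟨⟨trivial, trivial⟩, fun he => ?_, fun he => ?_⟩
    · simp only [AExpr.eval, Op.apply, h25, h26, ite_eq_right_iff, one_ne_zero, imp_false,
        not_lt] at he
      have : lo = hi' := by omega
      subst this
      exact ⟨rfl, lo, hhi, h25, hlo, hhi'⟩
    · simp only [AExpr.eval, Op.apply, h25, h26, ne_eq, ite_eq_right_iff, one_ne_zero, imp_false,
        not_lt, not_le] at he
      have hlt : lo < hi' := by exact_mod_cast he
      obtain ⟨k, rfl⟩ : ∃ k', k = k' + 1 := ⟨k - 1, by
        cases k with
        | zero => simp at hk; omega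
        | succ k => simp⟩
      refine ⟨k, Nat.lt_succ_self k, ?_⟩
      have hmid : ((lo : ℤ) + hi') / 2 = ((lo + hi') / 2 : ℕ) := by push_cast; rfl
      obtain ⟨mid, hmidd⟩ : ∃ mid, mid = (lo + hi') / 2 := ⟨_, rfl⟩
      rw [← hmidd] at hmid
      have hml : lo ≤ mid := by omega
      have hmh : mid < hi' := by omega
      have hmi : mid < i := by omega
      have h14 : R₁ 14 = w := (hfr 14 (by decide) (by decide) (by decide) (by decide)).trans hw
      have h13 : R₁ 13 = i := (hfr 13 (by decide) (by decide) (by decide) (by decide)).trans hi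
      have hbase : Base q n m R₁ := hR.frame fun x hx => hfr x (by omega) (by
        simp [difference, differenceBody, forUp, AProg.writes]; omega) (by omega) (by omega)
      have hr0 := hbase.r0
      refine ATri.wp_seq (T₂ := 70 * n + 40) ?_ (by
        simp [AProg.time, AExpr.div_def, AExpr.cost]; omega)
      simp only [AProg.wp, AExpr.div_def, AExpr.Safe, AExpr.eval, Op.apply, true_and, and_true,
        Function.update_apply, Nat.reduceEqDiff, if_true, if_false, hmid, h25, h26, h14, hr0,
        Int.toNat_natCast, hS.list.list mid hmi, mul_toNat]
      have hr1 := hrow w hwn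
      have hr2 := hrow _ (hS.lt mid hmi)
      refine ⟨by omega, by omega, by omega, by omega, ?_⟩
      refine ATri.seq (T₁ := 70 * n + 10) (T₂ := 20)
        (difference_rows_spec (a := n * w) (b := n * σ mid) hroom (hbase.frame fun x hx => ?_)
        (by simp [h13]) hin hS (by simp) (by simp) hsupp (hS.supported hN hmi)) ?_ (by omega)
      · simp only [Function.update_apply]
        rw [if_neg (by omega), if_neg (by omega), if_neg (by omega)]
      · rintro R₂ M₂ ⟨rfl, hclip, hfr₂⟩
        rw [hval, hS.rowValue_eq hN hmi] at hclip
        have hlt0 := hclip.lt_zero_iff (by omega)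
        have h27 : R₂ 27 = mid := by rw [hfr₂ 27 (by decide)]; simp
        have h25' : R₂ 25 = lo := by rw [hfr₂ 25 (by decide)]; simp [h25]
        have h26' : R₂ 26 = hi' := by rw [hfr₂ 26 (by decide)]; simp [h26]
        have hfr' : ∀ x < 25, x ∉ difference.writes → x ≠ 20 → x ≠ 21 → R₂ x = R x := by
          intro x hx hx' hx20 hx21
          rw [hfr₂ x hx', Function.update_of_ne hx21, Function.update_of_ne hx20,
            Function.update_of_ne (by omega), hfr x hx hx' hx20 hx21]
        refine ATri.wp ?_ (by decide)
        simp only [AProg.wp, AExpr.Safe, AExpr.eval, Op.apply, true_and, and_true,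
          Function.update_apply, Nat.reduceEqDiff, if_true, if_false, h27, h25', h26']
        refine ⟨fun h => ⟨by omega, fun x hx h₁ h₂ h₃ => ?_, lo, mid, hml, hmi.le, rfl, rfl, ?_,
          hlo, fun p hp hp' => ?_⟩, fun h => ⟨by omega, fun x hx h₁ h₂ h₃ => ?_, mid + 1, hi', hmh,
          hhi, by push_cast; rfl, rfl, ?_, fun p hp => ?_, hhi'⟩⟩
        · rw [if_neg (by omega), hfr' x hx h₁ h₂ h₃]
        · rw [pow_succ] at hk; omega
        · have := hS.le hp' hp
          have := hlt0.1 (by by_contra h'; exact h (if_neg h'))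
          omega
        · rw [if_neg (by omega), hfr' x hx h₁ h₂ h₃]
        · rw [pow_succ] at hk; omega
        · have := hS.le (Nat.lt_succ_iff.1 hp) hmi
          have := mt hlt0.2 (fun h' => one_ne_zero ((if_pos h').symm.trans h))
          omega
  · intro x hx _ _ _
    simp only [Function.update_apply]
    rw [if_neg (by omega), if_neg (by omega)]
  · have := Nat.lt_pow_succ_log_self (b := 2) (by norm_num) n
    simp only [Nat.succ_eq_add_one] at this
    omega
  · intro p hp hp'; omega
  · simp [AExpr.cost]; nlinarith

end ArrayMachine

/-! ### Insertion into the sorted list -/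

namespace ArrayMachine

open RAM

variable {q n m i : ℕ} {K W : ℤ} {R : ℕ → ℤ} {M : Mem} {P : ℕ → ℤ} {ex σ : ℕ → ℕ}
  {good : ℕ → Prop}

theorem Room.row_le (h : Room q n m K) {u : ℕ} (hu : u < n) : (n * u : ℕ) ≤ K := by
  have haddr := h.address_le
  have : n * u ≤ offset n m := by unfold offset; nlinarith
  have h0 : (0 : ℤ) ≤ stride n * (2 * n + m + 4) := by positivity
  have : ((n * u : ℕ) : ℤ) ≤ offset n m := by exact_mod_cast this
  omega

theorem Room.offset_le (h : Room q n m K) : (offset n m : ℤ) ≤ K := by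
  have haddr := h.address_le
  have h0 : (0 : ℤ) ≤ stride n * (2 * n + m + 4) := by positivity
  omega

theorem rowValue_zero {a : ℕ} (h : ∀ v < n, P (a + v) = 0) : rowValue q n P ex a = 0 :=
  Finset.sum_eq_zero fun v hv => by rw [h v (Finset.mem_range.1 hv), zero_mul]

theorem supported_zero {a : ℕ} (h : ∀ v < n, P (a + v) = 0) : Supported q n i P σ a :=
  fun v hv => ⟨by rw [h v hv]; simp, fun h' => absurd (h v hv) h'⟩

/-- For position 0 the predecessor is the virtual exponent 0. Its marking is the zero row behind the
input, so both cases are one call of `difference`. -/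
theorem lowerGap_spec (hroom : Room q n m K) (hR : Base q n m R) (hi : R 13 = i)
    (hin : i ≤ n) (hN : NodeSystem q n M.pos good ex) (hS : SortedNodes q n i M.pos good ex M σ)
    (hz : ∀ v < n, M.pos (offset n m + v) = 0)
    {w : ℕ} (hw : R 14 = w) (hwn : w < n) (hsupp : Supported q n i M.pos σ (n * w))
    (hval : rowValue q n M.pos ex (n * w) = ex w) {lo : ℕ} (hlo : R 25 = lo) (hlo' : lo ≤ i)
    (hle : exponents ex σ lo ≤ ex w) :
    ATri K W lowerGap R M (70 * n + 60) (fun R' M' => M' = M ∧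
      R' 28 = (min (gapBound q n) (ex w - exponents ex σ lo) : ℕ)) := by
  have hbasic := hroom.basic
  have hr := hroom.row_le hwn
  have ho := hroom.offset_le
  have hr0 := hR.r0
  have hr9 := hR.r9
  have key : ∀ b : ℕ, Supported q n i M.pos σ b →
      rowValue q n M.pos ex b = exponents ex σ lo →
      ATri K W (difference ;; .cond (.lt (r 11) (r 22)) (28 ::= r 11) (28 ::= r 22))
        (Function.update (Function.update R 20 (n * w : ℕ)) 21 (b : ℕ)) M (70 * n + 20)
        (fun R' M' => M' = M ∧ R' 28 = (min (gapBound q n) (ex w - exponents ex σ lo) : ℕ)) := by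
    intro b hb hbv
    refine ATri.seq (T₁ := 70 * n + 10) (T₂ := 10) (difference_rows_spec (a := n * w) (b := b) hroom
      (hR.frame fun x hx => ?_) (by simp [hi]) hin hS (by simp) (by simp) hsupp hb) ?_ (by omega)
    · rw [Function.update_of_ne (by omega), Function.update_of_ne (by omega)]
    · rintro R' M' ⟨rfl, hclip, hfr⟩
      have h11 : R' 11 = gapBound q n := by rw [hfr 11 (by decide)]; simp [hR.r11]
      rw [hval, hbv] at hclip
      have hmin := hclip.min_eq (by omega) (by omega)
      -- `difference` clips at an unspecified bound that is at least `gapBound`; clipping once more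
      -- at `gapBound` makes the stored gap canonical.
      have hg : ((min (gapBound q n) (ex w - exponents ex σ lo) : ℕ) : ℤ) =
          min (gapBound q n : ℤ) (R' 22) := by
        rw [hmin]; push_cast [Nat.cast_sub hle]; rfl
      have h22 : 0 ≤ R' 22 := by
        have := mt (hclip.lt_zero_iff (by omega)).1
        omega
      refine ATri.wp ?_ (by decide)
      simp only [AProg.wp, AExpr.Safe, AExpr.eval, Op.apply, true_and, and_true,
        Function.update_apply, if_true, h11, hg, ne_eq, ite_eq_right_iff, one_ne_zero, imp_false,
        not_lt, not_le]
      exact ⟨fun h => ⟨by omega, by omega⟩, fun h => ⟨by omega, by omega⟩⟩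
  refine ATri.wp_seq (T₂ := 70 * n + 20) ?_
    (by simp [AProg.time, AExpr.sub_def, AExpr.cost]; omega)
  simp only [AProg.wp, AExpr.sub_def, AExpr.Safe, AExpr.eval, Op.apply, true_and, and_true,
    Function.update_apply, Nat.reduceEqDiff, if_false, hlo, hw, hr0, hr9,
    mul_toNat, ne_eq, ite_eq_right_iff, one_ne_zero, imp_false, not_lt, not_le]
  refine ⟨by omega, fun h => ⟨by omega, ?_⟩, fun h => ⟨by omega, ?_⟩⟩
  · obtain ⟨p, rfl⟩ : ∃ p, lo = p + 1 := ⟨lo - 1, by omega⟩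
    have hpi : p < i := by omega
    have hr' := hroom.row_le (hS.lt p hpi)
    have : ((p + 1 : ℕ) : ℤ) - 1 = (p : ℕ) := by push_cast; ring
    rw [this, Int.toNat_natCast, hS.list.list p hpi, mul_toNat]
    exact ⟨by omega, key _ (hS.supported hN hpi) (hS.rowValue_eq hN hpi)⟩
  · have : lo = 0 := by omega
    subst this
    exact key _ (supported_zero hz) (rowValue_zero hz)

/-- When the new node goes to the end of the list there is no upper neighbour. The value computed
then is stored behind the list and never specified, so nothing is claimed about it. -/
theorem upperGap_spec (hroom : Room q n m K) (hR : Base q n m R) (hi : R 13 = i)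
    (hin : i ≤ n) (hN : NodeSystem q n M.pos good ex) (hS : SortedNodes q n i M.pos good ex M σ)
    {w : ℕ} (hw : R 14 = w) (hwn : w < n) (hsupp : Supported q n i M.pos σ (n * w))
    (hval : rowValue q n M.pos ex (n * w) = ex w) {lo : ℕ} (hlo : R 25 = lo) (hlo' : lo ≤ i)
    (hle : lo < i → ex w ≤ ex (σ lo)) :
    ATri K W upperGap R M (70 * n + 60) (fun R' M' => M' = M ∧
      (lo < i → R' 29 = (min (gapBound q n) (ex (σ lo) - ex w) : ℕ))) := by
  have hbasic := hroom.basic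
  have hr := hroom.row_le hwn
  have hr0 := hR.r0
  refine ATri.seq (T₁ := 70 * n + 40) (T₂ := 10) (Q' := fun R' M' => M' = M ∧ R' 11 = gapBound q n ∧
    (lo < i → ClipRel (gapBound q n) (R' 22) (ex (σ lo) - ex w))) ?_ ?_ (by omega)
  · refine ATri.cond (T₁ := 70 * n + 30) ⟨trivial, trivial⟩ (fun h => ?_) (fun h => ?_)
      (by simp [AExpr.cost]; omega)
    · have hlt : lo < i := by
        by_contra h'
        simp [AExpr.eval, Op.apply, hlo, hi] at h
        omega
      have hr' := hroom.row_le (hS.lt lo hlt)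
      refine ATri.wp_seq (T₂ := 70 * n + 10) ?_
        (by simp [AProg.time, AExpr.cost]; omega)
      simp only [AProg.wp, AExpr.Safe, AExpr.eval, Op.apply, true_and, and_true,
        Function.update_apply, Nat.reduceEqDiff, if_false, hlo, hw, hr0,
        Int.toNat_natCast, hS.list.list lo hlt, mul_toNat]
      refine ⟨by omega, by omega, by omega, ?_⟩
      refine (difference_rows_spec (a := n * σ lo) (b := n * w) hroom (hR.frame fun x hx => ?_)
        (by simp [hi]) hin hS (by simp) (by simp) (hS.supported hN hlt) hsupp).mono le_rfl ?_
      · rw [Function.update_of_ne (by omega), Function.update_of_ne (by omega)]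
      · rintro R' M' ⟨rfl, hclip, hfr⟩
        rw [hval, hS.rowValue_eq hN hlt] at hclip
        exact ⟨rfl, by rw [hfr 11 (by decide)]; simp [hR.r11], fun _ => hclip⟩
    · have hlt : ¬ lo < i := by
        intro h'
        simp [AExpr.eval, Op.apply, hlo, hi] at h
        omega
      refine ATri.wp ?_ (by simp [AProg.time, AExpr.cost])
      simp only [AProg.wp, AExpr.Safe, AExpr.eval, true_and, Function.update_apply,
        Nat.reduceEqDiff,
        if_false]
      exact ⟨by omega, hR.r11, fun h => absurd h hlt⟩
  · rintro R' M' ⟨rfl, h11, hclip⟩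
    refine ATri.of_bdd fun hB => ?_
    have h22 := abs_le.1 (hB.reg 22)
    refine ATri.wp ?_ (by decide)
    have hres : ∀ x : ℤ, x = min (gapBound q n : ℤ) (R' 22) → lo < i →
        x = (min (gapBound q n) (ex (σ lo) - ex w) : ℕ) := by
      intro x hx h
      have hle' := hle h
      have hmin := (hclip h).min_eq (by omega) (by omega)
      rw [hx, hmin]
      push_cast [Nat.cast_sub hle']; rfl
    simp only [AProg.wp, AExpr.Safe, AExpr.eval, Op.apply, true_and, and_true,
      Function.update_apply, if_true, h11, ne_eq, ite_eq_right_iff, one_ne_zero, imp_false,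
      not_lt, not_le]
    exact ⟨fun h => ⟨by omega, hres _ (by omega)⟩, fun h => ⟨by omega, hres _ (by omega)⟩⟩

/-- Entries are moved from the top downwards, so that the source of each copy still has its old
content. -/
theorem shift_spec (hroom : Room q n m K) (hi : R 13 = i) (hin : i ≤ n) {lo : ℕ} (hlo : R 25 = lo)
    (hlo' : lo ≤ i) :
    ATri K W shift R M (60 * n + 20) (fun _ M' => M.AgreeOff [3, 4] M' ∧
      ∀ k : Fin 16, k = 3 ∨ k = 4 → ∀ p ≤ i, M'.arr k p = if lo < p then M.arr k (p - 1)
        else M.arr k p) := by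
  have hbasic := hroom.basic
  refine ATri.wp_seq (T₂ := 60 * n + 10) ?_
    (by simp [AProg.time, AExpr.sub_def, AExpr.cost]; omega)
  have hsub : (i : ℤ) - lo = (i - lo : ℕ) := by omega
  simp only [AProg.wp, AExpr.sub_def, AExpr.Safe, AExpr.eval, Op.apply, true_and, hi, hlo, hsub]
  refine ⟨by omega, by omega, ?_⟩
  refine ATri.forUp (a := 0) (b := i - lo) (T₁ := 40) (by decide) (by decide) (by decide) (by simp)
    (by simp) (by omega) (fun k _ M' => M.AgreeOff [3, 4] M' ∧ ∀ j : Fin 16, j = 3 ∨ j = 4 →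
      ∀ p ≤ i, M'.arr j p = if i < p + k then M.arr j (p - 1) else M.arr j p) ?_ ?_
    (by omega) ?_
  · refine ⟨.refl _ _, fun j _ p hp => ?_⟩
    rw [if_neg (by omega)]
  · rintro k R' M' _ hk h30 _ hfr ⟨hM, h⟩
    refine ATri.of_bdd fun hB => ?_
    have h13 : R' 13 = i := by rw [hfr 13 (by decide) (by decide)]; simp [hi]
    obtain ⟨p, rfl⟩ : ∃ p, i = p + 1 + k := ⟨i - k - 1, by omega⟩
    have hidx : ((p + 1 + k : ℕ) : ℤ) - k = (p + 1 : ℕ) := by push_cast; ring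
    have hidx' : ((p + 1 : ℕ) : ℤ) - 1 = (p : ℕ) := by push_cast; ring
    have h3 := abs_le.1 (hB.arr 3 p)
    have h4 := abs_le.1 (hB.arr 4 p)
    refine ATri.wp ?_ (by decide)
    simp only [AProg.wp, AExpr.Safe, AExpr.eval, Op.apply, true_and, and_true,
      Function.update_apply, if_true, h13, h30, hidx, hidx',
      Int.toNat_natCast, Mem.setArr_arr]
    rw [if_neg (by decide : ¬ (4 : Fin 16) = 3)]
    refine ⟨by omega, by omega, by omega, h3, by omega, by omega, h4,
      (hM.setArr (by simp) _ _).setArr (by simp) _ _, ?_⟩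
    rintro j hj x hx
    have hval : ∀ j : Fin 16, j = 3 ∨ j = 4 → (if x = p + 1 then M'.arr j p else M'.arr j x) =
        if p + 1 + k < x + (k + 1) then M.arr j (x - 1) else M.arr j x := by
      intro j hj
      by_cases hxp : x = p + 1
      · subst hxp
        rw [if_pos rfl, if_pos (by omega), h j hj p (by omega), if_neg (by omega)]; simp
      · rw [if_neg hxp, h j hj x hx]
        by_cases hc : p + 1 + k < x + k
        · rw [if_pos hc, if_pos (by omega)]
        · rw [if_neg hc, if_neg (by omega)]
    rcases hj with rfl | rfl
    · rw [if_neg (by decide), if_pos rfl]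
      simpa only [Function.update_apply] using hval 3 (.inl rfl)
    · rw [if_pos rfl]
      simpa only [Function.update_apply] using hval 4 (.inr rfl)
  · rintro R' M' ⟨h₁, h₂⟩ _ _
    refine ⟨h₁, fun j hj p hp => ?_⟩
    rw [h₂ j hj p hp]
    simp only [show i < p + (i - lo) ↔ lo < p by omega]

/-- The list `σ` with `w` inserted at position `lo`. -/
def insertAt (σ : ℕ → ℕ) (lo w : ℕ) (p : ℕ) : ℕ :=
  if p < lo then σ p else if p = lo then w else σ (p - 1)

theorem insertAt_image (σ : ℕ → ℕ) {lo w i v : ℕ} (hlo : lo ≤ i) :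
    (∃ p < i + 1, insertAt σ lo w p = v) ↔ v = w ∨ ∃ p < i, σ p = v := by
  constructor
  · rintro ⟨p, hp, rfl⟩
    unfold insertAt
    split_ifs with h₁ h₂
    · exact .inr ⟨p, by omega, rfl⟩
    · exact .inl rfl
    · exact .inr ⟨p - 1, by omega, rfl⟩
  · rintro (rfl | ⟨p, hp, rfl⟩)
    · exact ⟨lo, by omega, by simp [insertAt]⟩
    · by_cases h : p < lo
      · exact ⟨p, by omega, by simp [insertAt, h]⟩
      · refine ⟨p + 1, by omega, ?_⟩
        unfold insertAt
        rw [if_neg (by omega), if_neg (by omega)]; simp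

theorem exponents_insertAt_of_le (ex σ : ℕ → ℕ) {lo w p : ℕ} (h : p ≤ lo) :
    exponents ex (insertAt σ lo w) p = exponents ex σ p := by
  cases p with
  | zero => rfl
  | succ p => simp only [exponents, insertAt, if_pos (show p < lo by omega)]

theorem exponents_insertAt_self (ex σ : ℕ → ℕ) (lo w : ℕ) :
    exponents ex (insertAt σ lo w) (lo + 1) = ex w := by
  simp [exponents, insertAt]

theorem exponents_insertAt_of_lt (ex σ : ℕ → ℕ) {lo w p : ℕ} (h : lo < p) :
    exponents ex (insertAt σ lo w) (p + 1) = exponents ex σ p := by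
  obtain ⟨p, rfl⟩ : ∃ p', p = p' + 1 := ⟨p - 1, by omega⟩
  simp only [exponents, insertAt, if_neg (show ¬ p + 1 < lo by omega),
    if_neg (show p + 1 ≠ lo by omega), Nat.add_sub_cancel]

/-- Only the two gaps adjacent to the new node change; all others are shifted with their nodes.
Closure under successors survives because the successors of the new node are already listed. -/
theorem SortedNodes.insert {M' : Mem} (hS : SortedNodes q n i P good ex M σ) {w lo : ℕ}
    (hwn : w < n)
    (hgood : good w) (hnot : ∀ p < i, σ p ≠ w)
    (hsupp : ∀ v < n, P (n * w + v) ≠ 0 → ∃ p < i, σ p = v) (hlo : lo ≤ i)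
    (hle : ∀ p < lo, ex (σ p) ≤ ex w) (hge : ∀ p < i, lo ≤ p → ex w ≤ ex (σ p))
    (hlist : ∀ p ≤ i, M'.arr 3 p = insertAt σ lo w p)
    (hgap : ∀ p ≤ i, M'.arr 4 p = if p < lo then M.arr 4 p else if p = lo then
      ((min (gapBound q n) (ex w - exponents ex σ lo) : ℕ) : ℤ) else if p = lo + 1 then
      ((min (gapBound q n) (ex (σ lo) - ex w) : ℕ) : ℤ) else M.arr 4 (p - 1))
    (hpow : M'.arr 2 = M.arr 2) : SortedNodes q n (i + 1) P good ex M' (insertAt σ lo w) := by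
  have hall : ∀ (C : ℕ → Prop), C w → (∀ p < i, C (σ p)) → ∀ p < i + 1, C (insertAt σ lo w p) := by
    intro C h₁ h₂ p hp
    rcases (insertAt_image σ hlo).1 ⟨p, hp, rfl⟩ with h | ⟨p', hp', h⟩
    · rwa [h]
    · rw [← h]; exact h₂ p' hp'
  refine ⟨⟨fun p hp => hlist p (by omega), rfl, fun p hp => ?_, fun p hp => ?_, ?_⟩, hall
    (· < n) hwn hS.lt,
    ?_, hall good hgood hS.good, ?_⟩
  · rcases lt_trichotomy p lo with h | rfl | h
    · rw [exponents_insertAt_of_le _ _ h.le, exponents_insertAt_of_le _ _ (Nat.succ_le_of_lt h)]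
      exact hS.list.mono p (by omega)
    · rw [exponents_insertAt_of_le _ _ le_rfl, exponents_insertAt_self]
      cases p with
      | zero => exact Nat.zero_le _
      | succ p => exact hle p (by omega)
    · rw [exponents_insertAt_of_lt _ _ h]
      obtain ⟨p, rfl⟩ : ∃ p', p = p' + 1 := ⟨p - 1, by omega⟩
      by_cases h' : p = lo
      · subst h'
        rw [exponents_insertAt_self]
        exact hge p (by omega) le_rfl
      · rw [exponents_insertAt_of_lt _ _ (by omega)]
        exact hS.list.mono p (by omega)
  · rw [hgap p (by omega)]
    rcases lt_trichotomy p lo with h | rfl | h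
    · rw [exponents_insertAt_of_le _ _ h.le, exponents_insertAt_of_le _ _ (Nat.succ_le_of_lt h),
        if_pos h]
      exact hS.list.gap p (by omega)
    · rw [exponents_insertAt_of_le _ _ le_rfl, exponents_insertAt_self, if_neg (lt_irrefl _),
        if_pos rfl]
    · rw [exponents_insertAt_of_lt _ _ h, if_neg h.not_gt, if_neg h.ne']
      obtain ⟨p, rfl⟩ : ∃ p', p = p' + 1 := ⟨p - 1, by omega⟩
      by_cases h' : p = lo
      · subst h'
        rw [exponents_insertAt_self, if_pos rfl]; rfl
      · rw [exponents_insertAt_of_lt _ _ (by omega), if_neg (by omega)]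
        exact hS.list.gap p (by omega)
  · rw [hpow]; exact hS.list.pow
  · intro p hp p' hp' h
    have hne := hnot
    have hinj := hS.inj
    unfold insertAt at h
    split_ifs at h with h₁ h₂ h₃ h₄ h₅ h₆
    · exact hinj p (by omega) p' (by omega) h
    · exact absurd h (hne p (by omega))
    · have := hinj p (by omega) (p' - 1) (by omega) h
      omega
    · exact absurd h.symm (hne p' (by omega))
    · omega
    · exact absurd h.symm (hne (p' - 1) (by omega))
    · have := hinj (p - 1) (by omega) p' (by omega) h
      omega
    · exact absurd h (hne (p - 1) (by omega))
    · have := hinj (p - 1) (by omega) (p' - 1) (by omega) h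
      omega
  · refine hall (fun u => ∀ v < n, P (n * u + v) ≠ 0 → ∃ p' < i + 1, insertAt σ lo w p' = v)
      (fun v hv h => ?_) (fun p hp v hv h => ?_)
    · exact (insertAt_image σ hlo).2 (.inr (hsupp v hv h))
    · exact (insertAt_image σ hlo).2 (.inr (hS.closed p hp v hv h))

end ArrayMachine

/-! ### The sorting loop -/

namespace ArrayMachine

open RAM

variable {q n m i : ℕ} {K W : ℤ} {R : ℕ → ℤ} {M : Mem} {P : ℕ → ℤ} {ex σ : ℕ → ℕ}
  {good : ℕ → Prop}

theorem SortedNodes.congr {M' : Mem} (hS : SortedNodes q n i P good ex M σ)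
    (h2 : M'.arr 2 = M.arr 2) (h3 : M'.arr 3 = M.arr 3) (h4 : M'.arr 4 = M.arr 4) :
    SortedNodes q n i P good ex M' σ :=
  ⟨⟨by rw [h3]; exact hS.list.list, rfl, hS.list.mono, by rw [h4]; exact hS.list.gap,
    by rw [h2]; exact hS.list.pow⟩, hS.lt, hS.inj, hS.good, hS.closed⟩

theorem insertNode_spec (hroom : Room q n m K) (hR : Base q n m R) (hi : R 13 = i)
    (hin : i < n) (hN : NodeSystem q n M.pos good ex) (hS : SortedNodes q n i M.pos good ex M σ)
    (hz : ∀ v < n, M.pos (offset n m + v) = 0)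
    {w : ℕ} (hw : R 14 = w) (hwn : w < n) (hgood : good w) (hnot : ∀ p < i, σ p ≠ w)
    (hsupp : Supported q n i M.pos σ (n * w))
    (hval : rowValue q n M.pos ex (n * w) = ex w) {lo : ℕ} (hlo : R 25 = lo) (hlo' : lo ≤ i)
    (hle : ∀ p < lo, ex (σ p) ≤ ex w) (hge : ∀ p < i, lo ≤ p → ex w ≤ ex (σ p)) :
    ATri K W insertNode R M (200 * n + 200) (fun _ M' => M.AgreeOff [3, 4] M' ∧
      SortedNodes q n (i + 1) M.pos good ex M' (insertAt σ lo w)) := by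
  have hbasic := hroom.basic
  have hle' : exponents ex σ lo ≤ ex w := by
    cases lo with
    | zero => exact Nat.zero_le _
    | succ p => exact hle p (by omega)
  refine ATri.seq (T₁ := 70 * n + 60) (T₂ := 130 * n + 140)
    (lowerGap_spec hroom hR hi hin.le hN hS hz hw hwn hsupp hval hlo hlo' hle').frame ?_ (by omega)
  rintro R₁ M₁ ⟨⟨rfl, h28⟩, hfr₁⟩
  have h13 : R₁ 13 = i := (hfr₁ 13 (by decide)).trans hi
  have h14 : R₁ 14 = w := (hfr₁ 14 (by decide)).trans hw
  have h25 : R₁ 25 = lo := (hfr₁ 25 (by decide)).trans hlo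
  have hbase : ∀ x < 12, x ∉ lowerGap.writes ∧ x ∉ upperGap.writes := by decide
  have hR₁ := hR.frame fun x hx => hfr₁ x (hbase x hx).1
  refine ATri.seq (T₁ := 70 * n + 60) (T₂ := 60 * n + 80)
    (upperGap_spec hroom hR₁ h13 hin.le hN hS h14 hwn hsupp hval h25 hlo'
      fun h => hge lo h le_rfl).frame ?_ (by omega)
  rintro R₂ M ⟨⟨rfl, h29⟩, hfr₂⟩
  replace h13 := (hfr₂ 13 (by decide)).trans h13
  replace h14 := (hfr₂ 14 (by decide)).trans h14
  replace h25 := (hfr₂ 25 (by decide)).trans h25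
  replace h28 := (hfr₂ 28 (by decide)).trans h28
  refine ATri.seq (T₁ := 60 * n + 20) (T₂ := 60) (shift_spec hroom h13 hin.le h25 hlo').frame ?_
    (by omega)
  rintro R₃ M' ⟨⟨hM, harr⟩, hfr₃⟩
  replace h13 := (hfr₃ 13 (by decide)).trans h13
  replace h14 := (hfr₃ 14 (by decide)).trans h14
  replace h25 := (hfr₃ 25 (by decide)).trans h25
  replace h28 := (hfr₃ 28 (by decide)).trans h28
  replace h29 := fun h => (hfr₃ 29 (by decide)).trans (h29 h)
  refine ATri.of_bdd fun hB => ?_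
  -- If `lo = i`, register 29 holds an unspecified value; for the store behind the list it only has
  -- to fit into a cell.
  have hb29 := abs_le.1 (hB.reg 29)
  have hcast : (lo : ℤ) + 1 = (lo + 1 : ℕ) := by push_cast; rfl
  refine ATri.wp ?_ (by decide)
  simp only [AProg.wp, AExpr.Safe, AExpr.eval, Op.apply, true_and, and_true, h25, h14, h28, hcast,
    Int.toNat_natCast]
  refine ⟨by omega, by omega, by omega, by omega, by omega, hb29,
    ((hM.setArr (by simp) _ _).setArr (by simp) _ _).setArr (by simp) _ _,
    hS.insert hwn hgood hnot (fun v hv => (hsupp v hv).2) hlo' hle hge ?_ ?_ ?_⟩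
  · intro p hp
    simp only [Mem.setArr_arr, if_neg (by decide : ¬ (3 : Fin 16) = 4), if_true,
      Function.update_apply, insertAt]
    rw [harr 3 (.inl rfl) p hp]
    rcases lt_trichotomy p lo with h | rfl | h
    · rw [if_neg h.ne, if_neg h.not_gt, if_pos h, hS.list.list p (by omega)]
    · rw [if_pos rfl, if_neg (lt_irrefl _), if_pos rfl]
    · rw [if_neg h.ne', if_pos h, if_neg h.not_gt, if_neg h.ne', hS.list.list (p - 1) (by omega)]
  · intro p hp
    simp only [Mem.setArr_arr, if_neg (by decide : ¬ (4 : Fin 16) = 3), if_true,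
      Function.update_apply]
    rw [harr 4 (.inr rfl) p hp]
    rcases lt_trichotomy p lo with h | rfl | h
    · rw [if_neg (by omega), if_neg h.ne, if_neg h.not_gt, if_pos h]
    · rw [if_neg (by omega), if_pos rfl, if_neg (lt_irrefl _), if_pos rfl]
    · rw [if_neg h.ne', if_pos h, if_neg h.not_gt, if_neg h.ne']
      split_ifs with h'
      · exact h29 (by omega)
      · rfl
  · simp only [Mem.setArr_arr, if_neg (by decide : ¬ (2 : Fin 16) = 3),
      if_neg (by decide : ¬ (2 : Fin 16) = 4)]
    exact hM.2 2 (by decide)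

/-- The state of the sorting loop. -/
structure SortState (q n i : ℕ) (P : ℕ → ℤ) (good : ℕ → Prop) (ex : ℕ → ℕ) (M : Mem)
    (σ : ℕ → ℕ) : Prop where
  nodes : SortedNodes q n i P good ex M σ
  count : ∀ u < n, M.arr 0 u = if u ∈ (Finset.range i).image σ then -1
    else (outDegree P n ((Finset.range i).image σ) u : ℤ)

/-- Acyclicity provides an unprocessed node all of whose successors are processed. Its marking value
is then an integer known up to clipping, and its sign alone decides between insertion and rejection.
-/
theorem processNode_spec (hroom : Room q n m K) (hR : Base q n m R) (hi : R 13 = i)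
    (hin : i < n) (hN : NodeSystem q n M.pos good ex) (hS : SortState q n i M.pos good ex M σ)
    (hz : ∀ v < n, M.pos (offset n m + v) = 0) :
    ATri K W processNode R M ((Nat.log 2 n + 1) * (70 * n + 80) + 400 * n + 400)
      (fun R' M' => M.AgreeOff [0, 3, 4] M' ∧
        ((R' 12 = R 12 ∧ ∃ σ', SortState q n (i + 1) M.pos good ex M' σ') ∨
          (R' 12 = 0 ∧ ∃ u < n, ¬ good u))) := by
  have hbasic := hroom.basic
  have hoff := hroom.offset_le
  obtain ⟨hS, hcount⟩ := hS
  set D := (Finset.range i).image σ with hD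
  have hmem : ∀ v, v ∈ D ↔ ∃ p < i, σ p = v := by simp [hD]
  have hclosed : ∀ u ∈ D, ∀ v < n, M.pos (n * u + v) ≠ 0 → v ∈ D := by
    intro u hu v hv h
    obtain ⟨p, hp, rfl⟩ := (hmem u).1 hu
    exact (hmem v).2 (hS.closed p hp v hv h)
  -- Fewer than n nodes have been processed.
  have hex : ∃ u < n, u ∉ D := by
    by_contra! hall
    have h1 : (Finset.range n).card ≤ D.card :=
      Finset.card_le_card fun u hu => hall u (Finset.mem_range.1 hu)
    have h2 : D.card ≤ i := Finset.card_image_le.trans (by simp)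
    simp at h1
    omega
  have hex' : ∃ u < n, M.arr 0 u = 0 := by
    obtain ⟨u, hu, huD, hsucc⟩ := hN.acyclic D hex
    refine ⟨u, hu, ?_⟩
    rw [hcount u hu, if_neg huD, outDegree, Finset.filter_false_of_mem]
    · simp
    · rintro v hv ⟨h₁, h₂⟩
      exact h₂ (hsucc v (Finset.mem_range.1 hv) h₁)
  refine ATri.seq (T₁ := 40 * n + 20) (T₂ := (Nat.log 2 n + 1) * (70 * n + 80) + 360 * n + 380)
    (select_spec hroom hR.r0 hex').frame ?_ (by omega)
  rintro R₁ M₁ ⟨⟨rfl, w, hwn, h14, hw0⟩, hfr₁⟩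
  have hwD : w ∉ D := fun h => by
    rw [hcount w hwn, if_pos h] at hw0; omega
  have hwsucc : ∀ v < n, M₁.pos (n * w + v) ≠ 0 → ∃ p < i, σ p = v := by
    intro v hv h
    rw [← hmem]
    by_contra hvD
    rw [hcount w hwn, if_neg hwD, outDegree, Nat.cast_eq_zero, Finset.card_eq_zero] at hw0
    have : v ∈ (∅ : Finset ℕ) := hw0 ▸ Finset.mem_filter.2 ⟨Finset.mem_range.2 hv, h, hvD⟩
    simp at this
  have hnot : ∀ p < i, σ p ≠ w := fun p hp h => hwD ((hmem w).2 ⟨p, hp, h⟩)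
  have hsupp : Supported q n i M₁.pos σ (n * w) := fun v hv =>
    ⟨hN.digit w hwn v hv, hwsucc v hv⟩
  have hgoodsucc : ∀ v < n, M₁.pos (n * w + v) ≠ 0 → good v := by
    intro v hv h
    obtain ⟨p, hp, rfl⟩ := hwsucc v hv h
    exact hS.good p hp
  have hr := hroom.row_le hwn
  have hbase : ∀ x < 14, x ∉ select.writes ∧ x ∉ updateDegrees.writes ∧ x ∉ difference.writes ∧
      x ∉ search.writes ∧ x ∉ insertNode.writes := by decide
  refine ATri.seq (T₁ := 60 * n + 30) (T₂ := (Nat.log 2 n + 1) * (70 * n + 80) + 300 * n + 350)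
    (updateDegrees_spec hroom ((hfr₁ 0 (by decide)).trans hR.r0) hwn h14 hwD hcount hclosed).frame
      ?_
    (by omega)
  rintro R₂ M ⟨⟨hM, hcount'⟩, hfr₂⟩
  replace h14 := (hfr₂ 14 (by decide)).trans h14
  have hfr : ∀ x < 14, R₂ x = R x := fun x hx =>
    (hfr₂ x (hbase x hx).2.1).trans (hfr₁ x (hbase x hx).1)
  have h0 := (hfr 0 (by omega)).trans hR.r0
  have h9 := (hfr 9 (by omega)).trans hR.r9
  have hpos : M.pos = M₁.pos := hM.1
  replace hS : SortedNodes q n i M.pos good ex M σ := by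
    rw [hpos]
    exact hS.congr (hM.2 2 (by decide)) (hM.2 3 (by decide)) (hM.2 4 (by decide))
  rw [← hpos] at hN hz hsupp hgoodsucc hcount' ⊢
  refine ATri.wp_seq (T₂ := (Nat.log 2 n + 1) * (70 * n + 80) + 300 * n + 330) ?_
    (by simp [AProg.time, AExpr.cost]; omega)
  simp only [AProg.wp, AExpr.Safe, AExpr.eval, Op.apply, true_and, Function.update_apply,
    Nat.reduceEqDiff, if_false, h0, h14, h9, mul_toNat]
  refine ⟨by omega, by omega, ?_⟩
  refine ATri.seq (T₁ := 70 * n + 10) (T₂ := (Nat.log 2 n + 1) * (70 * n + 80) + 230 * n + 320)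
    (difference_rows_spec (a := n * w) (b := offset n m) (σ := σ) (i := i) hroom
      (hR.frame fun x hx => ?_) ?_ hin.le hS (by simp) (by simp) hsupp
      (supported_zero hz)) ?_ (by omega)
  · rw [Function.update_of_ne (by omega), Function.update_of_ne (by omega), hfr x (by omega)]
  · rw [Function.update_of_ne (by omega), Function.update_of_ne (by omega), hfr 13 (by omega), hi]
  rintro R₃ M₃ ⟨rfl, hclip, hfr₃⟩
  -- The second marking was the zero row behind the input, so the difference is the exponent of `w`
  -- itself.
  rw [rowValue_zero hz, sub_zero] at hclip
  have hsign := hclip.lt_zero_iff (by omega)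
  have hgood := hN.good_iff w hwn hgoodsucc
  replace h14 : R₃ 14 = w := by
    rw [hfr₃ 14 (by decide), Function.update_of_ne (by omega), Function.update_of_ne (by omega),
      h14]
  have hfr' : ∀ x < 14, R₃ x = R x := fun x hx => by
    rw [hfr₃ x (hbase x hx).2.2.1, Function.update_of_ne (by omega),
      Function.update_of_ne (by omega), hfr x hx]
  have hR₃ := hR.frame fun x hx => hfr' x (by omega)
  refine ATri.cond (T₁ := (Nat.log 2 n + 1) * (70 * n + 80) + 230 * n + 310) ⟨trivial, trivial⟩
    (fun h => ?_) (fun h => ?_) (by simp [AExpr.cost]; omega)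
  · have hlt : R₃ 22 < 0 := by
      by_contra h'; exact h (if_neg h')
    refine ATri.wp ?_ (by simp [AProg.time, AExpr.cost])
    simp only [AProg.wp, AExpr.Safe, AExpr.eval, true_and, Function.update_apply, if_true]
    exact ⟨by omega, ⟨hM.mono (by simp), .inr ⟨w, hwn, fun hg =>
      absurd (hgood.1 hg) (not_le.2 (hsign.1 hlt))⟩⟩⟩
  · have hge : ¬ R₃ 22 < 0 := fun h' => one_ne_zero ((if_pos h').symm.trans h)
    have hgw : good w := hgood.2 (not_lt.1 (mt hsign.2 hge))
    have hval := hN.ex_eq w hwn hgoodsucc hgw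
    refine ATri.seq (T₁ := (Nat.log 2 n + 1) * (70 * n + 80) + 20) (T₂ := 200 * n + 200)
      (search_spec hroom hR₃ ((hfr' 13 (by omega)).trans hi) hin.le hN hS h14 hwn hsupp hval).frame
      ?_ (by omega)
    rintro R₄ M₄ ⟨⟨rfl, lo, hlo, h25, hle, hge'⟩, hfr₄⟩
    replace h14 := (hfr₄ 14 (by decide)).trans h14
    have hfr'' : ∀ x < 14, R₄ x = R x := fun x hx =>
      (hfr₄ x (hbase x hx).2.2.2.1).trans (hfr' x hx)
    refine (insertNode_spec hroom (hR.frame fun x hx => hfr'' x (by omega))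
      ((hfr'' 13 (by omega)).trans hi) hin hN hS hz h14 hwn hgw hnot hsupp hval h25 hlo hle
      hge').frame.mono le_rfl ?_
    rintro R₅ M₅ ⟨⟨hM₅, hS₅⟩, hfr₅⟩
    refine ⟨(hM.mono (by simp)).trans (hM₅.mono (by simp)), .inl ⟨?_, insertAt σ lo w, hS₅, ?_⟩⟩
    · rw [hfr₅ 12 (by decide), hfr'' 12 (by omega)]
    · have : (Finset.range (i + 1)).image (insertAt σ lo w) = insert w D := by
        ext v
        have := insertAt_image σ (w := w) (v := v) hlo
        simpa [hmem] using this
      rw [this, hM₅.2 0 (by decide)]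
      exact hcount'

/-- After a rejection register 12 is 0 and the remaining rounds do nothing. This keeps a plain
counting loop. -/
theorem sortNodes_spec (hroom : Room q n m K) (hR : Base q n m R)
    (hN : NodeSystem q n M.pos good ex) (hz : ∀ v < n, M.pos (offset n m + v) = 0)
    (hdeg : ∀ u < n, M.arr 0 u = outDegree M.pos n ∅ u)
    (hpow : ∀ j ≤ gapBound q n, M.arr 2 j = (min (valueBound q n) (q ^ j) : ℕ)) :
    ATri K W sortNodes R M (n * ((Nat.log 2 n + 1) * (70 * n + 80) + 400 * n + 420) + 20)
      (fun R' M' => M.AgreeOff [0, 3, 4] M' ∧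
        ((R' 12 = 1 ∧ ∃ σ, SortedNodes q n n M.pos good ex M' σ) ∨
          (R' 12 = 0 ∧ ∃ u < n, ¬ good u))) := by
  have hbasic := hroom.basic
  refine ATri.wp_seq (T₂ := n * ((Nat.log 2 n + 1) * (70 * n + 80) + 400 * n + 420) + 10) ?_
    (by simp [AProg.time, AExpr.cost]; omega)
  simp only [AProg.wp, AExpr.Safe, AExpr.eval, true_and]
  refine ⟨by omega, by omega, ?_⟩
  have hbase : ∀ x < 12, x ∉ (AProg.cond (r 12) processNode .skip).writes ∧ x ≠ 13 := by decide
  refine ATri.forUp (a := 0) (b := n) (T₁ := (Nat.log 2 n + 1) * (70 * n + 80) + 400 * n + 410)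
    (by decide) (by decide) (by decide) (by simp) (by simp [hR.r0]) (by omega)
    (fun i R' M' => M.AgreeOff [0, 3, 4] M' ∧ ((R' 12 = 1 ∧ ∃ σ,
      SortState q n i M.pos good ex M' σ) ∨
          (R' 12 = 0 ∧ ∃ u < n, ¬ good u))) ?_ ?_ (by rw [Nat.sub_zero]; nlinarith) ?_
  · refine ⟨.refl _ _, .inl ⟨by simp, id, ⟨⟨by simp, rfl, by simp, by simp, hpow⟩, by simp, by simp,
      by simp, by simp⟩, fun u hu => ?_⟩⟩
    simpa using hdeg u hu
  · rintro i R' M' _ hin h13 _ hfr ⟨hM, h⟩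
    have hR' := hR.frame (R' := R') fun x hx => by
      rw [hfr x (hbase x hx).1 (hbase x hx).2, Function.update_of_ne (by omega),
        Function.update_of_ne (by omega)]
    have hpos : M'.pos = M.pos := hM.1
    refine ATri.cond (T₁ := (Nat.log 2 n + 1) * (70 * n + 80) + 400 * n + 400) trivial
      (fun h1 => ?_) (fun h1 => ?_) (by simp [AExpr.cost]; omega)
    · have h1' : R' 12 ≠ 0 := h1
      obtain ⟨h12, σ, hS⟩ | ⟨h12, _⟩ := h
      · rw [← hpos] at hS hN hz
        refine (processNode_spec hroom hR' h13 hin hN hS hz).mono le_rfl ?_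
        rintro R'' M'' ⟨hM'', h⟩
        rw [hpos, h12] at h
        exact ⟨hM.trans hM'', by simpa using h⟩
      · exact absurd h12 h1'
    · have h1' : R' 12 = 0 := h1
      obtain ⟨h12, _⟩ | h := h
      · rw [h12] at h1'; exact absurd h1' one_ne_zero
      · refine ATri.wp ?_ (by simp [AProg.time])
        exact ⟨hM, .inr (by simpa using h)⟩
  · rintro R' M' ⟨hM, h⟩ _ _
    refine ⟨hM, h.imp (fun ⟨h₁, σ, h₂⟩ => ⟨h₁, σ, h₂.nodes⟩) id⟩

end ArrayMachine

/-! ### The nodes of the reduced circuit -/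

namespace ArrayMachine

open RAM

variable {q n m i : ℕ} {K W : ℤ} {R : ℕ → ℤ} {M : Mem} {P : ℕ → ℤ} {ex σ : ℕ → ℕ}
  {good : ℕ → Prop}

/-- The exponents `E 0 < … < E c` of new nodes, among them those of the first `p` old nodes in the
list `σ`, which are mapped to new nodes by `ι`. The number `Acc t` bounds the absolute value of the
coefficient of node `t` including carries. Node `c` has distance `j` to the last old node. -/
structure Plan (q n : ℕ) (ex σ : ℕ → ℕ) (p j c : ℕ) (E ι Acc : ℕ → ℕ) : Prop where
  one_le : 1 ≤ p
  le : p ≤ n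
  count : c + 1 + Acc c / q ≤ n + p
  acc_le : Acc c ≤ n + (q - 1) * p
  dist_le : j + Acc c / q ≤ n
  zero : E 0 = 0
  mono : ∀ t < c, E t < E (t + 1)
  last : E c = ex (σ (p - 1)) + j
  next : p < n → E c ≤ ex (σ p)
  index : ∀ p' < p, ι p' ≤ c ∧ E (ι p') = ex (σ p')
  capacity : ∀ t ≤ c, (q - 1) * ((Finset.range p).filter fun p' => ι p' = t).card +
    (if t = 0 then n else if E t = E (t - 1) + 1 then Acc (t - 1) / q else 0) ≤ Acc t
  chain : ∀ t < c, E (t + 1) ≠ E t + 1 → Acc t < q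

namespace Plan

variable {p j c : ℕ} {E ι Acc : ℕ → ℕ}

/-- One more old node at the current exponent raises the accumulated bound by q - 1, hence the
quotient Acc c / q by at most one. The field `count` stays valid because p grows by one as well. -/
theorem absorb (h : Plan q n ex σ p j c E ι Acc) (hq : 2 ≤ q) (hp : p < n) (hex : E c = ex (σ p))
    (hnext : p + 1 < n → ex (σ p) ≤ ex (σ (p + 1))) :
    Plan q n ex σ (p + 1) 0 c E (Function.update ι p c)
      (Function.update Acc c (Acc c + (q - 1))) := by
  have hdiv : (Acc c + (q - 1)) / q ≤ Acc c / q + 1 := by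
    calc (Acc c + (q - 1)) / q ≤ (Acc c + q) / q := Nat.div_le_div_right (by omega)
      _ = Acc c / q + 1 := Nat.add_div_right _ (by omega)
  have hacc : Acc c + (q - 1) ≤ n + (q - 1) * (p + 1) := by
    have := h.acc_le
    rw [mul_add, mul_one]; omega
  -- The accumulated bound is at most n + (q - 1)n = qn. This is the whole of `dist_le`, because the
  -- distance restarts at 0.
  have hdist : (Acc c + (q - 1)) / q ≤ n := by
    refine Nat.div_le_of_le_mul (hacc.trans ?_)
    have : (q - 1) * (p + 1) ≤ (q - 1) * n := Nat.mul_le_mul_left _ hp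
    obtain ⟨q', rfl⟩ : ∃ q', q = q' + 1 := ⟨q - 1, by omega⟩
    rw [Nat.add_sub_cancel] at *
    rw [add_mul, one_mul]; omega
  refine ⟨by omega, hp, ?_, ?_, ?_, h.zero, h.mono, by simpa using hex, fun h' => hex ▸ hnext h',
    ?_,
    ?_, ?_⟩
  · have := h.count
    rw [Function.update_self]; omega
  · rwa [Function.update_self]
  · rw [Function.update_self]; omega
  · intro p' hp'
    rw [Function.update_apply]
    split_ifs with h'
    · exact ⟨le_rfl, h' ▸ hex⟩
    · exact h.index p' (by omega)
  · intro t ht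
    have hcap := h.capacity t ht
    have hcard : ((Finset.range (p + 1)).filter fun p' => Function.update ι p c p' = t).card =
        ((Finset.range p).filter fun p' => ι p' = t).card + if t = c then 1 else 0 := by
      rw [Finset.range_add_one, Finset.filter_insert, Function.update_self]
      have : ((Finset.range p).filter fun p' => Function.update ι p c p' = t) =
          (Finset.range p).filter fun p' => ι p' = t := by
        refine Finset.filter_congr fun p' hp' => ?_
        rw [Function.update_of_ne (Finset.mem_range.1 hp').ne]
      rw [this]
      by_cases htc : t = c
      · rw [if_pos htc.symm, if_pos htc, Finset.card_insert_of_notMem (by simp)]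
      · rw [if_neg (Ne.symm htc), if_neg htc, add_zero]
    have hpred : t ≠ 0 → Function.update Acc c (Acc c + (q - 1)) (t - 1) = Acc (t - 1) := fun h0 =>
      Function.update_of_ne (by omega) _ _
    rw [hcard]
    by_cases htc : t = c
    · subst htc
      rw [if_pos rfl, Function.update_self, mul_add, mul_one]
      by_cases h0 : t = 0
      · rw [if_pos h0] at hcap ⊢; omega
      · rw [if_neg h0] at hcap ⊢
        rw [hpred h0]; omega
    · rw [if_neg htc, add_zero, Function.update_of_ne htc]
      by_cases h0 : t = 0
      · rw [if_pos h0] at hcap ⊢; omega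
      · rw [if_neg h0] at hcap ⊢
        rw [hpred h0]; omega
  · intro t ht hne
    rw [Function.update_of_ne ht.ne]
    exact h.chain t ht hne

/-- Common to `extend` and `jump`: appending a node leaves the capacity of the earlier ones alone,
because carries come only from below. -/
theorem push_capacity (h : Plan q n ex σ p j c E ι Acc) {e a : ℕ} {ι' : ℕ → ℕ} {p' : ℕ}
    (hι : ∀ t ≤ c, ((Finset.range p').filter fun x => ι' x = t).card =
      ((Finset.range p).filter fun x => ι x = t).card)
    (ha : (q - 1) * ((Finset.range p').filter fun x => ι' x = c + 1).card +
      (if e = E c + 1 then Acc c / q else 0) ≤ a) :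
    ∀ t ≤ c + 1, (q - 1) * ((Finset.range p').filter fun x => ι' x = t).card +
      (if t = 0 then n else if Function.update E (c + 1) e t = Function.update E (c + 1) e
        (t - 1) + 1
        then Function.update Acc (c + 1) a (t - 1) / q else 0) ≤ Function.update Acc (c + 1) a t :=
          by
  intro t ht
  obtain rfl | hlt := eq_or_lt_of_le ht
  · rw [if_neg (by omega), Function.update_self, Function.update_self, Nat.add_sub_cancel,
      Function.update_of_ne (by omega), Function.update_of_ne (by omega)]
    exact ha
  · have htc : t ≤ c := by omega
    rw [Function.update_of_ne (by omega), Function.update_of_ne (by omega),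
      Function.update_of_ne (by omega), Function.update_of_ne (by omega), hι t htc]
    exact h.capacity t htc

theorem push_mono (h : Plan q n ex σ p j c E ι Acc) {e : ℕ} (he : E c < e) :
    ∀ t < c + 1, Function.update E (c + 1) e t < Function.update E (c + 1) e (t + 1) := by
  intro t ht
  rw [Function.update_of_ne ht.ne]
  obtain rfl | hlt := eq_or_lt_of_le (Nat.lt_succ_iff.1 ht)
  · rwa [Function.update_self]
  · rw [Function.update_of_ne (by omega)]
    exact h.mono t hlt

theorem push_chain (h : Plan q n ex σ p j c E ι Acc) {e a : ℕ} (he : e ≠ E c + 1 → Acc c < q) :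
    ∀ t < c + 1, Function.update E (c + 1) e (t + 1) ≠ Function.update E (c + 1) e t + 1 →
      Function.update Acc (c + 1) a t < q := by
  intro t ht
  rw [Function.update_of_ne ht.ne, Function.update_of_ne ht.ne]
  obtain rfl | hlt := eq_or_lt_of_le (Nat.lt_succ_iff.1 ht)
  · rwa [Function.update_self]
  · rw [Function.update_of_ne (by omega)]
    exact h.chain t hlt

/-- Since Acc c ≥ q, passing to Acc c / q lowers the quotient by at least one. This pays for the
additional node in `count` and for the additional distance in `dist_le`. -/
theorem extend (h : Plan q n ex σ p j c E ι Acc) (hq : 2 ≤ q) (hacc : q ≤ Acc c)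
    (hex : p < n → E c ≠ ex (σ p)) :
    Plan q n ex σ p (j + 1) (c + 1) (Function.update E (c + 1) (E c + 1)) ι
      (Function.update Acc (c + 1) (Acc c / q)) := by
  have h1 : 1 ≤ Acc c / q := (Nat.one_le_div_iff (by omega)).2 hacc
  have h2 : Acc c / q / q + 1 ≤ Acc c / q := Nat.succ_le_of_lt (Nat.div_lt_self (by omega)
    (by omega))
  have hcount := h.count
  have hdist := h.dist_le
  have hle := h.acc_le
  have hdiv : Acc c / q ≤ Acc c := Nat.div_le_self _ _
  refine ⟨h.one_le, h.le, ?_, ?_, ?_, ?_, h.push_mono (Nat.lt_succ_self _), ?_, fun hp => ?_,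
    fun p' hp' => ?_, h.push_capacity (fun _ _ => rfl) ?_, h.push_chain fun h' => absurd rfl h'⟩
  · rw [Function.update_self]; omega
  · rw [Function.update_self]; omega
  · rw [Function.update_self]; omega
  · rw [Function.update_of_ne (by omega), h.zero]
  · rw [Function.update_self, h.last]; ring
  · rw [Function.update_self]
    exact Nat.succ_le_of_lt (lt_of_le_of_ne (h.next hp) (hex hp))
  · have := h.index p' hp'
    rw [Function.update_of_ne (by omega)]
    exact ⟨by omega, this.2⟩
  · rw [if_pos rfl, Finset.filter_false_of_mem, Finset.card_empty]
    · omega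
    · intro x hx
      have := (h.index x (Finset.mem_range.1 hx)).1
      omega

/-- The new node is paid for by the old node that it represents. As Acc c < q, no carry can leave
the old chain, so nothing is lost across the gap; this also covers the case that the gap is exactly
1. -/
theorem jump (h : Plan q n ex σ p j c E ι Acc) (hacc : Acc c < q) (hp : p < n)
    (hex : E c ≠ ex (σ p)) (hnext : p + 1 < n → ex (σ p) ≤ ex (σ (p + 1))) :
    Plan q n ex σ (p + 1) 0 (c + 1) (Function.update E (c + 1) (ex (σ p)))
      (Function.update ι p (c + 1)) (Function.update Acc (c + 1) (q - 1)) := by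
  have hcount := h.count
  have hdist := h.dist_le
  have hle := h.acc_le
  have h0 : (q - 1) / q = 0 := Nat.div_eq_of_lt (by omega)
  have h0' : Acc c / q = 0 := Nat.div_eq_of_lt hacc
  have hfil : ∀ t, ((Finset.range (p + 1)).filter fun x => Function.update ι p (c + 1) x = t).card =
      ((Finset.range p).filter fun x => ι x = t).card + if c + 1 = t then 1 else 0 := by
    intro t
    have : ((Finset.range p).filter fun x => Function.update ι p (c + 1) x = t) =
        (Finset.range p).filter fun x => ι x = t := by
      refine Finset.filter_congr fun p' hp' => ?_
      rw [Function.update_of_ne (Finset.mem_range.1 hp').ne]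
    rw [Finset.range_add_one, Finset.filter_insert, Function.update_self, this]
    split_ifs
    · rw [Finset.card_insert_of_notMem (by simp)]
    · rw [add_zero]
  refine ⟨by omega, hp, ?_, ?_, ?_, ?_, h.push_mono (lt_of_le_of_ne (h.next hp) hex), ?_,
    fun hp => ?_, fun p' hp' => ?_, h.push_capacity (fun t ht => ?_) ?_, h.push_chain fun _ => hacc⟩
  · rw [Function.update_self]; omega
  · rw [Function.update_self, mul_add, mul_one]; omega
  · rw [Function.update_self]; omega
  · rw [Function.update_of_ne (by omega), h.zero]
  · rw [Function.update_self]; simp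
  · rw [Function.update_self]; exact hnext hp
  · rw [Function.update_apply ι]
    split_ifs with h'
    · rw [Function.update_self, h']; simp
    · have := h.index p' (by omega)
      rw [Function.update_of_ne (by omega)]
      exact ⟨by omega, this.2⟩
  · rw [hfil, if_neg (by omega), add_zero]
  · rw [hfil, if_pos rfl, h0', Finset.filter_false_of_mem]
    · simp
    · intro x hx
      have := (h.index x (Finset.mem_range.1 hx)).1
      omega

end Plan

/-- The memory holds a plan. -/
structure Holds (n m : ℕ) (ex σ : ℕ → ℕ) (M₀ M : Mem) (p c : ℕ) (E ι : ℕ → ℕ) : Prop where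
  node : ∀ t ≤ c, ∃ u < n, ∃ o ≤ n, M.arr 5 t = (u : ℕ) ∧ M.arr 6 t = (o : ℕ) ∧ E t = ex u + o
  index : ∀ p' < p, M.arr 7 (σ p') = ι p'
  list : ∀ t ≤ c, M.pos (offset n m + t) = t
  bit : ∀ t < c, M.pos (offset n m + stride n + t) = if E (t + 1) = E t + 1 then 1 else 0
  pos : ∀ a, a < offset n m ∨ offset n m + 2 * stride n ≤ a → M.pos a = M₀.pos a
  arr : ∀ k : Fin 16, k ≠ 5 → k ≠ 6 → k ≠ 7 → M.arr k = M₀.arr k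

theorem Holds.push {M₀ M' : Mem} {p p' c u o e : ℕ} {b : ℤ} {E ι ι' : ℕ → ℕ}
    (h : Holds n m ex σ M₀ M p c E ι) (hu : u < n) (ho : o ≤ n) (he : e = ex u + o)
    (hc : c + 1 < stride n) (hb : b = if e = E c + 1 then 1 else 0)
    (h5 : M'.arr 5 = Function.update (M.arr 5) (c + 1) (u : ℤ))
    (h6 : M'.arr 6 = Function.update (M.arr 6) (c + 1) (o : ℤ))
    (h7 : ∀ x < p', M'.arr 7 (σ x) = ι' x)
    (hpos : M'.pos = Function.update (Function.update M.pos (offset n m + stride n + c) b)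
      (offset n m + (c + 1)) ((c + 1 : ℕ) : ℤ))
    (harr : ∀ k : Fin 16, k ≠ 5 → k ≠ 6 → k ≠ 7 → M'.arr k = M.arr k) :
    Holds n m ex σ M₀ M' p' (c + 1) (Function.update E (c + 1) e) ι' := by
  refine ⟨fun t ht => ?_, h7, fun t ht => ?_, fun t ht => ?_, fun a ha => ?_, fun k h₁ h₂ h₃ =>
    (harr k h₁ h₂ h₃).trans (h.arr k h₁ h₂ h₃)⟩
  · rw [h5, h6]
    obtain rfl | hlt := eq_or_lt_of_le ht
    · exact ⟨u, hu, o, ho, by simp, by simp, by simp [he]⟩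
    · rw [Function.update_of_ne hlt.ne, Function.update_of_ne hlt.ne, Function.update_of_ne hlt.ne]
      exact h.node t (by omega)
  · rw [hpos]
    obtain rfl | hlt := eq_or_lt_of_le ht
    · rw [Function.update_self]
    · rw [Function.update_of_ne (by omega), Function.update_of_ne (by omega)]
      exact h.list t (by omega)
  · rw [hpos, Function.update_of_ne (by omega), Function.update_of_ne (a := t) (by omega)]
    obtain rfl | hlt := eq_or_lt_of_le (Nat.lt_succ_iff.1 ht)
    · rw [Function.update_self, Function.update_self, hb]
    · rw [Function.update_of_ne (by omega), Function.update_of_ne (by omega)]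
      exact h.bit t hlt
  · rw [hpos, Function.update_of_ne (by omega), Function.update_of_ne (by omega)]
    exact h.pos a ha

end ArrayMachine

/-! ### The construction of the new nodes -/

namespace ArrayMachine

open RAM

variable {q n m i : ℕ} {K W : ℤ} {R : ℕ → ℤ} {M M₀ : Mem} {P : ℕ → ℤ} {ex σ : ℕ → ℕ}
  {good : ℕ → Prop}

/-- The state of `buildNodes` after `k` steps. -/
def BuildState (q n m : ℕ) (ex σ : ℕ → ℕ) (M₀ : Mem) (k : ℕ) (R : ℕ → ℤ) (M : Mem) : Prop :=
  ∃ (p j c : ℕ) (E ι Acc : ℕ → ℕ), R 35 = p ∧ R 36 = j ∧ R 37 = Acc c ∧ R 38 = (c + 1 : ℕ) ∧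
    Plan q n ex σ p j c E ι Acc ∧ Holds n m ex σ M₀ M p c E ι ∧
    ((p = n ∧ Acc c < q) ∨ k + 1 ≤ p + c)

/-- A gap can be recognized exactly as long as it is compared with a number below the clipping
bound. This is how equality of exponents is tested without knowing them. -/
theorem SortedNodes.gap_eq (hS : SortedNodes q n n P good ex M₀ σ) {p j e : ℕ} (hp : p < n)
    (h1 : 1 ≤ p) (hj : j < gapBound q n) (he : e = ex (σ (p - 1)) + j) :
    M₀.arr 4 p = (j : ℤ) ↔ e = ex (σ p) := by
  obtain ⟨p, rfl⟩ : ∃ p', p = p' + 1 := ⟨p - 1, by omega⟩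
  have := hS.le (show p ≤ p + 1 by omega) hp
  rw [hS.list.gap _ hp]
  simp only [exponents, Nat.add_sub_cancel] at *
  norm_cast
  omega

/-- The three active branches are `Plan.absorb`, `Plan.extend` and `Plan.jump`. Each raises p + c by
at least one; the idle branch is reached only when the plan is complete. -/
theorem buildStep_spec (hroom : Room q n m K) (hR : Base q n m R)
    (hS : SortedNodes q n n P good ex M₀ σ) {k : ℕ} (h : BuildState q n m ex σ M₀ k R M) :
    ATri K W (buildStep q) R M 120 (BuildState q n m ex σ M₀ (k + 1)) := by
  have hbasic := hroom.basic
  have haddr := hroom.address_le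
  have hconst := hroom.const_le
  have hq := hroom.two_le
  have h0 := hR.r0
  have h8 := hR.r8
  have h9 := hR.r9
  obtain ⟨p, j, c, E, ι, Acc, h35, h36, h37, h38, hP, hH, hk⟩ := h
  have hp1 := hP.one_le
  have hpn := hP.le
  have hdist := hP.dist_le
  have hcount := hP.count
  have hacc := hP.acc_le
  have hjn : j ≤ n := le_trans (Nat.le_add_right _ _) hdist
  have hcn : c + 1 ≤ n + p := le_trans (Nat.le_add_right _ _) hcount
  have h3 : M.arr 3 = M₀.arr 3 := hH.arr 3 (by decide) (by decide) (by decide)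
  have h4 : M.arr 4 = M₀.arr 4 := hH.arr 4 (by decide) (by decide) (by decide)
  have hlist : ∀ p < n, M.arr 3 p = σ p := fun p hp => (congrFun h3 p).trans (hS.list.list p hp)
  have hgap : p < n → (M.arr 4 p = (j : ℤ) ↔ E c = ex (σ p)) := fun hp =>
    h4 ▸ hS.gap_eq hp hp1 (by omega) hP.last
  -- The adjacency bit of a jump compares the gap with j + 1; this is still below the clipping
  -- bound, because j ≤ n.
  have hgap' : p < n → (M.arr 4 p = (j : ℤ) + 1 ↔ ex (σ p) = E c + 1) := fun hp => by
    have := hS.gap_eq (j := j + 1) (e := E c + 1) hp hp1 (by omega) (by rw [hP.last]; ring)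
    rw [h4, eq_comm (a := ex (σ p)), ← this]; push_cast; rfl
  have hnext : p + 1 < n → ex (σ p) ≤ ex (σ (p + 1)) := fun hp => hS.le (Nat.le_succ p) hp
  have hc : c + 1 < stride n := by unfold stride; omega
  have hqp : (q - 1) * p ≤ (q - 1) * n := Nat.mul_le_mul_left _ hpn
  have hqn : (q - 1) * n + n = q * n := by
    obtain ⟨q', rfl⟩ : ∃ q', q = q' + 1 := ⟨q - 1, by omega⟩
    rw [Nat.add_sub_cancel]; ring
  have hacc' : (Acc c : ℤ) + q ≤ K := by
    have h5 : 3 * (q * n : ℕ) + (q : ℤ) ≤ K := by push_cast; rw [← mul_assoc]; omega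
    omega
  have hoff : (offset n m : ℤ) + 2 * stride n + 2 ≤ K := by
    have : (stride n : ℤ) * 4 ≤ stride n * (2 * n + m + 4) :=
      mul_le_mul_of_nonneg_left (by omega) (by omega)
    have : (stride n : ℤ) = 2 * n + 2 := by unfold stride; push_cast; rfl
    omega
  have e1 : ((c + 1 : ℕ) : ℤ) - 1 = c := by push_cast; ring
  have e2 : ((p : ℕ) : ℤ) - 1 = ((p - 1 : ℕ) : ℤ) := by omega
  have e3 : ((offset n m : ℤ) + stride n + c).toNat = offset n m + stride n + c := by norm_cast
  have e4 : ((offset n m : ℤ) + ((c + 1 : ℕ) : ℤ)).toNat = offset n m + (c + 1) := by norm_cast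
  have e5 : ((q : ℤ) - 1) = ((q - 1 : ℕ) : ℤ) := by omega
  have e6 : (Acc c : ℤ) / q = ((Acc c / q : ℕ) : ℤ) := by norm_cast
  have hσ : ∀ p < n, (σ p : ℤ) ≤ K ∧ 0 ≤ (σ p : ℤ) := fun p hp => by
    have := hS.lt p hp; omega
  refine ATri.cond (T₁ := 100) ⟨⟨trivial, trivial⟩, ⟨trivial, ?_⟩, trivial⟩ (fun hc1 => ?_)
    (fun hc1 => ?_) (by simp [AExpr.cost])
  · simp only [AExpr.eval, h35]; omega
  · have hc1' : p < n ∧ M.arr 4 p = j := by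
      change (if R 35 < R 0 then (1 : ℤ) else 0) * (if M.arr 4
        (R 35).toNat = R 36 then 1 else 0) ≠ 0
        at hc1
      rw [h35, h0, h36, Int.toNat_natCast] at hc1
      constructor <;> by_contra h'
      · rw [if_neg (by omega)] at hc1; simp at hc1
      · rw [if_neg h'] at hc1; simp at hc1
    obtain ⟨hpn', hj⟩ := hc1'
    have hex := (hgap hpn').1 hj
    refine ATri.wp ?_ (by simp [AProg.time, AExpr.cost, AExpr.sub_def])
    simp only [AProg.wp, AExpr.sub_def, AExpr.Safe, AExpr.eval, Op.apply, true_and, and_true,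
      Function.update_apply, Nat.reduceEqDiff, if_false, h35, h37, h38,
      Int.toNat_natCast, hlist p hpn', e1, e5]
    have := hσ p hpn'
    refine ⟨by omega, by omega, by omega, by omega, by omega, by omega, p + 1, 0, c, E,
      Function.update ι p c, Function.update Acc c (Acc c + (q - 1)), by simp, by simp, by simp,
      by simp [h38], hP.absorb hq hpn' hex hnext, ⟨?_, ?_, ?_, ?_, ?_, ?_⟩, ?_⟩
    · intro t ht
      simpa using hH.node t ht
    · intro p' hp'
      simp only [Mem.setArr_arr, if_true]
      obtain rfl | hlt := eq_or_lt_of_le (Nat.lt_succ_iff.1 hp')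
      · simp
      · rw [Function.update_of_ne hlt.ne, Function.update_of_ne fun h =>
          hlt.ne (hS.inj _ (by omega) _ hpn' h)]
        exact hH.index p' hlt
    · exact hH.list
    · exact hH.bit
    · exact hH.pos
    · intro k h5 h6 h7
      rw [Mem.setArr_arr, if_neg h7]
      exact hH.arr k h5 h6 h7
    · omega
  · have hc1' : p < n → E c ≠ ex (σ p) := by
      change (if R 35 < R 0 then (1 : ℤ) else 0) * (if M.arr 4
        (R 35).toNat = R 36 then 1 else 0) = 0
        at hc1
      rw [h35, h0, h36, Int.toNat_natCast] at hc1
      intro hpn' he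
      rw [if_pos (by omega), if_pos ((hgap hpn').2 he)] at hc1
      simp at hc1
    refine ATri.cond (T₁ := 80) ⟨trivial, trivial⟩ (fun hc2 => ?_) (fun hc2 => ?_)
      (by simp [AExpr.cost])
    · have hc2' : q ≤ Acc c := by
        by_contra h'
        refine hc2 (if_neg ?_)
        change ¬ (q : ℤ) - 1 < R 37
        omega
      refine ATri.wp ?_ (by simp [AProg.time, AExpr.cost, AExpr.sub_def, AExpr.div_def])
      have := hσ (p - 1) (by omega)
      have hdiv : Acc c / q ≤ Acc c := Nat.div_le_self _ _
      have hdiv1 : 1 ≤ Acc c / q := (Nat.one_le_div_iff (by omega)).2 hc2'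
      simp only [AProg.wp, AExpr.sub_def, AExpr.div_def, AExpr.Safe, AExpr.eval, Op.apply, true_and,
        and_true, Function.update_apply, Nat.reduceEqDiff, if_true, if_false, h35, h36, h37, h38,
        h8, h9, Int.toNat_natCast, e1, e2, e3, e4, e6, hlist (p - 1) (by omega)]
      refine ⟨by omega, by omega, by omega, by omega, by omega, by omega, by omega, by omega,
        by omega, by omega, by omega, by omega, p, j + 1, c + 1, _, ι, _, by simp [h35], by simp,
        by simp, by simp, hP.extend hq hc2' hc1', hH.push (u := σ (p - 1)) (o := j + 1) (b := 1)
          (hS.lt _ (by omega)) (by omega) (by rw [hP.last]; ring) hc (by simp) (by simp) (by simp)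
          (by simpa using hH.index) (by simp) (fun k h5 h6 _ => ?_), by omega⟩
      simp [h5, h6]
    · have hc2' : Acc c < q := by
        by_contra h'
        refine one_ne_zero ((if_pos ?_).symm.trans hc2)
        change (q : ℤ) - 1 < R 37
        omega
      have hdiv0 : Acc c / q = 0 := Nat.div_eq_of_lt hc2'
      refine ATri.cond (T₁ := 70) ⟨trivial, trivial⟩ (fun hc3 => ?_) (fun hc3 => ?_)
        (by simp [AExpr.cost])
      · have hpn' : p < n := by
          by_contra h'
          refine hc3 (if_neg ?_)
          change ¬ R 35 < R 0
          omega
        refine ATri.wp ?_ (by simp [AProg.time, AExpr.cost, AExpr.sub_def])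
        have := hσ p hpn'
        have hb01 : 0 ≤ (if ex (σ p) = E c + 1 then (1 : ℤ) else 0) ∧
            (if ex (σ p) = E c + 1 then (1 : ℤ) else 0) ≤ 1 := by split_ifs <;> simp
        simp only [AProg.wp, AExpr.sub_def, AExpr.Safe, AExpr.eval, Op.apply, true_and, and_true,
          Function.update_apply, Nat.reduceEqDiff, if_false, h35, h36, h38, h8, h9,
          Int.toNat_natCast, e1, e3, e4, e5, Mem.setArr_arr,
          if_neg (by decide : ¬ (3 : Fin 16) = 5), if_neg (by decide : ¬ (3 : Fin 16) = 6),
          if_neg (by decide : ¬ (4 : Fin 16) = 5), if_neg (by decide : ¬ (4 : Fin 16) = 6),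
          if_neg (by decide : ¬ (4 : Fin 16) = 7),
          hlist p hpn', hgap' hpn']
        refine ⟨by omega, by omega, by omega, by omega, by omega, by omega, by omega, by omega,
          by omega, by omega, by omega, by omega, by omega, by omega, by omega, by omega, by omega,
          p + 1, 0, c + 1, _, _, _, by simp, by simp, by simp,
          by simp, hP.jump hc2' hpn' (hc1' hpn') hnext, hH.push (u := σ p) (o := 0)
            (hS.lt _ hpn') (by omega) (by simp) hc rfl (by simp) (by simp) (fun p' hp' => ?_)
            (by simp) (fun k h5 h6 h7 => ?_), by omega⟩
        · simp only [Mem.setArr_arr, Mem.setPos_arr, if_true,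
            if_neg (by decide : ¬ (7 : Fin 16) = 5), if_neg (by decide : ¬ (7 : Fin 16) = 6)]
          obtain rfl | hlt := eq_or_lt_of_le (Nat.lt_succ_iff.1 hp')
          · simp
          · rw [Function.update_of_ne hlt.ne, Function.update_of_ne fun h =>
              hlt.ne (hS.inj _ (by omega) _ hpn' h)]
            exact hH.index p' hlt
        · simp [h5, h6, h7]
      · have hpn' : p = n := by
          by_contra h'
          refine one_ne_zero ((if_pos ?_).symm.trans hc3)
          change R 35 < R 0
          omega
        refine ATri.wp ?_ (by simp [AProg.time])
        exact ⟨p, j, c, E, ι, Acc, h35, h36, h37, h38, hP, hH, .inl ⟨hpn', hc2'⟩⟩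

theorem SortedNodes.image_range (hS : SortedNodes q n n P good ex M₀ σ) :
    (Finset.range n).image σ = Finset.range n := by
  refine Finset.eq_of_subset_of_card_le (fun v hv => ?_) ?_
  · obtain ⟨p, hp, rfl⟩ := Finset.mem_image.1 hv
    exact Finset.mem_range.2 (hS.lt p (Finset.mem_range.1 hp))
  · rw [Finset.card_image_of_injOn fun p hp p' hp' h => hS.inj p (Finset.mem_range.1 hp) p'
      (Finset.mem_range.1 hp') h]

theorem SortedNodes.exists_eq (hS : SortedNodes q n n P good ex M₀ σ) {v : ℕ} (hv : v < n) :
    ∃ p < n, σ p = v := by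
  have : v ∈ (Finset.range n).image σ := by
    rw [hS.image_range]; exact Finset.mem_range.2 hv
  obtain ⟨p, hp, h⟩ := Finset.mem_image.1 this
  exact ⟨p, Finset.mem_range.1 hp, h⟩

/-- A sink has the empty successor marking and thus exponent 0, and exponents are natural numbers.
Hence the first new node has value 1 and can carry the offsets of all chain nodes. -/
theorem SortedNodes.first_eq_zero (hN : NodeSystem q n P good ex)
    (hS : SortedNodes q n n P good ex M₀ σ) (hn : 1 ≤ n) : ex (σ 0) = 0 := by
  obtain ⟨u, hu, -, h⟩ := hN.acyclic ∅ ⟨0, hn, by simp⟩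
  obtain ⟨p, hp, rfl⟩ := hS.exists_eq hu
  have h0 : rowValue q n P ex (n * σ p) = 0 := Finset.sum_eq_zero fun v hv => by
    rw [not_not.1 fun h' => absurd (h v (Finset.mem_range.1 hv) h') (by simp), zero_mul]
  have := hS.le (Nat.zero_le p) hp
  have := hS.rowValue_eq hN hp
  omega

/-- The memory describes `N` new nodes with exponents `E 0 < … < E (N - 1)`. The number `Acc t`
bounds the absolute value of the coefficient of node `t` including carries. -/
structure NewNodes (q n m N : ℕ) (ex : ℕ → ℕ) (M : Mem) (E idx Acc : ℕ → ℕ) : Prop where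
  one_le : 1 ≤ N
  le : N ≤ 2 * n
  zero : E 0 = 0
  mono : ∀ t, t + 1 < N → E t < E (t + 1)
  index : ∀ v < n, idx v < N ∧ E (idx v) = ex v ∧ M.arr 7 v = idx v
  capacity : ∀ t < N, (q - 1) * ((Finset.range n).filter fun v => idx v = t).card +
    (if t = 0 then n else if E t = E (t - 1) + 1 then Acc (t - 1) / q else 0) ≤ Acc t
  chain : ∀ t < N, (t + 1 < N → E (t + 1) ≠ E t + 1) → Acc t < q
  node : ∀ t < N, ∃ u < n, ∃ o ≤ n, M.arr 5 t = (u : ℕ) ∧ M.arr 6 t = (o : ℕ) ∧ E t = ex u + o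
  list : ∀ t < N, M.pos (offset n m + t) = t
  bit : ∀ t, t + 1 < N →
    M.pos (offset n m + stride n + t) = if E (t + 1) = E t + 1 then 1 else 0

/-- Translates the index map from list positions to node names, along the bijection given by the
sorted list. -/
theorem Plan.newNodes {j c : ℕ} {E ι Acc : ℕ → ℕ} (hS : SortedNodes q n n P good ex M₀ σ)
    (hP : Plan q n ex σ n j c E ι Acc) (hH : Holds n m ex σ M₀ M n c E ι) (hacc : Acc c < q) :
    NewNodes q n m (c + 1) ex M E (fun v => (M.arr 7 v).toNat) Acc := by
  have hcount := hP.count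
  have hidx : ∀ p < n, (M.arr 7 (σ p)).toNat = ι p := fun p hp => by
    rw [hH.index p hp, Int.toNat_natCast]
  refine ⟨by omega, le_trans (Nat.le_add_right _ _) (hcount.trans (by omega)), hP.zero,
    fun t ht => hP.mono t (by omega), fun v hv => ?_, fun t ht => ?_, fun t ht h => ?_,
    fun t ht => hH.node t (by omega), fun t ht => hH.list t (by omega),
    fun t ht => hH.bit t (by omega)⟩
  · obtain ⟨p, hp, rfl⟩ := hS.exists_eq hv
    rw [hidx p hp, hH.index p hp]
    have := hP.index p hp
    exact ⟨by omega, this.2, rfl⟩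
  · refine le_trans (le_of_eq ?_) (hP.capacity t (by omega))
    congr 2
    rw [← Finset.card_image_of_injOn (f := σ) (s := (Finset.range n).filter fun p' => ι p' = t)]
    · congr 1
      ext v
      simp only [Finset.mem_filter, Finset.mem_image, Finset.mem_range]
      constructor
      · rintro ⟨hv, h⟩
        obtain ⟨p, hp, rfl⟩ := hS.exists_eq hv
        exact ⟨p, ⟨hp, (hidx p hp).symm.trans h⟩, rfl⟩
      · rintro ⟨p, ⟨hp, h⟩, rfl⟩
        exact ⟨hS.lt p hp, (hidx p hp).trans h⟩
    · intro p hp p' hp' h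
      simp only [Finset.coe_filter, Finset.mem_range, Set.mem_ofPred_eq] at hp hp'
      exact hS.inj p hp.1 p' hp'.1 h
  · obtain rfl | hlt := eq_or_lt_of_le (Nat.lt_succ_iff.1 ht)
    · exact hacc
    · exact hP.chain t hlt (h (by omega))

theorem buildNodes_spec (hroom : Room q n m K) (hR : Base q n m R)
    (hN : NodeSystem q n P good ex) (hS : SortedNodes q n n P good ex M σ) :
    ATri K W (buildNodes q) R M (3 * n * 128 + 100) (fun R' M' => ∃ (N : ℕ) (E idx Acc : ℕ → ℕ),
      R' 38 = N ∧ NewNodes q n m N ex M' E idx Acc ∧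
      (∀ a, a < offset n m ∨ offset n m + 2 * stride n ≤ a → M'.pos a = M.pos a) ∧
      ∀ k : Fin 16, k ≠ 5 → k ≠ 6 → k ≠ 7 → M'.arr k = M.arr k) := by
  have hbasic := hroom.basic
  have hoff := hroom.offset_le
  have hconst := hroom.const_le
  have hq := hroom.two_le
  have hn := hroom.one_le
  have hlin := hroom.linear_le
  have h3 : M.arr 3 0 = σ 0 := hS.list.list 0 hn
  have hlt := hS.lt 0 hn
  have hex := hS.first_eq_zero hN hn
  refine ATri.wp_seq (T₂ := 3 * n * 128 + 10) ?_
    (by simp [AProg.time, AExpr.cost]; omega)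
  have e3 : (3 : ℤ) * (n : ℕ) = (3 * n : ℕ) := by push_cast; rfl
  have eq1 : ((q : ℤ) - 1) = ((q - 1 : ℕ) : ℤ) := by omega
  simp only [AProg.wp, AExpr.Safe, AExpr.eval, Op.apply, true_and, and_true,
    Function.update_apply, Nat.reduceEqDiff, if_false, hR.r0, hR.r9, Mem.setArr_arr,
    if_neg (by decide : ¬ (3 : Fin 16) = 5), if_neg (by decide : ¬ (3 : Fin 16) = 6),
    Int.toNat_natCast, Int.toNat_zero, h3, e3, eq1]
  refine ⟨by omega, by omega, by omega, by omega, by omega, by omega, by omega, by omega, by omega,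
    by omega, by omega, by omega, by omega, by omega, by omega, by omega, ?_⟩
  have hbase : ∀ x < 12, x ∉ (buildStep q).writes ∧ x ≠ 33 := by
    intro x hx; simp [buildStep, AProg.writes]; omega
  -- Each unfinished round raises p + c, and p ≤ n and c + 1 ≤ n + p give p + c ≤ 3n - 1. So 3n
  -- rounds suffice.
  refine ATri.forUp (a := 0) (b := 3 * n) (T₁ := 120) (by decide) (by simp [buildStep,
    AProg.writes])
    (by simp [buildStep, AProg.writes]) (by simp) (by simp) (by omega)
    (BuildState q n m ex σ M) ?_ ?_ (by omega) ?_
  -- The first bound n + (q - 1) reserves n for the offset of a chain node and q - 1 for the digit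
  -- of the first old node.
  · refine ⟨1, 0, 0, fun _ => 0, fun _ => 0, fun _ => n + (q - 1), by simp, by simp, by simp,
      by simp, ⟨le_rfl, hn, ?_, by omega, ?_, rfl, by simp, by simp [hex], by simp, ?_, ?_,
        by simp⟩,
      ⟨?_, ?_, by simp, by simp, ?_, ?_⟩, by omega⟩
    · have : (n + (q - 1)) / q ≤ n := by
        refine Nat.div_le_of_le_mul ?_
        obtain ⟨q', rfl⟩ : ∃ q', q = q' + 1 := ⟨q - 1, by omega⟩
        have := Nat.le_mul_of_pos_right q' hn
        rw [add_mul]; omega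
      omega
    · rw [zero_add]
      refine Nat.div_le_of_le_mul ?_
      obtain ⟨q', rfl⟩ : ∃ q', q = q' + 1 := ⟨q - 1, by omega⟩
      have := Nat.le_mul_of_pos_right q' hn
      rw [add_mul]; omega
    · intro p' hp'
      obtain rfl : p' = 0 := by omega
      exact ⟨le_rfl, hex.symm⟩
    · intro t ht
      obtain rfl : t = 0 := by omega
      simp; omega
    · intro t ht
      obtain rfl : t = 0 := by omega
      exact ⟨σ 0, hlt, 0, by omega, by simp, by simp, by simp [hex]⟩
    · intro p' hp'
      obtain rfl : p' = 0 := by omega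
      simp
    · intro a ha
      have : a ≠ offset n m := by unfold stride at ha; omega
      simp [this]
    · intro k h5 h6 h7
      simp [h5, h6, h7]
  · intro k R' M' _ _ _ _ hfr h
    refine (buildStep_spec hroom (hR.frame fun x hx => ?_) hS h).mono le_rfl fun R'' M'' h' => ?_
    · rw [hfr x (hbase x hx).1 (hbase x hx).2]
      simp only [Function.update_apply]
      repeat rw [if_neg (by omega)]
    · obtain ⟨p, j, c, E, ι, Acc, h35, h36, h37, h38, h⟩ := h'
      exact ⟨p, j, c, E, ι, Acc, by simpa using h35, by simpa using h36, by simpa using h37,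
        by simpa using h38, h⟩
  · rintro R' M' ⟨p, j, c, E, ι, Acc, h35, h36, h37, h38, hP, hH, h⟩ _ _
    have hcount := le_trans (Nat.le_add_right _ _) hP.count
    have hle := hP.le
    obtain ⟨rfl, hacc⟩ : p = n ∧ Acc c < q := by omega
    exact ⟨c + 1, E, _, Acc, h38, hP.newNodes hS hH hacc, hH.pos, hH.arr⟩

end ArrayMachine

/-! ### Rewriting a marking in terms of the new nodes -/

namespace ArrayMachine

open RAM

variable {q n m N : ℕ} {K W : ℤ} {R : ℕ → ℤ} {M : Mem} {P : ℕ → ℤ} {ex E idx Acc : ℕ → ℕ}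

/-- The coefficient of the new node `t` of the marking `f` of the old nodes plus `o` times the
first new node. -/
def coefficient (n : ℕ) (idx : ℕ → ℕ) (f : ℕ → ℤ) (o t : ℕ) : ℤ :=
  (if t = 0 then (o : ℤ) else 0) + ∑ v ∈ (Finset.range n).filter fun v => idx v = t, f v

theorem abs_coefficient_le {f : ℕ → ℤ} {o b : ℕ} (ho : o ≤ b) (t : ℕ) (hf : ∀ v < n, |f v| ≤ q) :
    |coefficient n idx f o t| ≤
      (q * ((Finset.range n).filter fun v => idx v = t).card + if t = 0 then b else 0 : ℕ) := by
  have h1 : |∑ v ∈ (Finset.range n).filter fun v => idx v = t, f v| ≤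
      (((Finset.range n).filter fun v => idx v = t).card : ℤ) * q := by
    refine (Finset.abs_sum_le_sum_abs _ _).trans ?_
    rw [← nsmul_eq_mul]
    exact Finset.sum_le_card_nsmul _ _ _ fun v hv =>
      hf v (Finset.mem_range.1 (Finset.mem_filter.1 hv).1)
  refine (abs_add_le _ _).trans ?_
  push_cast
  rw [mul_comm] at h1
  split_ifs <;> simp <;> omega

theorem abs_coefficient_le' {f : ℕ → ℤ} {o : ℕ} (ho : o ≤ n) (t : ℕ) (hf : ∀ v < n, |f v| ≤ q) :
    |coefficient n idx f o t| ≤ (q * n + n : ℕ) := by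
  refine (abs_coefficient_le ho t hf).trans ?_
  have : ((Finset.range n).filter fun v => idx v = t).card ≤ n := by
    simpa using Finset.card_filter_le (Finset.range n) fun v => idx v = t
  have := Nat.mul_le_mul_left q this
  split_ifs <;> omega

/-- Regroups the old nodes by the new node that represents them; the offset counts the first new
node. -/
theorem sum_coefficient {f : ℕ → ℤ} {o : ℕ} (hN : 1 ≤ N) (hidx : ∀ v < n, idx v < N)
    (g : ℕ → ℤ) : ∑ t ∈ Finset.range N, coefficient n idx f o t * g t =
      o * g 0 + ∑ v ∈ Finset.range n, f v * g (idx v) := by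
  simp only [coefficient, add_mul, Finset.sum_add_distrib, ite_mul, zero_mul]
  congr 1
  · rw [Finset.sum_ite_eq' (Finset.range N) 0, if_pos (Finset.mem_range.2 hN)]
  · rw [← Finset.sum_fiberwise_of_maps_to (s := Finset.range n) (t := Finset.range N) (g := idx)
      (fun v hv => Finset.mem_range.2 (hidx v (Finset.mem_range.1 hv)))]
    refine Finset.sum_congr rfl fun t _ => ?_
    rw [Finset.sum_mul]
    exact Finset.sum_congr rfl fun v hv => by rw [(Finset.mem_filter.1 hv).2]

theorem scatter_spec (hroom : Room q n m K) (hR : R 0 = n) {a o : ℕ} (ha : R 41 = a)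
    (ho : R 42 = o) (hon : o ≤ n) (haK : (a : ℤ) + n ≤ K)
    (hidx : ∀ v < n, idx v < N ∧ M.arr 7 v = idx v)
    (hzero : ∀ t < N, M.arr 9 t = 0) (hf : ∀ v < n, |M.pos (a + v)| ≤ q) :
    ATri K W scatter R M (50 * n + 30) (fun _ M' => M.AgreeOff [9] M' ∧
      ∀ t < N, M'.arr 9 t = coefficient n idx (fun v => M.pos (a + v)) o t) := by
  have hbasic := hroom.basic
  refine ATri.wp_seq (T₂ := 50 * n + 10) ?_ (by simp [AProg.time, AExpr.cost]; omega)
  simp only [AProg.wp, AExpr.Safe, AExpr.eval, true_and, ho, Int.toNat_zero]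
  refine ⟨by omega, by omega, by omega, ?_⟩
  refine ATri.forUp (a := 0) (b := n) (T₁ := 40) (by decide) (by decide) (by decide) (by simp)
    (by simp [hR]) (by omega) (fun k _ M' => M.AgreeOff [9] M' ∧
      ∀ t < N, M'.arr 9 t = coefficient k idx (fun v => M.pos (a + v)) o t) ?_ ?_ (by omega) ?_
  · refine ⟨(Mem.AgreeOff.refl _ _).setArr (by simp) _ _, fun t ht => ?_⟩
    rw [Mem.setArr_arr, if_pos rfl, Function.update_apply, hzero t ht]
    simp [coefficient]
  · rintro k R' M' _ hk h44 _ hfr ⟨hM, hc⟩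
    have h41 : R' 41 = a := by rw [hfr 41 (by decide) (by decide)]; simp [ha]
    have h7 : M'.arr 7 k = idx k := by rw [hM.2 7 (by decide)]; exact (hidx k hk).2
    have hpos : M'.pos = M.pos := hM.1
    have hNk := (hidx k hk).1
    have hstep : ∀ t, coefficient (k + 1) idx (fun v => M.pos (a + v)) o t =
        coefficient k idx (fun v => M.pos (a + v)) o t + if idx k = t then M.pos
          (a + k) else 0 := by
      intro t
      rw [coefficient, coefficient, Finset.range_add_one, Finset.filter_insert]
      split_ifs
      all_goals first
        | rw [Finset.sum_insert (by simp)]; ring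
        | simp
    have e1 : ((a : ℤ) + k).toNat = a + k := by norm_cast
    -- Partial sums obey the same bound as complete coefficients, so no intermediate cell overflows.
    have hb' : |coefficient (k + 1) idx (fun v => M.pos (a + v)) o (idx k)| ≤ K := by
      refine (abs_coefficient_le (b := n) hon _ fun v hv => hf v (by omega)).trans ?_
      have h1 : ((Finset.range (k + 1)).filter fun v => idx v = idx k).card ≤ n :=
        (by simpa using Finset.card_filter_le (Finset.range (k + 1)) fun v => idx v = idx k :
          _ ≤ k + 1).trans hk
      have h2 := Nat.mul_le_mul_left q h1
      have h3 : 3 * ((q * n : ℕ) : ℤ) ≤ K := by push_cast; rw [← mul_assoc]; omega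
      have h4 := Nat.le_mul_of_pos_left n (show 0 < q by have := hroom.two_le; omega)
      split_ifs <;> omega
    rw [hstep, if_pos rfl, abs_le] at hb'
    refine ATri.wp ?_ (by simp [AProg.time, AExpr.cost])
    simp only [AProg.wp, AExpr.Safe, AExpr.eval, Op.apply, true_and, and_true, h44, h41, h7, hpos,
      Int.toNat_natCast, hc _ hNk, e1]
    refine ⟨by omega, by omega, by omega, hb', hM.setArr (by simp) _ _, fun t ht => ?_⟩
    rw [Mem.setArr_arr, if_pos rfl, Function.update_apply, hstep]
    split_ifs with h1 h2 h2
    · rw [h1]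
    · exact absurd h1.symm h2
    · exact absurd h2.symm h1
    · rw [hc t ht, add_zero]
  · rintro R' M' h _ _
    exact h

/-- Division with rounding towards `0`. -/
def truncatedDiv (x : ℤ) (q : ℕ) : ℤ := if x < 0 then 0 - (0 - x) / q else x / q

theorem abs_sub_truncatedDiv (hq : 2 ≤ q) (x : ℤ) : |x - q * truncatedDiv x q| ≤ q - 1 := by
  have hq' : (0 : ℤ) < q := by omega
  rw [abs_le]
  unfold truncatedDiv
  split_ifs
  · have h1 := Int.emod_add_mul_ediv (0 - x) q
    have h2 := Int.emod_nonneg (0 - x) hq'.ne'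
    have h3 := Int.emod_lt_of_pos (0 - x) hq'
    rw [mul_sub, mul_zero]
    omega
  · have h1 := Int.emod_add_mul_ediv x q
    have h2 := Int.emod_nonneg x hq'.ne'
    have h3 := Int.emod_lt_of_pos x hq'
    omega

/-- This is the reason for rounding towards 0: floor division would turn a small negative
coefficient into the carry -1 and break the bound A / q. -/
theorem abs_truncatedDiv_le (hq : 2 ≤ q) {x : ℤ} {A : ℕ} (hx : |x| ≤ A) : |truncatedDiv x q| ≤
    (A / q : ℕ) := by
  rw [abs_le] at hx
  have hq' : (0 : ℤ) < q := by omega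
  have key : ∀ y : ℤ, 0 ≤ y → y ≤ A → 0 ≤ y / q ∧ y / q ≤ (A / q : ℕ) := fun y h0 hy =>
    ⟨Int.ediv_nonneg h0 hq'.le, by push_cast; exact Int.ediv_le_ediv hq' hy⟩
  rw [abs_le]
  unfold truncatedDiv
  split_ifs
  · have := key (0 - x) (by omega) (by omega); omega
  · have := key x (by omega) (by omega); omega

/-- By `hcap`, coefficient plus incoming carry stays below `Acc`, so the outgoing carry is at most
Acc / q. By `hchain` it vanishes where the next power of q has no node, and in particular at the
top. The cruder `hbound` only serves the word size. -/
theorem carry_spec (hroom : Room q n m K) (h38 : R 38 = N) {C : ℕ → ℤ}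
    (hC : ∀ t < N, M.arr 9 t = C t) (hbound : ∀ t < N, |C t| ≤ (q * n + n : ℕ))
    (hcap : ∀ t < N, |C t| + (if t = 0 then 0 else if E t = E (t - 1) + 1 then Acc (t - 1) / q
      else 0 : ℕ) ≤ Acc t)
    (hchain : ∀ t < N, (t + 1 < N → E (t + 1) ≠ E t + 1) → Acc t < q) :
    ATri K W (carry q) R M (100 * N + 20) (fun _ M' => M.AgreeOff [9, 10] M' ∧
      (∀ t < N, M'.arr 9 t = 0) ∧ (∀ t < N, |M'.arr 10 t| ≤ q - 1) ∧
      ∑ t ∈ Finset.range N, M'.arr 10 t * (q : ℤ) ^ E t =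
        ∑ t ∈ Finset.range N, C t * (q : ℤ) ^ E t) := by
  have hbasic := hroom.basic
  have hq := hroom.two_le
  have hn := hroom.one_le
  have hK : 2 * (q * n + n : ℕ) + (q : ℤ) ≤ K := by
    have h1 : 3 * ((q * n : ℕ) : ℤ) + q ≤ K := by push_cast; rw [← mul_assoc]; omega
    have h2 := Nat.mul_le_mul_right n hq
    omega
  obtain ⟨B, hB⟩ : ∃ B, q * n + n = B := ⟨_, rfl⟩
  rw [hB] at hK
  simp only [hB] at hbound
  refine ATri.wp_seq (T₂ := 100 * N + 10) ?_ (by simp [AProg.time, AExpr.cost]; omega)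
  simp only [AProg.wp, AExpr.Safe, AExpr.eval, true_and]
  refine ⟨by omega, by omega, ?_⟩
  -- The pending carry `κ` has weight q ^ (E (k - 1) + 1), whether or not a node with this exponent
  -- exists. For `k = 0` the index `k - 1` is a dummy, and `κ = 0`.
  refine ATri.forUp (a := 0) (b := N) (T₁ := 80) (by decide) (by simp [AProg.writes])
    (by simp [AProg.writes]) (by simp) (by simp [h38]) (by omega)
    (fun k R' M' => M.AgreeOff [9, 10] M' ∧ ∃ κ : ℤ, R' 46 = κ ∧ |κ| ≤ B ∧ (κ = 0 ∨ 1 ≤ k) ∧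
      (1 ≤ k → |κ| ≤ (Acc (k - 1) / q : ℕ)) ∧ (∀ t < k, M'.arr 9 t = 0) ∧
      (∀ t, k ≤ t → t < N → M'.arr 9 t = C t) ∧ (∀ t < k, |M'.arr 10 t| ≤ q - 1) ∧
      ∑ t ∈ Finset.range k, M'.arr 10 t * (q : ℤ) ^ E t + κ * (q : ℤ) ^ (E (k - 1) + 1) =
        ∑ t ∈ Finset.range k, C t * (q : ℤ) ^ E t) ?_ ?_ (by omega) ?_
  · exact ⟨.refl _ _, 0, by simp, by simp, .inl rfl, by simp, by simp,
      fun t _ ht => hC t ht, by simp, by simp⟩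
  · rintro k R' M' _ hk h45 _ hfr ⟨hM, κ, h46, hκB, hκ0, hκ, h9, h9', h10, hsum⟩
    have hCk := h9' k le_rfl hk
    -- If the chain breaks below `k`, then Acc (k - 1) < q, so the incoming carry has absolute value
    -- at most 0.
    have hgap : k ≠ 0 → E k ≠ E (k - 1) + 1 → κ = 0 := by
      intro h0 hE
      have h1 := hchain (k - 1) (by omega) fun _ => by rwa [Nat.sub_add_cancel (by omega)]
      have h2 := hκ (by omega)
      rw [Nat.div_eq_of_lt h1] at h2
      exact abs_nonpos_iff.1 (by exact_mod_cast h2)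
    have hx : |C k + κ| ≤ Acc k := by
      refine (abs_add_le _ _).trans (le_trans (add_le_add_right ?_ _) (hcap k hk))
      split_ifs with h0 hE
      · simp [hκ0.resolve_right (by omega)]
      · exact hκ (by omega)
      · simp [hgap h0 hE]
    have hxB : |C k + κ| ≤ (2 * B : ℕ) := by
      have := hbound k hk
      have := abs_add_le (C k) κ
      push_cast; omega
    have hdB : |truncatedDiv (C k + κ) q| ≤ B := by
      refine (abs_truncatedDiv_le hq hxB).trans ?_
      have : 2 * B / q ≤ B := Nat.div_le_of_le_mul (Nat.mul_le_mul_right _ hq)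
      exact_mod_cast this
    have hdig := abs_sub_truncatedDiv hq (C k + κ)
    have hκE : κ * (q : ℤ) ^ (E (k - 1) + 1) = κ * (q : ℤ) ^ E k := by
      by_cases h0 : k = 0
      · simp [hκ0.resolve_right (by omega)]
      · by_cases hE : E k = E (k - 1) + 1
        · rw [hE]
        · simp [hgap h0 hE]
    rw [hκE] at hsum
    obtain ⟨M₁, hM₁⟩ : ∃ M₁, M₁ = (M'.setArr 10 k (C k + κ - q * truncatedDiv (C k + κ) q)).setArr
      9 k 0 := ⟨_, rfl⟩
    have hpost : M.AgreeOff [9, 10] M₁ :=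
      hM₁ ▸ (hM.setArr (by simp) _ _).setArr (by simp) _ _
    have hfin : ∃ κ' : ℤ, truncatedDiv (C k + κ) q = κ' ∧ |κ'| ≤ B ∧ (κ' = 0 ∨ 1 ≤ k + 1) ∧
        (1 ≤ k + 1 → |κ'| ≤ (Acc (k + 1 - 1) / q : ℕ)) ∧
        (∀ t < k + 1, M₁.arr 9 t = 0) ∧ (∀ t, k + 1 ≤ t → t < N → M₁.arr 9 t = C t) ∧
        (∀ t < k + 1, |M₁.arr 10 t| ≤ q - 1) ∧ ∑ t ∈ Finset.range (k + 1), M₁.arr 10 t *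
          (q : ℤ) ^ E t + κ' * (q : ℤ) ^ (E (k + 1 - 1) + 1) =
          ∑ t ∈ Finset.range (k + 1), C t * (q : ℤ) ^ E t := by
      simp only [hM₁, Mem.setArr_arr, if_true, if_neg (by decide : ¬ (9 : Fin 16) = 10),
        if_neg (by decide : ¬ (10 : Fin 16) = 9)]
      refine ⟨_, rfl, hdB, .inr (by omega), fun _ => abs_truncatedDiv_le hq hx, fun t ht => ?_,
        fun t ht htN => ?_, fun t ht => ?_, ?_⟩
      · rw [Function.update_apply]
        split_ifs with h
        · rfl
        · exact h9 t (by omega)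
      · rw [Function.update_of_ne (by omega)]
        exact h9' t (by omega) htN
      · rw [Function.update_apply]
        split_ifs with h
        · exact hdig
        · exact h10 t (by omega)
      · rw [Finset.sum_range_succ, Finset.sum_range_succ, ← hsum, Function.update_self,
          Finset.sum_congr rfl fun t ht => by
            rw [Function.update_of_ne (Finset.mem_range.1 ht).ne], Nat.add_sub_cancel]
        ring
    rw [abs_le] at hdB hdig hxB
    refine ATri.wp ?_ (by simp [AProg.time, AExpr.cost, AExpr.sub_def, AExpr.div_def])
    simp only [AProg.wp, AExpr.sub_def, AExpr.div_def, AExpr.Safe, AExpr.eval, Op.apply, true_and,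
      and_true, Function.update_apply, Nat.reduceEqDiff, if_true, if_false, h45, h46, hCk,
      Int.toNat_natCast]
    refine ⟨by omega, by omega, fun h => ?_, fun h => ?_⟩
    · have hlt : C k + κ < 0 := by by_contra h'; exact h (if_neg h')
      have hdiv : 0 - (0 - (C k + κ)) / (q : ℤ) = truncatedDiv (C k + κ) q := (if_pos hlt).symm
      rw [hdiv, ← hM₁]
      exact ⟨by omega, by omega, by omega, by omega, by omega, hpost, hfin⟩
    · have hge : ¬ C k + κ < 0 := fun h' => one_ne_zero ((if_pos h').symm.trans h)
      have hdiv : (C k + κ) / (q : ℤ) = truncatedDiv (C k + κ) q := (if_neg hge).symm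
      rw [hdiv, ← hM₁]
      exact ⟨by omega, by omega, by omega, by omega, by omega, hpost, hfin⟩
  · rintro R' M' ⟨hM, κ, -, -, hκ0, hκ, h9, -, h10, hsum⟩ _ _
    have : κ = 0 := by
      by_cases h0 : N = 0
      · exact hκ0.resolve_right (by omega)
      · have h1 := hchain (N - 1) (by omega) (by omega)
        have h2 := hκ (by omega)
        rw [Nat.div_eq_of_lt h1] at h2
        exact abs_nonpos_iff.1 (by exact_mod_cast h2)
    rw [this, zero_mul, add_zero] at hsum
    exact ⟨hM, h9, h10, hsum⟩

end ArrayMachine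

/-! ### The rows of the output -/

namespace ArrayMachine

open RAM

variable {q n m N : ℕ} {K W : ℤ} {R : ℕ → ℤ} {M : Mem} {P : ℕ → ℤ} {ex E idx Acc : ℕ → ℕ}

/-- The digits `f` form a marking with value `V` of nodes with exponents `E`, and there is no digit
`1` directly above a negative digit. -/
structure IsRow (q N : ℕ) (E : ℕ → ℕ) (f : ℕ → ℤ) (V : ℤ) : Prop where
  digit : ∀ t < N, |f t| ≤ q - 1
  sum : ∑ t ∈ Finset.range N, f t * (q : ℤ) ^ E t = V
  normal : ∀ t, t + 1 < N → E (t + 1) = E t + 1 → f (t + 1) = 1 → 0 ≤ f t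

theorem sum_update_mul (D g : ℕ → ℤ) {w : ℕ} (hw : w < N) (y : ℤ) :
    ∑ t ∈ Finset.range N, Function.update D w y t * g t =
      ∑ t ∈ Finset.range N, D t * g t + (y - D w) * g w := by
  have : ∀ t, Function.update D w y t * g t = D t * g t + if t = w then (y - D w) * g w else 0 := by
    intro t
    rw [Function.update_apply]
    split_ifs with h
    · rw [h]; ring
    · rw [add_zero]
  rw [Finset.sum_congr rfl fun t _ => this t, Finset.sum_add_distrib,
    Finset.sum_ite_eq' (Finset.range N) w, if_pos (Finset.mem_range.2 hw)]

/-- The replacement rests on q ^ (e + 1) + d q ^ e = (d + q) q ^ e. For a digit d < 0 the new digits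
are 0 and d + q > 0, so no bad pattern appears above. A new digit 1 may be bad with the digit below
it, which the downward scan meets next. -/
theorem normalize_spec (hroom : Room q n m K) (hR : Base q n m R) (h38 : R 38 = N) (hN : 1 ≤ N)
    (hN2 : N ≤ 2 * n) (hbit : ∀ t, t + 1 < N →
      M.pos (offset n m + stride n + t) = if E (t + 1) = E t + 1 then 1 else 0)
    {a : ℕ} (h43 : R 43 = a) (ha : offset n m + 2 * stride n ≤ a) (haK : (a : ℤ) + N ≤ K)
    (hdig : ∀ t < N, |M.arr 10 t| ≤ q - 1) {V : ℤ}
    (hsum : ∑ t ∈ Finset.range N, M.arr 10 t * (q : ℤ) ^ E t = V) :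
    ATri K W (normalize q) R M (100 * N + 50) (fun _ M' => M'.arr = M.arr ∧
      (∀ b, b < a ∨ a + N ≤ b → M'.pos b = M.pos b) ∧ IsRow q N E (fun t => M'.pos (a + t)) V) := by
  have hbasic := hroom.basic
  have hconst := hroom.const_le
  have hq := hroom.two_le
  have h8 := hR.r8
  have h9 := hR.r9
  have hst : stride n = 2 * n + 2 := rfl
  refine ATri.wp_seq (T₂ := 100 * N + 30) ?_
    (by simp [AProg.time, AExpr.cost, AExpr.sub_def]; omega)
  have e1 : (N : ℤ) - 1 = (N - 1 : ℕ) := by omega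
  have hd := abs_le.1 (hdig (N - 1) (by omega))
  simp only [AProg.wp, AExpr.sub_def, AExpr.Safe, AExpr.eval, Op.apply, true_and, and_true, h38, e1,
    Int.toNat_natCast]
  refine ⟨by omega, by omega, by omega, ?_⟩
  refine ATri.seq (T₁ := 100 * N + 10) (T₂ := 10) (Q' := fun R' M' => R' 43 = a ∧ M'.arr = M.arr ∧
    ∃ D : ℕ → ℤ, R' 48 = D 0 ∧ (∀ t < N, |D t| ≤ q - 1) ∧
      ∑ t ∈ Finset.range N, D t * (q : ℤ) ^ E t = V ∧
      (∀ t, 1 ≤ t → t < N → M'.pos (a + t) = D t) ∧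
      (∀ b, b < a ∨ a + N ≤ b → M'.pos b = M.pos b) ∧
      (∀ t, t + 1 < N → E (t + 1) = E t + 1 → D (t + 1) = 1 → 0 ≤ D t)) ?_ ?_ (by omega)
  -- `D` is the current digit sequence: already written above position N - k, held in register 48 at
  -- this position, and still in array 10 below it.
  · refine ATri.forUp (a := 1) (b := N) (T₁ := 90) (by decide) (by simp [AProg.writes])
      (by simp [AProg.writes]) (by simp) (by simp [h38]) (by omega)
      (fun k R' M' => M'.arr = M.arr ∧
        ∃ D : ℕ → ℤ, R' 48 = D (N - k) ∧ (∀ t < N, |D t| ≤ q - 1) ∧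
        ∑ t ∈ Finset.range N, D t * (q : ℤ) ^ E t = V ∧
        (∀ t < N - k, D t = M.arr 10 t) ∧
        (∀ t, N - k < t → t < N → M'.pos (a + t) = D t) ∧
        (∀ b, b < a ∨ a + N ≤ b → M'.pos b = M.pos b) ∧
        (∀ t, N - k ≤ t → t + 1 < N → E (t + 1) = E t + 1 → D (t + 1) = 1 → 0 ≤ D t)) ?_ ?_
      (by omega) ?_
    · exact ⟨rfl, M.arr 10, by simp, hdig, hsum, fun _ _ => rfl, by omega, fun _ _ => rfl, by omega⟩
    · rintro k R' M' hk1 hk h45 h38' hfr ⟨hM, D, h48, hD, hsum, hD10, hpos, hoff, hnorm⟩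
      have hbase : ∀ x < 12, x ∉ AProg.writes (50 ::= r 38 - r 45 ;; 49 ::= .arr 10 (r 50 - 1) ;;
          .cond (.eq (r 48) 1 * .pos (r 9 + r 8 + (r 50 - 1)) * .lt (r 49) 0)
            (48 ::= 0 ;; 49 ::= r 49 + .const q) .skip ;;
          .storePos (r 43 + r 50) (r 48) ;; 48 ::= r 49) ∧ x ≠ 45 := by
        intro x hx; simp [AProg.writes]; omega
      have hR' := hR.frame (R' := R') fun x hx => by
        rw [hfr x (hbase x hx).1 (hbase x hx).2, Function.update_of_ne (by omega),
          Function.update_of_ne (by omega)]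
      have h43' : R' 43 = a := by
        rw [hfr 43 (by simp [AProg.writes]) (by decide)]; simp [h43]
      obtain ⟨w, hw⟩ : ∃ w, N - k = w + 1 := ⟨N - k - 1, by omega⟩
      have hw' : N - (k + 1) = w := by omega
      have e2 : (N : ℤ) - k = (w + 1 : ℕ) := by omega
      have e3 : ((w + 1 : ℕ) : ℤ) - 1 = w := by omega
      have e4 : ((offset n m : ℤ) + stride n + w).toNat = offset n m + stride n + w := by norm_cast
      have e5 : ((a : ℤ) + (w + 1 : ℕ)).toNat = a + (w + 1) := by norm_cast
      have hbitw := (hoff (offset n m + stride n + w) (by omega)).trans (hbit w (by omega))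
      have hDw := abs_le.1 (hD w (by omega))
      have hDw1 := abs_le.1 (hD (w + 1) (by omega))
      have h10 : M'.arr 10 w = D w := by rw [hM]; exact (hD10 w (by omega)).symm
      rw [hw] at h48 hD10 hpos hnorm
      refine ATri.wp ?_ (by simp [AProg.time, AExpr.cost])
      simp only [AProg.wp, AExpr.Safe, AExpr.eval, Op.apply, true_and, and_true,
        Function.update_apply, Nat.reduceEqDiff, if_true, if_false, h38', h45, h43', h48, hR'.r8,
        hR'.r9, e2, e3, e4, e5, Int.toNat_natCast, h10, hbitw]
      have hpush : ∀ (D' : ℕ → ℤ), (∀ t, t ≠ w → t ≠ w + 1 → D' t = D t) →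
          (∀ t, w + 1 < t → t < N → (M'.setPos (a + (w + 1)) (D' (w + 1))).pos (a + t) = D' t) :=
        fun D' hD' t ht htN => by
          rw [Mem.setPos_pos, Function.update_of_ne (by omega), hD' t (by omega) (by omega)]
          exact hpos t ht htN
      have hpush' : ∀ (D' : ℕ → ℤ), (∀ t, t ≠ w → t ≠ w + 1 → D' t = D t) →
          (∀ t, w < t → t < N → (M'.setPos (a + (w + 1)) (D' (w + 1))).pos (a + t) = D' t) :=
        fun D' hD' t ht htN => by
          obtain rfl | h := eq_or_lt_of_le (Nat.succ_le_of_lt ht)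
          · simp
          · exact hpush D' hD' t h htN
      have hoff' : ∀ y b, b < a ∨ a + N ≤ b → (M'.setPos (a + (w + 1)) y).pos b = M.pos b :=
        fun y b hb => by
          rw [Mem.setPos_pos, Function.update_of_ne (by omega)]; exact hoff b hb
      refine ⟨by omega, by omega, by omega, by omega, fun h => ?_, fun h => ?_⟩
      · have h1 : D (w + 1) = 1 := by by_contra h'; simp [h'] at h
        have h2 : E (w + 1) = E w + 1 := by by_contra h'; simp [h'] at h
        have h3 : D w < 0 := by by_contra h'; simp [h'] at h
        -- The pattern 1, d at positions w + 1, w becomes 0, d + q.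
        refine ⟨by omega, by omega, by omega, by omega, by omega, hM,
          Function.update (Function.update D (w + 1) 0) w (D w + q), ?_, fun t ht => ?_, ?_,
          fun t ht => ?_, ?_, hoff' _, fun t ht htN hE => ?_⟩
        · rw [hw', Function.update_self]
        · rw [Function.update_apply, Function.update_apply]
          split_ifs
          · rw [abs_le]; omega
          · rw [abs_zero]; omega
          · exact hD t ht
        · rw [sum_update_mul _ _ (by omega), sum_update_mul _ _ (by omega), hsum,
            Function.update_of_ne (by omega), h1, h2]
          ring
        · rw [Function.update_of_ne (by omega), Function.update_of_ne (by omega)]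
          exact hD10 t (by omega)
        · rw [hw']
          have := hpush' (Function.update (Function.update D (w + 1) 0) w (D w + q))
            fun t h h' => by rw [Function.update_of_ne h, Function.update_of_ne h']
          rwa [Function.update_of_ne (by omega), Function.update_self] at this
        · rw [hw'] at ht
          obtain rfl | hlt := eq_or_lt_of_le ht
          · rw [Function.update_of_ne (by omega), Function.update_self]
            intro h; omega
          · rw [Function.update_of_ne (by omega), Function.update_of_ne (by omega),
              Function.update_of_ne (by omega)]
            obtain rfl | hlt' := eq_or_lt_of_le (Nat.succ_le_of_lt hlt)
            · intro _
              rw [Function.update_self]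
            · rw [Function.update_of_ne (by omega)]
              exact hnorm t (by omega) htN hE
      · have hnot : E (w + 1) = E w + 1 → D (w + 1) = 1 → 0 ≤ D w := by
          intro h2 h1
          by_contra h3
          rw [if_pos h1, if_pos h2, if_pos (by omega)] at h
          simp at h
        refine ⟨by omega, by omega, by omega, hM, D, by rw [hw'], hD, hsum,
          fun t ht => hD10 t (by omega), ?_, hoff' _, fun t ht htN hE => ?_⟩
        · rw [hw']
          exact hpush' D fun _ _ _ => rfl
        · rw [hw'] at ht
          obtain rfl | hlt := eq_or_lt_of_le ht
          · exact hnot hE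
          · exact hnorm t (by omega) htN hE
    · rintro R' M' ⟨hM, D, h48, hD, hsum, -, hpos, hoff, hnorm⟩ _ hfr
      rw [Nat.sub_self] at h48 hpos hnorm
      refine ⟨?_, hM, D, h48, hD, hsum, fun t ht => hpos t ht, hoff, fun t => hnorm t (by omega)⟩
      rw [hfr 43 (by simp [AProg.writes]) (by decide)]; simp [h43]
  · rintro R' M' ⟨h43', hM, D, h48, hD, hsum, hpos, hoff, hnorm⟩
    have hD0 := abs_le.1 (hD 0 (by omega))
    refine ATri.wp ?_ (by simp [AProg.time, AExpr.cost])
    simp only [AProg.wp, AExpr.Safe, AExpr.eval, true_and, h43', h48, Int.toNat_natCast]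
    have hval : ∀ t < N, (M'.setPos a (D 0)).pos (a + t) = D t := fun t ht => by
      rw [Mem.setPos_pos, Function.update_apply]
      split_ifs with h
      · rw [show t = 0 by omega]
      · exact hpos t (by omega) ht
    refine ⟨by omega, by omega, hM, fun b hb => ?_, fun t ht => ?_, ?_, fun t ht hE => ?_⟩
    · rw [Mem.setPos_pos, Function.update_of_ne (by omega)]
      exact hoff b hb
    · rw [hval t ht]; exact hD t ht
    · rw [← hsum]
      exact Finset.sum_congr rfl fun t ht => by rw [hval t (Finset.mem_range.1 ht)]
    · rw [hval t (by omega), hval (t + 1) ht]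
      exact hnorm t ht hE

theorem NewNodes.congr (h : NewNodes q n m N ex M E idx Acc) {M' : Mem}
    (hpos : ∀ b, offset n m ≤ b → b < offset n m + 2 * stride n → M'.pos b = M.pos b)
    (h5 : M'.arr 5 = M.arr 5) (h6 : M'.arr 6 = M.arr 6) (h7 : M'.arr 7 = M.arr 7) :
    NewNodes q n m N ex M' E idx Acc := by
  have hle := h.le
  have hst : stride n = 2 * n + 2 := rfl
  refine ⟨h.one_le, h.le, h.zero, h.mono, fun v hv => ?_, h.capacity, h.chain, fun t ht => ?_,
    fun t ht => ?_, fun t ht => ?_⟩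
  · rw [h7]; exact h.index v hv
  · rw [h5, h6]; exact h.node t ht
  · rw [hpos _ (by omega) (by omega)]; exact h.list t ht
  · rw [hpos _ (by omega) (by omega)]; exact h.bit t ht

/-- The address of row `k` of the output. -/
def rowAddress (n m k : ℕ) : ℕ := offset n m + 2 * stride n + stride n * k

theorem Room.rowAddress_le (h : Room q n m K) (hN : N ≤ 2 * n) {k : ℕ} (hk : k < N + m) :
    (rowAddress n m k : ℤ) + stride n ≤ K := by
  refine le_trans ?_ h.address_le
  unfold rowAddress
  have : stride n * (k + 3) ≤ stride n * (2 * n + m + 4) := Nat.mul_le_mul_left _ (by omega)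
  push_cast
  have : (stride n : ℤ) * (k + 3) ≤ stride n * (2 * n + m + 4) := by exact_mod_cast this
  rw [mul_add] at this
  omega

/-- The part of `writeRow` behind the computation of the addresses. -/
theorem rewrite_spec (hroom : Room q n m K) (hR : Base q n m R)
    (h : NewNodes q n m N ex M E idx Acc) (h38 : R 38 = N) {a o b : ℕ} (h41 : R 41 = a)
    (h42 : R 42 = o) (h43 : R 43 = b) (hon : o ≤ n) (haK : (a : ℤ) + n ≤ K)
    (hb : offset n m + 2 * stride n ≤ b) (hbK : (b : ℤ) + N ≤ K)
    (hzero : ∀ t < N, M.arr 9 t = 0) (hdig : ∀ v < n, |M.pos (a + v)| ≤ q - 1) :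
    ATri K W (scatter ;; carry q ;; normalize q) R M (50 * n + 200 * N + 100)
      (fun _ M' => (∀ k : Fin 16, k ≠ 9 → k ≠ 10 → M'.arr k = M.arr k) ∧
        (∀ t < N, M'.arr 9 t = 0) ∧ (∀ c, c < b ∨ b + N ≤ c → M'.pos c = M.pos c) ∧
        IsRow q N E (fun t => M'.pos (b + t)) (rowValue q n M.pos ex a + o)) := by
  have hq := hroom.two_le
  have hdig' : ∀ v < n, |M.pos (a + v)| ≤ q := fun v hv => (hdig v hv).trans (by omega)
  have hdig'' : ∀ v < n, |M.pos (a + v)| ≤ (q - 1 : ℕ) := fun v hv =>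
    (hdig v hv).trans (by omega)
  have hbase : ∀ x < 45, x ∉ scatter.writes ∨ x = 44 := by decide
  refine ATri.seq (T₁ := 50 * n + 30) (T₂ := 200 * N + 70) (scatter_spec hroom hR.r0 h41 h42 hon haK
    (fun v hv => ⟨(h.index v hv).1, (h.index v hv).2.2⟩) hzero hdig').frame ?_ (by omega)
  rintro R₁ M₁ ⟨⟨hM₁, hC⟩, hfr₁⟩
  refine ATri.seq (T₁ := 100 * N + 20) (T₂ := 100 * N + 50) (carry_spec (E := E) (Acc := Acc) hroom
    ((hfr₁ 38 (by decide)).trans h38) hC (fun t _ => abs_coefficient_le' hon t hdig')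
    (fun t ht => ?_) h.chain).frame ?_ (by omega)
  · refine le_trans (add_le_add_left (abs_coefficient_le (b := n) hon t hdig'') _) ?_
    have := h.capacity t ht
    norm_cast
    split_ifs at this ⊢ <;> omega
  · rintro R₂ M₂ ⟨⟨hM₂, h9, h10, hsum⟩, hfr₂⟩
    have hfr : ∀ x, x < 44 → R₂ x = R x := fun x hx =>
      (hfr₂ x (by simp [carry, forUp, AProg.writes]; omega)).trans
        (hfr₁ x ((hbase x (by omega)).resolve_right (by omega)))
    have hpos : M₂.pos = M.pos := hM₂.1.trans hM₁.1
    refine (normalize_spec (E := E) hroom (hR.frame fun x hx => hfr x (by omega))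
      ((hfr 38 (by omega)).trans h38) h.one_le h.le (fun t ht => ?_)
      ((hfr 43 (by omega)).trans h43) hb hbK h10 hsum).mono le_rfl ?_
    · rw [hpos]; exact h.bit t ht
    · rintro R₃ M₃ ⟨hM₃, hoff, hrow⟩
      refine ⟨fun k hk9 hk10 => ?_, fun t ht => by rw [hM₃]; exact h9 t ht,
        fun c hc => by rw [hoff c hc, hpos], ?_⟩
      · rw [hM₃, hM₂.2 k (by simp [hk9, hk10]), hM₁.2 k (by simp [hk9])]
      · rw [sum_coefficient h.one_le (fun v hv => (h.index v hv).1) fun t => (q : ℤ) ^ E t, h.zero,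
          pow_zero, mul_one, add_comm, Finset.sum_congr rfl fun v hv => by
            rw [(h.index v (Finset.mem_range.1 hv)).2.1]] at hrow
        exact hrow

/-- A new node at distance o above the old node u has exponent ex u + o, so its row is that of u
plus o times the node of value 1. Rows of input markings are the case o = 0. -/
theorem writeRow_spec (hroom : Room q n m K) (hR : Base q n m R)
    (h : NewNodes q n m N ex M E idx Acc) (h38 : R 38 = N) {k : ℕ} (h39 : R 39 = k)
    (hk : k < N + m) (hzero : ∀ t < N, M.arr 9 t = 0)
    (hdig : ∀ a < offset n m, |M.pos a| ≤ q - 1)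
    (hval : ∀ u < n, rowValue q n M.pos ex (n * u) = ex u) :
    ATri K W (writeRow q) R M (50 * n + 200 * N + 150)
      (fun _ M' => (∀ k : Fin 16, k ≠ 9 → k ≠ 10 → M'.arr k = M.arr k) ∧
        (∀ t < N, M'.arr 9 t = 0) ∧
        (∀ c, c < rowAddress n m k ∨ rowAddress n m k + N ≤ c → M'.pos c = M.pos c) ∧
        IsRow q N E (fun t => M'.pos (rowAddress n m k + t))
          (if k < N then (E k : ℤ) else rowValue q n M.pos ex (n * n + n * (k - N)))) := by
  have hbasic := hroom.basic
  have haddr := hroom.rowAddress_le h.le hk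
  have hoff := hroom.offset_le
  have hst : stride n = 2 * n + 2 := rfl
  have hle := h.le
  have e1 : (offset n m : ℤ) + 2 * stride n + stride n * k = (rowAddress n m k : ℕ) := by
    unfold rowAddress; push_cast; ring
  have ho : rowAddress n m k = offset n m + 2 * stride n + stride n * k := rfl
  have key : ∀ a o : ℕ, o ≤ n → a + n ≤ offset n m →
      (rowValue q n M.pos ex a + o =
        if k < N then (E k : ℤ) else rowValue q n M.pos ex (n * n + n * (k - N))) →
      ATri K W (scatter ;; carry q ;; normalize q)
        (Function.update (Function.update (Function.update R 41 (a : ℕ)) 42 (o : ℕ)) 43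
          (rowAddress n m k : ℕ)) M (50 * n + 200 * N + 100)
      (fun _ M' => (∀ k : Fin 16, k ≠ 9 → k ≠ 10 → M'.arr k = M.arr k) ∧
        (∀ t < N, M'.arr 9 t = 0) ∧
        (∀ c, c < rowAddress n m k ∨ rowAddress n m k + N ≤ c → M'.pos c = M.pos c) ∧
        IsRow q N E (fun t => M'.pos (rowAddress n m k + t))
          (if k < N then (E k : ℤ) else rowValue q n M.pos ex (n * n + n * (k - N)))) := by
    intro a o hon ha hV
    rw [← hV]
    refine rewrite_spec hroom (hR.frame fun x hx => ?_) h (by simpa using h38) (by simp) (by simp)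
      (by simp) hon (by omega) (by rw [ho]; exact Nat.le_add_right _ _) (by omega) hzero
      fun v hv => hdig _ (by omega)
    rw [Function.update_of_ne (by omega), Function.update_of_ne (by omega),
      Function.update_of_ne (by omega)]
  refine ATri.wp_seq (T₂ := 50 * n + 200 * N + 100) ?_
    (by simp [AProg.time, AExpr.cost, AExpr.sub_def]; omega)
  simp only [AProg.wp, AExpr.sub_def, AExpr.Safe, AExpr.eval, Op.apply, true_and, and_true, h38,
    h39,
    hR.r0, hR.r8, hR.r9, Function.update_apply, Nat.reduceEqDiff, if_false, Int.toNat_natCast, e1]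
  refine ⟨fun hc => ?_, fun hc => ?_⟩
  · have hkN : k < N := by by_contra h'; exact hc (if_neg (by omega))
    obtain ⟨u, hu, o, hon, h5, h6, hE⟩ := h.node k hkN
    have hrow := hroom.row_le hu
    have hun : n * u + n ≤ offset n m := by
      have : n * (u + 1) ≤ n * n := Nat.mul_le_mul_left _ hu
      unfold offset
      rw [mul_add] at this; omega
    rw [h5, h6, mul_toNat]
    refine ⟨by omega, by omega, by omega, by omega, by omega, key _ _ hon hun ?_⟩
    rw [if_pos hkN, hval u hu, hE]; push_cast; rfl
  · have hkN : ¬ k < N := fun h' => one_ne_zero ((if_pos (by omega)).symm.trans hc)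
    have e2 : (n : ℤ) * n + n * (k - N) = (n * n + n * (k - N) : ℕ) := by
      push_cast [Nat.cast_sub (not_lt.1 hkN)]; rfl
    have hun : n * n + n * (k - N) + n ≤ offset n m := by
      have : n * (k - N + 1) ≤ n * m := Nat.mul_le_mul_left _ (by omega)
      unfold offset
      rw [mul_add] at this; omega
    rw [e2]
    refine ⟨by omega, by omega, by omega, key _ 0 (by omega) hun ?_⟩
    rw [if_neg hkN]; simp

/-- Output rows are disjoint from each other and lie behind the input, the node list and the bit
vector, so everything read later is intact. Array 9 is zero again after each row. -/
theorem writeRows_spec (hroom : Room q n m K) (hR : Base q n m R)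
    (h : NewNodes q n m N ex M E idx Acc) (h38 : R 38 = N) (hzero : ∀ t < N, M.arr 9 t = 0)
    (hdig : ∀ a < offset n m, |M.pos a| ≤ q - 1)
    (hval : ∀ u < n, rowValue q n M.pos ex (n * u) = ex u) :
    ATri K W (writeRows q) R M ((N + m) * (50 * n + 200 * N + 160) + 30) (fun _ M' =>
      NewNodes q n m N ex M' E idx Acc ∧ ∀ k < N + m,
        IsRow q N E (fun t => M'.pos (rowAddress n m k + t))
          (if k < N then (E k : ℤ) else rowValue q n M.pos ex (n * n + n * (k - N)))) := by
  have hbasic := hroom.basic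
  have hle := h.le
  have hst : stride n = 2 * n + 2 := rfl
  have hmono : ∀ k k', k < k' → rowAddress n m k + stride n ≤ rowAddress n m k' := fun k k' hk => by
    have : stride n * (k + 1) ≤ stride n * k' := Nat.mul_le_mul_left _ hk
    unfold rowAddress
    rw [mul_add] at this; omega
  have hlow : ∀ k, offset n m + 2 * stride n ≤ rowAddress n m k := fun k => Nat.le_add_right _ _
  refine ATri.wp_seq (T₂ := (N + m) * (50 * n + 200 * N + 160) + 20) ?_
    (by simp [AProg.time, AExpr.cost]; omega)
  have e1 : (N : ℤ) + m = (N + m : ℕ) := by push_cast; rfl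
  simp only [AProg.wp, AExpr.Safe, AExpr.eval, Op.apply, true_and, and_true, h38, hR.r1, e1]
  refine ⟨by omega, by omega, ?_⟩
  have hbase : ∀ x, x < 12 ∨ x = 38 → x ∉ (writeRow q).writes ∧ x ≠ 39 := by
    intro x hx; simp [writeRow, scatter, carry, normalize, forUp, AProg.writes]; omega
  refine ATri.forUp (a := 0) (b := N + m) (T₁ := 50 * n + 200 * N + 150) (by decide)
    (by simp [writeRow, scatter, carry, normalize, forUp, AProg.writes])
    (by simp [writeRow, scatter, carry, normalize, forUp, AProg.writes]) (by simp) (by simp)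
    (by omega)
    (fun i _ M' => NewNodes q n m N ex M' E idx Acc ∧ (∀ t < N, M'.arr 9 t = 0) ∧
      (∀ a < offset n m, M'.pos a = M.pos a) ∧ ∀ k < i,
        IsRow q N E (fun t => M'.pos (rowAddress n m k + t))
          (if k < N then (E k : ℤ) else rowValue q n M.pos ex (n * n + n * (k - N)))) ?_ ?_
    (by rw [Nat.sub_zero]; nlinarith) ?_
  · exact ⟨h, hzero, fun _ _ => rfl, by simp⟩
  · rintro i R' M' _ hi h39 _ hfr ⟨hN, h9, hpos, hrows⟩
    have hfr' : ∀ x, x < 12 ∨ x = 38 → R' x = R x := fun x hx => by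
      rw [hfr x (hbase x hx).1 (hbase x hx).2, Function.update_of_ne (by omega),
        Function.update_of_ne (by omega)]
    have hrv : ∀ a, a + n ≤ offset n m → rowValue q n M'.pos ex a = rowValue q n M.pos ex a :=
      fun a ha => Finset.sum_congr rfl fun v hv => by
        rw [hpos _ (by have := Finset.mem_range.1 hv; omega)]
    refine (writeRow_spec hroom (hR.frame fun x hx => hfr' x (.inl hx)) hN
      ((hfr' 38 (.inr rfl)).trans h38) h39 hi h9 (fun a ha => by rw [hpos a ha]; exact hdig a ha)
      fun u hu => ?_).mono le_rfl ?_
    · rw [hrv, hval u hu]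
      have : n * (u + 1) ≤ n * n := Nat.mul_le_mul_left _ hu
      unfold offset
      rw [mul_add] at this; omega
    · rintro R'' M'' ⟨harr, h9', hpos', hrow⟩
      have hlowi := hlow i
      refine ⟨hN.congr (fun b _ hb => hpos' b (by omega)) (harr 5 (by decide) (by decide))
        (harr 6 (by decide) (by decide)) (harr 7 (by decide) (by decide)), h9',
        fun a ha => by rw [hpos' a (by omega), hpos a ha], fun k hk => ?_⟩
      obtain rfl | hlt := eq_or_lt_of_le (Nat.lt_succ_iff.1 hk)
      · have hV : (if k < N then (E k : ℤ) else rowValue q n M'.pos ex (n * n + n * (k - N))) =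
            if k < N then (E k : ℤ) else rowValue q n M.pos ex (n * n + n * (k - N)) := by
          split_ifs with hkN
          · rfl
          · refine hrv _ ?_
            have : n * (k - N + 1) ≤ n * m := Nat.mul_le_mul_left _ (by omega)
            unfold offset
            rw [mul_add] at this; omega
        rwa [hV] at hrow
      · have hsame : ∀ t < N, M''.pos (rowAddress n m k + t) = M'.pos (rowAddress n m k + t) :=
          fun t ht => hpos' _ (by have := hmono k i hlt; omega)
        have := hrows k hlt
        refine ⟨fun t ht => ?_, ?_, fun t ht => ?_⟩
        · rw [hsame t ht]; exact this.digit t ht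
        · rw [← this.sum]
          exact Finset.sum_congr rfl fun t ht => by rw [hsame t (Finset.mem_range.1 ht)]
        · rw [hsame t (by omega), hsame (t + 1) ht]; exact this.normal t ht
  · rintro R' M' ⟨hN, -, -, hrows⟩ _ _
    exact ⟨hN, hrows⟩

end ArrayMachine

/-! ### The whole program -/

namespace ArrayMachine

open RAM

variable {q n m N : ℕ} {K W : ℤ} {R : ℕ → ℤ} {M : Mem} {P : ℕ → ℤ} {ex E idx Acc : ℕ → ℕ}
  {good : ℕ → Prop}

/-- The registers and the memory hold the result. -/
structure Result (q n m : ℕ) (P : ℕ → ℤ) (ex : ℕ → ℕ) (N : ℕ) (E : ℕ → ℕ) (R : ℕ → ℤ)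
    (M : Mem) : Prop where
  le : N ≤ 2 * n
  mono : ∀ t, t + 1 < N → E t < E (t + 1)
  list : ∀ t < N, M.pos (offset n m + t) = t
  bit : ∀ t, t + 1 < N →
    M.pos (offset n m + stride n + t) = if E (t + 1) = E t + 1 then 1 else 0
  node : ∀ k < N, IsRow q N E (fun t => M.pos (rowAddress n m k + t)) (E k : ℤ)
  marking : ∀ i < m, IsRow q N E (fun t => M.pos (rowAddress n m (N + i) + t))
    (rowValue q n P ex (n * n + n * i))
  r1 : R 1 = N
  r2 : R 2 = rowAddress n m 0
  r3 : R 3 = stride n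
  r4 : R 4 = offset n m
  r5 : R 5 = (offset n m + stride n : ℕ)
  r6 : R 6 = rowAddress n m N
  r7 : R 7 = stride n

theorem time_le (hn : 1 ≤ n) (hN : N ≤ 2 * n) :
    60 * n ^ 2 + 60 * n + 60 + (100 * (gapBound q n + 1) + 60) +
      (n * ((Nat.log 2 n + 1) * (70 * n + 80) + 400 * n + 420) + 20) + (3 * n * 128 + 100) +
      ((N + m) * (50 * n + 200 * N + 160) + 30) + 200 ≤ softO (400 * q + 5000) 1
        (n ^ 2 + n * m) := by
  obtain ⟨x, hx⟩ : ∃ x, x = n ^ 2 + n * m := ⟨_, rfl⟩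
  rw [← hx, softO, pow_one]
  have h1 : n ≤ n ^ 2 := Nat.le_self_pow two_ne_zero n
  have h2 : m ≤ n * m := Nat.le_mul_of_pos_left m hn
  have hlog : Nat.log 2 n ≤ Nat.log 2 (x + 2) := Nat.log_mono_right (by omega)
  have hlog1 : 1 ≤ Nat.log 2 (x + 2) := Nat.le_log_of_pow_le (by norm_num) (by omega)
  obtain ⟨L, hL⟩ : ∃ L, L = Nat.log 2 (x + 2) := ⟨_, rfl⟩
  rw [← hL] at hlog hlog1 ⊢
  have h3 : n * ((Nat.log 2 n + 1) * (70 * n + 80)) ≤ 300 * (L * x) := by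
    calc n * ((Nat.log 2 n + 1) * (70 * n + 80)) ≤ n * ((L + L) * (150 * n)) :=
          Nat.mul_le_mul_left _ (Nat.mul_le_mul (by omega) (by omega))
      _ = 300 * (L * n ^ 2) := by ring
      _ ≤ 300 * (L * x) := Nat.mul_le_mul_left _ (Nat.mul_le_mul_left _ (by omega))
  have h4 : n * (400 * n + 420) ≤ 820 * x := by
    calc n * (400 * n + 420) ≤ n * (820 * n) := Nat.mul_le_mul_left _ (by omega)
      _ = 820 * n ^ 2 := by ring
      _ ≤ 820 * x := Nat.mul_le_mul_left _ (by omega)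
  have h5 : (N + m) * (50 * n + 200 * N + 160) ≤ 1220 * x := by
    calc (N + m) * (50 * n + 200 * N + 160) ≤ (2 * n + m) * (610 * n) :=
          Nat.mul_le_mul (by omega) (by omega)
      _ = 1220 * n ^ 2 + 610 * (n * m) := by ring
      _ ≤ 1220 * x := by omega
  have h6 : gapBound q n ≤ 4 * (q * (x + 1)) := by
    unfold gapBound
    calc 2 * q * (n + 1) = 2 * (q * (n + 1)) := by ring
      _ ≤ 2 * (q * (x + 1)) := Nat.mul_le_mul_left _ (Nat.mul_le_mul_left _ (by omega))
      _ ≤ 4 * (q * (x + 1)) := Nat.mul_le_mul_right _ (by norm_num)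
  have h7 : x + 1 ≤ L * (x + 1) := Nat.le_mul_of_pos_left _ hlog1
  have h8 : q * (x + 1) ≤ L * (q * (x + 1)) := Nat.le_mul_of_pos_left _ hlog1
  have h9 : (400 * q + 5000) * (x + 1) * L =
    400 * (L * (q * (x + 1))) + 5000 * (L * (x + 1)) := by ring
  have h10 : L * (x + 1) = L * x + L := by ring
  have h11 : n * ((Nat.log 2 n + 1) * (70 * n + 80) + 400 * n + 420) =
    n * ((Nat.log 2 n + 1) * (70 * n + 80)) + n * (400 * n + 420) := by ring
  rw [h9, h11]
  omega

theorem returnTables_spec (hroom : Room q n m K) (hR : Base q n m R) (h38 : R 38 = N)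
    (hN : NewNodes q n m N ex M E idx Acc)
    (hrows : ∀ k < N + m, IsRow q N E (fun t => M.pos (rowAddress n m k + t))
      (if k < N then (E k : ℤ) else rowValue q n P ex (n * n + n * (k - N)))) :
    ATri K W returnTables R M 60 (fun R' M' => R' 0 = 1 ∧ Result q n m P ex N E R' M') := by
  have hbasic := hroom.basic
  have hoff := hroom.offset_le
  have haddr := hroom.address_le
  have hle := hN.le
  have h1 : (stride n : ℤ) * 4 ≤ stride n * (2 * n + m + 4) :=
    mul_le_mul_of_nonneg_left (by omega) (by omega)
  have h2 : (stride n : ℤ) * (N + 4) ≤ stride n * (2 * n + m + 4) :=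
    mul_le_mul_of_nonneg_left (by omega) (by omega)
  have h3 : (0 : ℤ) ≤ stride n * N := by positivity
  rw [mul_add] at h2
  refine ATri.wp ?_ (by decide)
  simp only [returnTables, AProg.wp, AExpr.Safe, AExpr.eval, Op.apply, true_and, and_true,
    Function.update_apply, Nat.reduceEqDiff, if_false, h38, hR.r8, hR.r9]
  refine ⟨by omega, by omega, by omega, by omega, by omega, by omega, by omega, by omega, by simp,
    hle, hN.mono, hN.list, hN.bit, fun k hk => ?_, fun i hi => ?_, by simp, ?_, by simp, by simp,
    by simp, ?_, by simp⟩
  · have := hrows k (by omega)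
    rwa [if_pos hk] at this
  · have := hrows (N + i) (by omega)
    rwa [if_neg (by omega), Nat.add_sub_cancel_left] at this
  · simp [rowAddress]
  · simp [rowAddress]

theorem reduce_spec (hroom : Room q n m K) (h0 : R 0 = n) (h1 : R 1 = m)
    (hN : NodeSystem q n M.pos good ex) (hz : ∀ v < n, M.pos (offset n m + v) = 0)
    (hdig : ∀ a < offset n m, |M.pos a| ≤ q - 1) (h9 : ∀ t, M.arr 9 t = 0) :
    ATri K W (reduce q) R M (softO (400 * q + 5000) 1 (n ^ 2 + n * m)) (fun R' M' =>
      (R' 0 = 1 ∧ (∀ u < n, good u) ∧ ∃ N E, Result q n m M.pos ex N E R' M') ∨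
        (R' 0 = 0 ∧ ∃ u < n, ¬ good u)) := by
  have hbasic := hroom.basic
  have hn := hroom.one_le
  -- The number of new nodes is determined during the run; the time is budgeted for its maximum 2n.
  refine ATri.mono ?_ (time_le (N := 2 * n) hn le_rfl) fun _ _ => id
  obtain ⟨T₁, hT₁⟩ : ∃ T₁, T₁ = 60 * n ^ 2 + 60 * n + 60 := ⟨_, rfl⟩
  obtain ⟨T₂, hT₂⟩ : ∃ T₂, T₂ = 100 * (gapBound q n + 1) + 60 := ⟨_, rfl⟩
  obtain ⟨T₃, hT₃⟩ : ∃ T₃, T₃ = n * ((Nat.log 2 n + 1) * (70 * n + 80) + 400 * n + 420) + 20 :=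
    ⟨_, rfl⟩
  obtain ⟨T₄, hT₄⟩ : ∃ T₄, T₄ = 3 * n * 128 + 100 := ⟨_, rfl⟩
  obtain ⟨T₅, hT₅⟩ : ∃ T₅, T₅ = (2 * n + m) * (50 * n + 200 * (2 * n) + 160) + 30 := ⟨_, rfl⟩
  rw [← hT₁, ← hT₂, ← hT₃, ← hT₄, ← hT₅]
  refine ATri.cond (T₁ := T₁ + T₂ + T₃ + T₄ + T₅ + 100) ⟨trivial, trivial⟩ (fun _ => ?_)
    (fun h => ?_)
    (by simp [AExpr.cost]; omega)
  swap
  · exact absurd ((if_pos (by simp only [AExpr.eval]; omega)).symm.trans h) one_ne_zero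
  refine ATri.seq (T₁ := 30) (T₂ := T₁ + T₂ + T₃ + T₄ + T₅ + 70) (setup_spec hroom h0 h1) ?_
    (by omega)
  rintro R₁ M ⟨hR₁, rfl⟩
  refine ATri.seq (T₁ := T₁) (T₂ := T₂ + T₃ + T₄ + T₅ + 70)
    (hT₁ ▸ countDegrees_spec hroom hR₁).frame ?_ (by omega)
  rintro R₂ M₂ ⟨⟨hM₂, hdeg⟩, hfr₂⟩
  have hR₂ := hR₁.frame (R' := R₂) fun x hx => hfr₂ x (by
    have : ∀ x < 12, x ∉ countDegrees.writes := by decide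
    exact this x hx)
  refine ATri.seq (T₁ := T₂) (T₂ := T₃ + T₄ + T₅ + 70)
    (hT₂ ▸ powers_spec hroom hR₂).frame ?_ (by omega)
  rintro R₃ M₃ ⟨⟨hM₃, hpow⟩, hfr₃⟩
  have hR₃ := hR₂.frame (R' := R₃) fun x hx => hfr₃ x (by
    simp [powers, forUp, AProg.writes]; omega)
  have hpos₃ : M₃.pos = M.pos := hM₃.1.trans hM₂.1
  have hdeg₃ : ∀ u < n, M₃.arr 0 u = outDegree M₃.pos n ∅ u := fun u hu => by
    rw [hM₃.2 0 (by decide), hpos₃]; exact hdeg u hu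
  refine ATri.seq (T₁ := T₃) (T₂ := T₄ + T₅ + 70)
    (hT₃ ▸ sortNodes_spec hroom hR₃ (hpos₃.symm ▸ hN) (hpos₃.symm ▸ hz) hdeg₃
      hpow).frame ?_ (by omega)
  rintro R₄ M₄ ⟨⟨hM₄, h⟩, hfr₄⟩
  have hR₄ := hR₃.frame (R' := R₄) fun x hx => hfr₄ x (by
    have : ∀ x < 12, x ∉ sortNodes.writes := by decide
    exact this x hx)
  rw [hpos₃] at h
  refine ATri.cond (T₁ := T₄ + T₅ + 68) trivial (fun h12 => ?_) (fun h12 => ?_)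
    (by simp [AExpr.cost]; omega)
  · obtain ⟨-, σ, hS⟩ | ⟨h12', -⟩ := h
    swap
    · exact absurd h12' h12
    refine ATri.seq (T₁ := T₄) (T₂ := T₅ + 60) (hT₄ ▸ buildNodes_spec hroom hR₄ hN hS).frame ?_
      (by omega)
    rintro R₅ M₅ ⟨⟨N, E, idx, Acc, h38, hNN, hpos, harr⟩, hfr₅⟩
    have hR₅ := hR₄.frame (R' := R₅) fun x hx => hfr₅ x (by
      simp [buildNodes, buildStep, forUp, AProg.writes]; omega)
    have hpos₅ : ∀ a < offset n m, M₅.pos a = M.pos a := fun a ha => by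
      rw [hpos a (.inl ha), hM₄.1, hpos₃]
    have hrv : ∀ a, a + n ≤ offset n m → rowValue q n M₅.pos ex a = rowValue q n M.pos ex a :=
      fun a ha => Finset.sum_congr rfl fun v hv => by
        rw [hpos₅ _ (by have := Finset.mem_range.1 hv; omega)]
    have hle := hNN.le
    have hT₅' : (N + m) * (50 * n + 200 * N + 160) + 30 ≤ T₅ := by
      rw [hT₅]
      exact Nat.add_le_add_right (Nat.mul_le_mul (by omega) (by omega)) _
    refine ATri.seq (T₁ := T₅) (T₂ := 60) ((writeRows_spec hroom hR₅ hNN h38 (fun t _ => ?_)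
      (fun a ha => ?_) fun u hu => ?_).frame.mono hT₅' fun _ _ => id) ?_ (by omega)
    · rw [harr 9 (by decide) (by decide) (by decide), hM₄.2 9 (by decide), hM₃.2 9 (by decide),
        hM₂.2 9 (by decide), h9]
    · rw [hpos₅ a ha]; exact hdig a ha
    · obtain ⟨p, hp, rfl⟩ := hS.exists_eq hu
      rw [hrv, hS.rowValue_eq hN hp]
      have : n * (σ p + 1) ≤ n * n := Nat.mul_le_mul_left _ hu
      unfold offset
      rw [mul_add] at this; omega
    · rintro R₆ M₆ ⟨⟨hN₆, hrows⟩, hfr₆⟩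
      have hfr₆' : ∀ x, x < 12 ∨ x = 38 → R₆ x = R₅ x := fun x hx => hfr₆ x (by
        simp [writeRows, writeRow, scatter, carry, normalize, forUp, AProg.writes]; omega)
      refine (returnTables_spec (P := M.pos) hroom (hR₅.frame fun x hx => hfr₆' x (.inl hx))
        ((hfr₆' 38 (.inr rfl)).trans h38) hN₆ fun k hk => ?_).mono le_rfl fun R' M' h =>
          .inl ⟨h.1, fun u hu => ?_, N, E, h.2⟩
      · have := hrows k hk
        split_ifs at this ⊢ with hkN
        · exact this
        · rwa [hrv] at this
          have : n * (k - N + 1) ≤ n * m := Nat.mul_le_mul_left _ (by omega)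
          unfold offset
          rw [mul_add] at this; omega
      · obtain ⟨p, hp, rfl⟩ := hS.exists_eq hu
        exact hS.good p hp
  · obtain ⟨h12', -⟩ | ⟨-, hu⟩ := h
    · rw [show (r 12).eval R₄ M₄ = R₄ 12 from rfl, h12'] at h12
      exact absurd h12 one_ne_zero
    · refine ATri.wp ?_ (by simp [AProg.time, AExpr.cost])
      simp only [AProg.wp, AExpr.Safe, AExpr.eval, true_and]
      exact ⟨by omega, .inr ⟨by simp, hu⟩⟩

/-! ### Rows of reduced circuits -/

theorem strictMono_of_succ (hE : ∀ t, t + 1 < N → E t < E (t + 1)) {s t : ℕ} (hst : s < t)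
    (ht : t < N) : E s < E t := by
  induction t, hst using Nat.le_induction with
  | base => exact hE s ht
  | succ t _ ih => exact (ih (by omega)).trans (hE t ht)

/-- The top term is at most (q - 1) q ^ E N, and by induction the rest is below q ^ E N. -/
theorem abs_sum_lt (hq : 2 ≤ q) {f : ℕ → ℤ} (hf : ∀ t < N, |f t| ≤ q - 1)
    (hE : ∀ t, t + 1 < N → E t < E (t + 1)) {e : ℕ} (he : ∀ t < N, E t < e) :
    |∑ t ∈ Finset.range N, f t * (q : ℤ) ^ E t| < (q : ℤ) ^ e := by
  have hq0 : (0 : ℤ) < q := by omega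
  induction N generalizing e with
  | zero => simpa using pow_pos hq0 e
  | succ N ih =>
    have h1 := ih (fun t ht => hf t (by omega)) (fun t ht => hE t (by omega))
      (fun t ht => strictMono_of_succ hE ht (Nat.lt_succ_self N))
    have h2 : |f N * (q : ℤ) ^ E N| ≤ (q - 1) * (q : ℤ) ^ E N := by
      rw [abs_mul, abs_of_pos (pow_pos hq0 (E N))]
      exact mul_le_mul_of_nonneg_right (hf N (Nat.lt_succ_self N)) (pow_pos hq0 _).le
    have h3 : (q : ℤ) ^ (E N + 1) ≤ (q : ℤ) ^ e :=
      pow_le_pow_right₀ (by omega) (he N (Nat.lt_succ_self N))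
    rw [Finset.sum_range_succ]
    refine (abs_add_le _ _).trans_lt (lt_of_lt_of_le ?_ h3)
    rw [pow_succ]
    linarith

/-- If the next exponent is adjacent, normality makes its digit nonnegative, and only still smaller
exponents can pull the sum down. Otherwise all remaining exponents are already below E N - 1. Both
cases end with `abs_sum_lt`. -/
theorem IsRow.neg_lt_sum (hq : 2 ≤ q) {f : ℕ → ℤ} {V : ℤ} (h : IsRow q (N + 1) E f V)
    (hE : ∀ t, t + 1 < N + 1 → E t < E (t + 1)) (h1 : f N = 1) :
    -(q : ℤ) ^ (E N - 1) < ∑ t ∈ Finset.range N, f t * (q : ℤ) ^ E t := by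
  have hq0 : (0 : ℤ) < q := by omega
  obtain _ | N := N
  · simpa using pow_pos hq0 _
  by_cases hgap : E (N + 1) = E N + 1
  · have h2 := h.normal N (by omega) hgap h1
    have h3 := abs_lt.1 (abs_sum_lt (N := N) hq (fun t ht => h.digit t (by omega))
      (fun t ht => hE t (by omega)) fun t ht => strictMono_of_succ hE ht
        (show N < N + 1 + 1 by omega))
    rw [Finset.sum_range_succ, hgap, Nat.add_sub_cancel]
    have := mul_nonneg h2 (pow_pos hq0 (E N)).le
    linarith
  · refine (abs_lt.1 (abs_sum_lt hq (fun t ht => h.digit t (by omega)) (fun t ht => hE t (by omega))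
      fun t ht => ?_)).1
    have h2 := hE N (by omega)
    obtain rfl | hlt := eq_or_lt_of_le (Nat.lt_succ_iff.1 ht)
    · omega
    · have := strictMono_of_succ hE hlt (show N < N + 1 + 1 by omega)
      omega

/-- Let e be the largest exponent used. A negative leading digit would make V negative. A leading
digit at least 2 gives V > q ^ e > e. A leading 1 gives V > q ^ e - q ^ (e - 1) ≥ q ^ (e - 1) ≥ e;
without normality the sum could be as small as 1. -/
theorem IsRow.exponent_lt (hq : 2 ≤ q) {f : ℕ → ℤ} {V : ℕ} (h : IsRow q N E f V)
    (hE : ∀ t, t + 1 < N → E t < E (t + 1)) {s : ℕ} (hs : s < N) (hfs : f s ≠ 0) : E s < V := by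
  have hq0 : (0 : ℤ) < q := by omega
  induction N with
  | zero => omega
  | succ N ih =>
    by_cases h0 : f N = 0
    · obtain rfl | hlt := eq_or_lt_of_le (Nat.lt_succ_iff.1 hs)
      · exact absurd h0 hfs
      · refine ih ⟨fun t ht => h.digit t (by omega), ?_, fun t ht => h.normal t (by omega)⟩
          (fun t ht => hE t (by omega)) hlt
        have := h.sum
        rwa [Finset.sum_range_succ, h0, zero_mul, add_zero] at this
    · have hle : E s ≤ E N := by
        obtain rfl | hlt := eq_or_lt_of_le (Nat.lt_succ_iff.1 hs)
        · exact le_rfl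
        · exact (strictMono_of_succ hE hlt (Nat.lt_succ_self N)).le
      refine hle.trans_lt ?_
      have hsum := h.sum
      rw [Finset.sum_range_succ] at hsum
      have habs := abs_lt.1 (abs_sum_lt (N := N) hq (fun t ht => h.digit t (by omega))
        (fun t ht => hE t (by omega)) fun t ht => strictMono_of_succ hE ht (Nat.lt_succ_self N))
      have hpow : ∀ e : ℕ, (e : ℤ) < (q : ℤ) ^ e := fun e => by
        exact_mod_cast Nat.lt_pow_self (show 1 < q by omega)
      have hp := pow_pos hq0 (E N)
      zify
      rcases lt_trichotomy (f N) 1 with hlt | h1 | hgt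
      · have : f N * (q : ℤ) ^ E N ≤ (-1) * (q : ℤ) ^ E N :=
          mul_le_mul_of_nonneg_right (by omega) hp.le
        linarith
      · have hneg := h.neg_lt_sum hq hE h1
        rw [h1, one_mul] at hsum
        -- For exponent 0 the truncated subtraction gives the bound -1 for the rest, and V > 0
        -- follows directly.
        by_cases hE0 : E N = 0
        · rw [hE0, Nat.zero_sub, pow_zero] at hneg
          rw [hE0, pow_zero] at hsum
          rw [hE0]; push_cast; linarith
        · have h3 : (q : ℤ) ^ E N = q ^ (E N - 1) * q := by
            rw [← pow_succ, Nat.sub_add_cancel (by omega)]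
          have h4 : (q : ℤ) ^ (E N - 1) * 2 ≤ q ^ (E N - 1) * q :=
            mul_le_mul_of_nonneg_left (by omega) (pow_pos hq0 _).le
          have h5 := hpow (E N - 1)
          omega
      · have : 2 * (q : ℤ) ^ E N ≤ f N * (q : ℤ) ^ E N :=
          mul_le_mul_of_nonneg_right (by omega) hp.le
        have := hpow (E N)
        linarith

end ArrayMachine

/-! ### Circuits -/

namespace ArrayMachine

open RAM

variable {q n m N : ℕ} {K W : ℤ} {R : ℕ → ℤ} {M : Mem} {P : ℕ → ℤ} {ex E : ℕ → ℕ}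

/-- The value of node `u` is a natural power of `q`. -/
def GoodNode (G : Dag q (Fin n)) (u : ℕ) : Prop :=
  ∃ h : u < n, ∃ k : ℕ, G.nodeValue ⟨u, h⟩ = (q : ℝ) ^ k

/-- The exponent of node `u`. -/
noncomputable def exponent (G : Dag q (Fin n)) (u : ℕ) : ℕ :=
  if h : u < n then ⌊G.markingValue (G.succ ⟨u, h⟩)⌋₊ else 0

theorem goodNode_iff (hq : 2 ≤ q) (G : Dag q (Fin n)) (u : Fin n) :
    GoodNode G u ↔ ∃ k : ℕ, G.markingValue (G.succ u) = k := by
  have hq1 : (1 : ℝ) < q := by exact_mod_cast hq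
  have : GoodNode G u ↔ ∃ k : ℕ, G.nodeValue u = (q : ℝ) ^ k :=
    ⟨fun ⟨_, h⟩ => h, fun h => ⟨u.2, h⟩⟩
  rw [this]
  refine exists_congr fun k => ?_
  rw [G.nodeValue_eq, ← Real.rpow_natCast, Real.rpow_right_inj (by linarith) hq1.ne']

theorem GoodNode.markingValue_eq (hq : 2 ≤ q) {G : Dag q (Fin n)} {u : Fin n} (h : GoodNode G u) :
    G.markingValue (G.succ u) = exponent G u := by
  obtain ⟨k, hk⟩ := (goodNode_iff hq G u).1 h
  rw [exponent, dif_pos u.2, Fin.eta, hk, Nat.floor_natCast]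

theorem GoodNode.nodeValue_eq (hq : 2 ≤ q) {G : Dag q (Fin n)} {u : Fin n} (h : GoodNode G u) :
    G.nodeValue u = (q : ℝ) ^ exponent G u := by
  rw [G.nodeValue_eq, h.markingValue_eq hq, Real.rpow_natCast]

theorem markingValue_eq_sum {Γ : Type*} [Fintype Γ] (G : Dag q Γ) (A : Marking q Γ) {e : Γ → ℕ}
    (h : ∀ v, (A v : ℤ) ≠ 0 → G.nodeValue v = (q : ℝ) ^ e v) :
    G.markingValue A = ((∑ v, (A v : ℤ) * (q : ℤ) ^ e v : ℤ) : ℝ) := by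
  rw [Dag.markingValue]
  push_cast
  refine Finset.sum_congr rfl fun v _ => ?_
  by_cases h0 : (A v : ℤ) = 0
  · simp [h0]
  · rw [h v h0]

theorem markingValue_eq_rowValue (hq : 2 ≤ q) (G : Dag q (Fin n)) (A : Marking q (Fin n)) {a : ℕ}
    (hP : ∀ v : Fin n, P (a + v) = A v) (h : ∀ v : Fin n, (A v : ℤ) ≠ 0 → GoodNode G v) :
    G.markingValue A = (rowValue q n P (exponent G) a : ℝ) := by
  rw [markingValue_eq_sum G A fun v hv => (h v hv).nodeValue_eq hq, rowValue, Finset.sum_range]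
  simp only [hP]

theorem abs_digit_le (d : Digit q) : |(d : ℤ)| ≤ q - 1 := by
  have := d.2.1
  have := d.2.2
  rw [abs_le]; omega

/-- Markings with good support have integer values, so being a natural number reduces to being
nonnegative. This passes from real evaluation to the integer arithmetic of the program. -/
theorem nodeSystem (hq : 2 ≤ q) (G : Dag q (Fin n)) (hP : ∀ u v : Fin n, P (n * u + v) = G.δ u v) :
    NodeSystem q n P (GoodNode G) (exponent G) := by
  have hsucc : ∀ u : Fin n, (∀ v < n, P (n * u + v) ≠ 0 → GoodNode G v) →
      G.markingValue (G.succ u) = (rowValue q n P (exponent G) (n * u) : ℝ) := fun u h =>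
    markingValue_eq_rowValue hq G _ (hP u) fun v hv => h v v.2 (by rw [hP]; exact hv)
  refine ⟨fun u hu v hv => ?_, fun u hu h => ?_, fun u hu h hg => ?_, fun D hD => ?_⟩
  · rw [hP ⟨u, hu⟩ ⟨v, hv⟩]
    exact (abs_digit_le _).trans (by omega)
  · rw [goodNode_iff hq G ⟨u, hu⟩, hsucc ⟨u, hu⟩ h]
    constructor
    · rintro ⟨k, hk⟩
      have : rowValue q n P (exponent G) (n * u) = k := by exact_mod_cast hk
      omega
    · intro h0
      obtain ⟨k, hk⟩ := Int.eq_ofNat_of_zero_le h0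
      exact ⟨k, by simp only [hk]; simp⟩
  · have h1 := hsucc ⟨u, hu⟩ h
    rw [GoodNode.markingValue_eq hq (u := ⟨u, hu⟩) hg] at h1
    exact_mod_cast h1.symm
  · obtain ⟨u, hu, huD⟩ := hD
    -- An element outside of `D` that is minimal along the edges has all its successors in `D`.
    obtain ⟨w, hw, hmin⟩ := G.wellFounded_edge.has_min {w : Fin n | (w : ℕ) ∉ D} ⟨⟨u, hu⟩, huD⟩
    refine ⟨w, w.2, hw, fun v hv h => ?_⟩
    by_contra hvD
    refine hmin ⟨v, hv⟩ hvD ?_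
    rw [hP w ⟨v, hv⟩] at h
    exact h

theorem input_row {r c : ℕ} (f : Fin r → Fin c → Digit q) (i : Fin r) (j : Fin c) :
    entry f ((c * i + j) / c) ((c * i + j) % c) = f i j := by
  have hc : 0 < c := j.pos
  rw [Nat.mul_add_div hc, Nat.mul_add_mod, Nat.div_eq_of_lt j.2, Nat.mod_eq_of_lt j.2, add_zero,
    entry, dif_pos ⟨i.2, j.2⟩]

theorem abs_entry_le (hq : 2 ≤ q) {r c : ℕ} (f : Fin r → Fin c → Digit q) (i j : ℕ) :
    |entry f i j| ≤ q - 1 := by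
  rw [entry]
  split_ifs
  · exact abs_digit_le _
  · rw [abs_zero]; omega

/-! ### The input as a memory of the array machine -/

section input

variable (G : Dag q (Fin n)) (A : Fin m → Marking q (Fin n))

/-- The memory that holds the input. -/
def inputMem : Mem := Mem.dec (inputState G A).mem

theorem enc_inputMem : (inputMem G A).enc = (inputState G A).mem := Mem.enc_dec _

theorem inputMem_pos (a : ℕ) : (inputMem G A).pos a = if a < n * n then entry G.δ (a / n) (a % n)
    else entry A ((a - n * n) / n) ((a - n * n) % n) := by
  simp only [inputMem, Mem.dec, inputState, Int.toNat_natCast]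
  rw [if_neg (by omega)]
  norm_cast

theorem inputMem_arr (k : Fin 16) (a : ℕ) : (inputMem G A).arr k a = 0 :=
  if_pos (Int.negSucc_lt_zero _)

theorem inputMem_edge (u v : Fin n) : (inputMem G A).pos (n * u + v) = G.δ u v := by
  have : n * (u + 1) ≤ n * n := Nat.mul_le_mul_left _ u.2
  rw [mul_add] at this
  rw [inputMem_pos, if_pos (by have := v.2; omega), input_row]

theorem inputMem_marking (i : Fin m) (v : Fin n) :
    (inputMem G A).pos (n * n + n * i + v) = A i v := by
  rw [inputMem_pos, if_neg (by omega), add_assoc, Nat.add_sub_cancel_left, input_row]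

/-- These addresses belong to rows m, m + 1, … of the table of markings, where `entry` returns 0.
This supplies the zero marking used for comparisons with 0. -/
theorem inputMem_offset (hn : 1 ≤ n) (v : ℕ) : (inputMem G A).pos (offset n m + v) = 0 := by
  have : (offset n m + v - n * n) / n = m + v / n := by
    rw [offset, add_assoc, Nat.add_sub_cancel_left, Nat.mul_add_div hn]
  rw [inputMem_pos, if_neg (by unfold offset; omega), this, entry,
    dif_neg fun h => absurd h.1 (Nat.not_lt.2 (Nat.le_add_right _ _))]

theorem abs_inputMem_le (hq : 2 ≤ q) (a : ℕ) : |(inputMem G A).pos a| ≤ q - 1 := by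
  rw [inputMem_pos]
  split_ifs
  · exact abs_entry_le hq _ _ _
  · exact abs_entry_le hq _ _ _

end input

/-- The bound for the numbers that occur. -/
def cellBound (q n m : ℕ) : ℤ := ((100 * q ^ 2 * (n + m + 2) ^ 2 : ℕ) : ℤ)

theorem le_cellBound (hq : 2 ≤ q) :
    10 * (q : ℤ) + 100 ≤ cellBound q n m ∧ (n : ℤ) ≤ cellBound q n m ∧
      (m : ℤ) ≤ cellBound q n m := by
  have h1 : q ≤ q ^ 2 := Nat.le_self_pow two_ne_zero q
  have h2 : n + m + 2 ≤ (n + m + 2) ^ 2 := Nat.le_self_pow two_ne_zero _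
  have h3 : q ^ 2 * (n + m + 2) ≤ q ^ 2 * (n + m + 2) ^ 2 := Nat.mul_le_mul_left _ h2
  have h4 : q ^ 2 * 2 ≤ q ^ 2 * (n + m + 2) := Nat.mul_le_mul_left _ (by omega)
  have h5 : 2 * (n + m + 2) ≤ q ^ 2 * (n + m + 2) := Nat.mul_le_mul_right _ (hq.trans h1)
  have h6 : cellBound q n m = 100 * (q ^ 2 * (n + m + 2) ^ 2 : ℕ) := by
    unfold cellBound; push_cast; ring
  omega

/-- With 100 ≤ 2 ^ 7 and q ≤ 2 ^ q the cell bound is at most (n + m + 2) ^ (7 + 2q + 2); the factor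
64 is `maxCost`. -/
theorem wordSize (hq : 2 ≤ q) :
    WordSize (cellBound q n m) (wordBound (64 * (2 * q + 9)) n m) := by
  refine ⟨by have := (le_cellBound (n := n) (m := m) hq).1; omega, ?_⟩
  unfold maxCost wordBound
  rw [mul_comm, pow_mul]
  refine pow_le_pow_left₀ (by unfold cellBound; positivity) ?_ 64
  unfold cellBound
  norm_cast
  have h1 : 100 ≤ (n + m + 2) ^ 7 :=
    (by norm_num : 100 ≤ 2 ^ 7).trans (Nat.pow_le_pow_left (by omega) 7)
  have h2 : q ≤ (n + m + 2) ^ q :=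
    Nat.lt_two_pow_self.le.trans (Nat.pow_le_pow_left (by omega) q)
  calc 100 * q ^ 2 * (n + m + 2) ^ 2
      ≤ (n + m + 2) ^ 7 * ((n + m + 2) ^ q) ^ 2 * (n + m + 2) ^ 2 :=
        Nat.mul_le_mul_right _ (Nat.mul_le_mul h1 (Nat.pow_le_pow_left h2 2))
    _ = (n + m + 2) ^ (2 * q + 9) := by ring

theorem bdd_input (hq : 2 ≤ q) (G : Dag q (Fin n)) (A : Fin m → Marking q (Fin n)) :
    Bdd (cellBound q n m) (inputState G A).reg (inputMem G A) := by
  have h := le_cellBound (n := n) (m := m) hq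
  refine ⟨fun x => ?_, fun a => (abs_inputMem_le G A hq a).trans (by omega), fun k a => ?_⟩
  · simp only [inputState]
    rw [abs_le]
    split_ifs <;> omega
  · rw [inputMem_arr, abs_zero]; omega

/-! ### The reduced circuit and the theorem -/

theorem Result.exists_output (hq : 2 ≤ q) (h : Result q n m P ex N E R M) :
    ∃ (G : Dag q (Fin N)) (u : Fin N → Fin N) (b : Fin (N - 1) → Bool)
      (A : Fin m → Marking q (Fin N)), IsOutput ⟨R, M.enc⟩ G u b A ∧ G.IsReduced u b ∧
      ∀ i : Fin m, G.markingValue (A i) = (rowValue q n P ex (n * n + n * i) : ℝ) := by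
  have hq1 : (1 : ℝ) < q := by exact_mod_cast hq
  have hdigit : ∀ {z : ℤ}, |z| ≤ q - 1 → z ∈ Set.Icc (-(q : ℤ) + 1) ((q : ℤ) - 1) := fun hz => by
    rw [abs_le] at hz
    constructor <;> omega
  -- Edges strictly decrease exponents, which is the source of acyclicity.
  have hlt : ∀ u < N, ∀ v < N, M.pos (rowAddress n m u + v) ≠ 0 → E v < E u := fun u hu v hv hne =>
    (h.node u hu).exponent_lt hq h.mono hv hne
  let G : Dag q (Fin N) :=
    { δ := fun u v => ⟨M.pos (rowAddress n m u + v), hdigit ((h.node u u.2).digit v v.2)⟩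
      acyclic := fun u hu => by
        have : ∀ v, Relation.TransGen (fun u v : Fin N => M.pos (rowAddress n m u + v) ≠ 0) u v →
            E v < E u := fun v hv => by
          induction hv with
          | single h => exact hlt _ u.2 _ (Fin.is_lt _) h
          | tail _ h ih => exact (hlt _ (Fin.is_lt _) _ (Fin.is_lt _) h).trans ih
        exact lt_irrefl _ (this u hu) }
  let A : Fin m → Marking q (Fin N) := fun i v =>
    ⟨M.pos (rowAddress n m (N + i) + v), hdigit ((h.marking i i.2).digit v v.2)⟩
  -- Induction along the edges: once the successors of u have the planned values, its row evaluates
  -- to E u.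
  have hvalue : ∀ u, G.nodeValue u = (q : ℝ) ^ E u := fun u => by
    induction u using G.wellFounded_edge.induction with
    | _ u ih =>
      rw [G.nodeValue_eq, markingValue_eq_sum G (G.succ u) (e := fun v => E v) fun v hv => ih v hv]
      have : ∑ v : Fin N, (G.succ u v : ℤ) * (q : ℤ) ^ E v = E u := by
        rw [← (h.node u u.2).sum, Finset.sum_range]
        rfl
      rw [this, Int.cast_natCast, Real.rpow_natCast]
  have hE : ∀ i j : Fin N, i < j → E i < E j := fun i j hij => strictMono_of_succ h.mono hij j.2
  have hvlt : ∀ i j : Fin N, i < j → G.nodeValue i < G.nodeValue j := fun i j hij => by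
    rw [hvalue, hvalue]
    exact pow_lt_pow_right₀ hq1 (hE i j hij)
  refine ⟨G, id, fun i => decide (E (i + 1) = E i + 1), A, ⟨h.r1, ⟨?_, fun i j => ?_⟩, fun i => ?_,
    fun i => ?_, ⟨?_, fun i j => ?_⟩⟩, ⟨fun u => ⟨_, hvalue u⟩, Function.bijective_id,
    fun v w hvw => ?_, hvlt, fun i => ?_⟩, fun i => ?_⟩
  · have := h.le
    simp only [h.r3, stride]; push_cast; omega
  · have : R 2 + R 3 * (i : ℕ) + (j : ℕ) = (rowAddress n m i + j : ℕ) := by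
      rw [h.r2, h.r3]; unfold rowAddress; push_cast; ring
    simp only [this]
    rfl
  · have : R 4 + (i : ℕ) = (offset n m + i : ℕ) := by rw [h.r4]; push_cast; rfl
    simp only [this]
    exact h.list i i.2
  · have : R 5 + (i : ℕ) = (offset n m + stride n + i : ℕ) := by rw [h.r5]; push_cast; rfl
    simp only [this, decide_eq_true_eq]
    exact h.bit i (by omega)
  · have := h.le
    simp only [h.r7, stride]; push_cast; omega
  · have : R 6 + R 7 * (i : ℕ) + (j : ℕ) = (rowAddress n m (N + i) + j : ℕ) := by
      rw [h.r6, h.r7]; unfold rowAddress; push_cast; ring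
    simp only [this]
    rfl
  · rcases lt_or_gt_of_ne hvw with h' | h'
    · exact (hvlt _ _ h').ne
    · exact (hvlt _ _ h').ne'
  · simp only [hvalue, id, decide_eq_true_eq]
    rw [← pow_succ', pow_right_inj₀ (by linarith) hq1.ne', eq_comm]
  · rw [markingValue_eq_sum G (A i) (e := fun v => E v) fun v _ => hvalue v,
      ← (h.marking i i.2).sum, Finset.sum_range]

theorem isPowerCircuit_iff (G : Dag q (Fin n)) : G.IsPowerCircuit ↔ ∀ u < n, GoodNode G u :=
  ⟨fun h u hu => ⟨hu, h ⟨u, hu⟩⟩, fun h u => (h u u.2).2⟩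

theorem exec_reduce (hq : 2 ≤ q) (G : Dag q (Fin n)) (A : Fin m → Marking q (Fin n)) :
    ∃ (s : State) (t : ℕ), Exec (wordBound (64 * (2 * q + 9)) n m) (reduce q).compile
      (inputState G A) s t ∧ t ≤ softO (400 * q + 5000) 1 (n ^ 2 + n * m) ∧
      ((s.reg 0 = 1 ∧ G.IsPowerCircuit ∧
        ∃ (n' : ℕ) (G' : Dag q (Fin n')) (u : Fin n' → Fin n') (b : Fin (n' - 1) → Bool)
          (A' : Fin m → Marking q (Fin n')), IsOutput s G' u b A' ∧ G'.IsReduced u b ∧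
          (∀ i, G'.markingValue (A' i) = G.markingValue (A i)) ∧ n' ≤ 2 * n) ∨
        (s.reg 0 = 0 ∧ ¬ G.IsPowerCircuit)) := by
  have hsmall : (reduce q).Small (cellBound q n m) := reduce_small (le_cellBound hq).1
  have hbdd := bdd_input hq G A
  have hinput : inputState G A = ⟨(inputState G A).reg, (inputMem G A).enc⟩ := by
    rw [enc_inputMem]
  rw [hinput]
  -- `Room` requires a node. For the empty circuit the program takes its trivial branch, and the
  -- untouched zero registers describe empty tables.
  obtain rfl | hn := Nat.eq_zero_or_pos n
  · have htri : ATri (cellBound q 0 m) (wordBound (64 * (2 * q + 9)) 0 m) (reduce q)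
        (inputState G A).reg (inputMem G A) 10 (fun R' _ => R' 0 = 1 ∧ ∀ x, 1 ≤ x → R' x = 0) := by
      have hK := (le_cellBound (n := 0) (m := m) hq).1
      refine ATri.cond (T₁ := 4) ⟨trivial, trivial⟩ (fun h => ?_) (fun _ => ?_)
        (by simp [AExpr.cost])
      · have h0 : (if (0 : ℤ) < 0 then (1 : ℤ) else 0) = 0 := if_neg (lt_irrefl _)
        exact absurd h0 h
      · refine ATri.wp ?_ (by simp [AProg.time, AExpr.cost])
        simp only [AProg.wp, AExpr.Safe, AExpr.eval, true_and]
        refine ⟨by omega, by omega, by simp, fun x hx => ?_⟩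
        by_cases h1 : x = 1
        · simp [h1]
        · rw [Function.update_of_ne h1, Function.update_of_ne (by omega)]
          simp [inputState, h1]
    obtain ⟨R', M', t, h₁, h₂, -, h0, h⟩ := htri (wordSize hq) hsmall hbdd
    refine ⟨_, t, h₁, h₂.trans ?_, .inl ⟨h0, fun u => u.elim0, 0, G, id, fun i => i.elim0, A, ?_,
      ?_,
      fun _ => rfl, le_rfl⟩⟩
    · have : Nat.log 2 2 = 1 := rfl
      simp [softO, this]
    · exact ⟨h 1 le_rfl, ⟨(h 3 (by omega)).ge, fun i => i.elim0⟩, fun i => i.elim0,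
        fun i => i.elim0,
        ⟨(h 7 (by omega)).ge, fun _ j => j.elim0⟩⟩
    · exact ⟨fun u => u.elim0, Function.bijective_id, fun u => u.elim0, fun u => u.elim0,
        fun i => i.elim0⟩
  · obtain ⟨R', M', t, h₁, h₂, -, h⟩ := reduce_spec ⟨hq, hn, le_rfl⟩ (by simp [inputState])
      (by simp [inputState]) (nodeSystem hq G (inputMem_edge G A))
      (fun v _ => inputMem_offset G A hn v) (fun a _ => abs_inputMem_le G A hq a)
      (inputMem_arr G A 9) (wordSize hq) hsmall hbdd
    refine ⟨_, t, h₁, h₂, ?_⟩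
    rw [isPowerCircuit_iff]
    refine h.imp (fun ⟨h0, hgood, N, E, hres⟩ => ⟨h0, hgood, ?_⟩) fun ⟨h0, u, hu, hbad⟩ =>
      ⟨h0, fun hgood => hbad (hgood u hu)⟩
    obtain ⟨G', u, b, A', hout, hred, hval⟩ := hres.exists_output hq
    refine ⟨N, G', u, b, A', hout, hred, fun i => ?_, hres.le⟩
    rw [hval, markingValue_eq_rowValue hq G (A i) (inputMem_marking G A i) fun v _ => hgood v v.2]

end ArrayMachine

theorem mainTheorem3 (q : ℕ) (hq : 2 ≤ q) :
    ∃ (P : RAM.Prog) (c C k : ℕ),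
      (∀ (n m : ℕ) (G : Dag q (Fin n)) (M : Fin m → Marking q (Fin n)), G.IsPowerCircuit →
        ∃ (s : RAM.State) (t : ℕ),
          RAM.Exec (RAM.wordBound c n m) P (RAM.inputState G M) s t ∧
          t ≤ RAM.softO C k (n ^ 2 + n * m) ∧
          ∃ (n' : ℕ) (G' : Dag q (Fin n')) (u : Fin n' → Fin n') (b : Fin (n' - 1) → Bool)
            (M' : Fin m → Marking q (Fin n')),
            RAM.IsOutput s G' u b M' ∧
            G'.IsReduced u b ∧
            (∀ i, G'.markingValue (M' i) = G.markingValue (M i)) ∧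
            n' ≤ 2 * n) ∧
      (∀ (n : ℕ) (G : Dag q (Fin n)),
        ∃ (s : RAM.State) (t : ℕ),
          RAM.Exec (RAM.wordBound c n 0) P
            (RAM.inputState G (fun i : Fin 0 => i.elim0)) s t ∧
          t ≤ RAM.softO C k (n ^ 2) ∧
          (s.reg 0 = 1 ↔ G.IsPowerCircuit)) := by
  refine ⟨(ArrayMachine.reduce q).compile, 64 * (2 * q + 9), 400 * q + 5000, 1,
    fun n m G M hG => ?_, fun n G => ?_⟩
  · obtain ⟨s, t, h₁, h₂, h⟩ := ArrayMachine.exec_reduce hq G M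
    exact ⟨s, t, h₁, h₂, (h.resolve_right fun h' => h'.2 hG).2.2⟩
  · obtain ⟨s, t, h₁, h₂, h⟩ := ArrayMachine.exec_reduce hq G fun i : Fin 0 => i.elim0
    refine ⟨s, t, h₁, h₂, ?_⟩
    obtain ⟨h0, hG, -⟩ | ⟨h0, hG⟩ := h
    · exact ⟨fun _ => hG, fun _ => h0⟩
    · exact ⟨fun h1 => absurd (h0.symm.trans h1) zero_ne_one, fun h1 => absurd h1 hG⟩
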